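/- **The language Actor.** Fix infinite totally ordered sets of actor classes $C$, method names $m$, field names $f$, variables $x$ (among them a special variable $\mathit{this}$), and, for each class $C$, an infinite totally ordered set of actor names $A\in C$ (disjoint for different classes), together with one more actor name $\aleph$, the root, which is in none of these classes. Values $U,V$ are variables and actor names. Expressions and processes are $$E ::= f \mid U \mid \mathtt{new}\,C(\tilde E),\qquad P ::= 0 \mid (f\leftarrow E).P \mid \mathtt{let}\ x=E\ \mathtt{in}\ P \mid U!m(\tilde E).P \mid [E=E']P;P' \mid P+P',$$ where $\mathtt{let}$ binds $x$ in $P$ and processes are identified up to renaming of bound variables. A *program* is a main process, a finite set of definitions $C.m(\tilde x)=P_{C,m}$, and an assignment of a tuple $\mathit{fields}(C)$ of field names to every class $C$ (non-empty for finitely many $C$ only); no actor names occur in the processes of a program; each pair $C,m$ has at most one definition; in every $\mathtt{new}\,C(\tilde E)$ the tuples $\tilde E$ and $\mathit{fields}(C)$ have the same length; and the field names occurring in $P_{C,m}$ are in $\mathit{fields}(C)$. A program is in $\mathtt{Actor^{ro}_{ba}}$ if $\mathtt{new}$ occurs only in the main process and there is no field update $(f\leftarrow E)$. **Semantics.** A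 configuration is a set of terms $A\triangleright(P,\varphi,q)$, at most one for each actor name $A$, where $\varphi$ is a partial map from fields to values and $q$ is a finite queue of messages $m(\tilde U)$. In a store $\varphi$, an expression $U$ evaluates to $U$, $f$ evaluates to $\varphi(f)$, and $\mathtt{new}\,C(\tilde E)$ evaluates $\tilde E$ to $\tilde U$, creates the actor $A\triangleright(0,[\mathit{fields}(C)\mapsto\tilde U],\varepsilon)$, where $A$ is the first unused name of class $C$, and yields $A$. In each transition one actor $A\triangleright(P,\varphi,q)$ moves, and the actors created by evaluations are added to the configuration: - $(f\leftarrow E).P$ becomes $P$ with $\varphi(f)$ set to the value of $E$; $\mathtt{let}\ x=E\ \mathtt{in}\ P$ becomes $P\{U/x\}$ with $U$ the value of $E$; - $B!m(\tilde E).P$, where $B$ is an actor of the configuration (possibly $A$ itself), becomes $P$, and $m(\tilde U)$, with $\tilde U$ the values of $\tilde E$, is appended to the queue of $B$; - $[E=E']P;P'$ becomes $P$ if $E,E'$ evaluate to the same value and $P'$ otherwise; $P+P'$ becomes $P$ or $P'$; - if $P=0$, $q=m(\tilde U)\cdot q'$, $A\in C$, and $C.m(\tilde x)=Q$ is a definition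 with $|\tilde x|=|\tilde U|$, then $q$ becomes $q'$ and $0$ becomes $Q$ with, simultaneously, $\mathit{this}$ replaced by $A$, $\tilde x$ by $\tilde U$, and the remaining free variables of $Q$ by the least unused variables, pairwise distinct. A name is unused if it does not occur (free) in the current configuration; $\mathit{this}$ always counts as used. The initial configuration is $\aleph\triangleright(P,\varnothing,\varepsilon)$ with $P$ the main process. **Statement.** The process reachability problem for $\mathtt{Actor^{ro}_{ba}}$ is decidable: there is an algorithm that, given (codes of) a program in $\mathtt{Actor^{ro}_{ba}}$ and a process $P$ (in which actor names may occur), decides whether some configuration reachable from the initial configuration of the program contains a term $A\triangleright(P',\varphi,q)$ such that $P'$ is equal to $P$ up to a bijective renaming of variables and a bijective renaming of actor names. -/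

import Mathlib

namespace ActorLang

/-! ### Names

Each of the infinite sets of names is a copy of `ℕ`, which also fixes its total order. -/

abbrev Cls := ℕ
abbrev Meth := ℕ
abbrev Fld := ℕ
abbrev Var := ℕ

/-- The special variable `this`. -/
def this : Var := 0

/-- Actor names: `root` is the name `ℵ` of the root actor, which is of none of the classes `C : Cls`
that a program can mention; the names of class `C` are `named C 0`, `named C 1`, ... -/
inductive ActorName
  | root
  | named (C : Cls) (i : ℕ)
  deriving DecidableEq

/-- Values: variables and actor names. -/
inductive Value
  | var (x : Var)
  | actor (A : ActorName)

/-- Processes are identified up to renaming of `let`-bound variables, so a bound occurrence of a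
variable is a de Bruijn index (the number of `let`s between the occurrence and its binder), and a
free occurrence is a name. -/
inductive Atom
  | bound (k : ℕ)
  | val (v : Value)

/-- Run-time expressions: atoms, fields, and `new C(E₁, ..., Eₙ)`. -/
inductive Expr
  | atom (a : Atom)
  | field (f : Fld)
  | new (C : Cls) (args : List Expr)

/-- Run-time processes: `0`, `(f ← E).P`, `let x = E in P`, `x!m(E₁, ..., Eₙ).P`, `[E = E'] P; Q`,
`P + Q`. -/
inductive Proc
  | nil
  | upd (f : Fld) (E : Expr) (P : Proc)
  | letIn (E : Expr) (P : Proc)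
  | invoke (x : Atom) (m : Meth) (args : List Expr) (P : Proc)
  | cond (E E' : Expr) (P Q : Proc)
  | plus (P Q : Proc)

/-! ### Occurrences -/

mutual
/-- All subexpressions of an expression, itself included. -/
def Expr.subs : Expr → List Expr
  | .atom a => [.atom a]
  | .field f => [.field f]
  | .new C args => .new C args :: Expr.subsList args
def Expr.subsList : List Expr → List Expr
  | [] => []
  | E :: Es => E.subs ++ Expr.subsList Es
end

/-- All expressions (and subexpressions) that occur in a process, targets of invocations
included. -/
def Proc.exprs : Proc → List Expr
  | .nil => []
  | .upd _ E P => E.subs ++ P.exprs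
  | .letIn E P => E.subs ++ P.exprs
  | .invoke x _ args P => .atom x :: (Expr.subsList args ++ P.exprs)
  | .cond E E' P Q => E.subs ++ E'.subs ++ P.exprs ++ Q.exprs
  | .plus P Q => P.exprs ++ Q.exprs

/-- The fields that are the target of an update operation in a process. -/
def Proc.updates : Proc → List Fld
  | .nil => []
  | .upd f _ P => f :: P.updates
  | .letIn _ P => P.updates
  | .invoke _ _ _ P => P.updates
  | .cond _ _ P Q => P.updates ++ Q.updates
  | .plus P Q => P.updates ++ Q.updates

/-- The variable that an expression is, if it is a free variable. -/
def Expr.asVar : Expr → Option Var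
  | .atom (.val (.var x)) => some x
  | _ => none

/-- The free variables of a process (possibly with repetitions). -/
def Proc.freeVars (P : Proc) : List Var := P.exprs.filterMap Expr.asVar

/-- No index points outside `k` enclosing binders. -/
def Atom.ClosedAt (k : ℕ) : Atom → Prop
  | .bound j => j < k
  | .val _ => True

mutual
def Expr.ClosedAt (k : ℕ) : Expr → Prop
  | .atom a => a.ClosedAt k
  | .field _ => True
  | .new _ args => Expr.ClosedAtList k args
def Expr.ClosedAtList (k : ℕ) : List Expr → Prop
  | [] => True
  | E :: Es => E.ClosedAt k ∧ Expr.ClosedAtList k Es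
end

def Proc.ClosedAt (k : ℕ) : Proc → Prop
  | .nil => True
  | .upd _ E P => E.ClosedAt k ∧ P.ClosedAt k
  | .letIn E P => E.ClosedAt k ∧ P.ClosedAt (k + 1)
  | .invoke x _ args P => x.ClosedAt k ∧ Expr.ClosedAtList k args ∧ P.ClosedAt k
  | .cond E E' P Q => E.ClosedAt k ∧ E'.ClosedAt k ∧ P.ClosedAt k ∧ Q.ClosedAt k
  | .plus P Q => P.ClosedAt k ∧ Q.ClosedAt k

/-- Every index is bound by a `let`: the terms with this property are exactly the run-time
processes up to renaming of bound variables. -/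
def Proc.LocallyClosed (P : Proc) : Prop := P.ClosedAt 0

/-! ### Substitutions -/

def Atom.mapVal (g : Value → Value) : Atom → Atom
  | .bound k => .bound k
  | .val v => .val (g v)

mutual
def Expr.mapVal (g : Value → Value) : Expr → Expr
  | .atom a => .atom (a.mapVal g)
  | .field f => .field f
  | .new C args => .new C (Expr.mapValList g args)
def Expr.mapValList (g : Value → Value) : List Expr → List Expr
  | [] => []
  | E :: Es => E.mapVal g :: Expr.mapValList g Es
end

/-- Simultaneous replacement of all free variables and actor names of a process. -/
def Proc.mapVal (g : Value → Value) : Proc → Proc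
  | .nil => .nil
  | .upd f E P => .upd f (E.mapVal g) (P.mapVal g)
  | .letIn E P => .letIn (E.mapVal g) (P.mapVal g)
  | .invoke x m args P => .invoke (x.mapVal g) m (Expr.mapValList g args) (P.mapVal g)
  | .cond E E' P Q => .cond (E.mapVal g) (E'.mapVal g) (P.mapVal g) (Q.mapVal g)
  | .plus P Q => .plus (P.mapVal g) (Q.mapVal g)

/-- The map on values that applies `θ` to the variables and fixes the actor names. -/
def Value.subst (θ : Var → Value) : Value → Value
  | .var x => θ x
  | .actor A => .actor A

/-- The map on values given by a renaming of the variables and a renaming of the actor names. -/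
def Value.rename (σ : Equiv.Perm Var) (τ : Equiv.Perm ActorName) : Value → Value
  | .var x => .var (σ x)
  | .actor A => .actor (τ A)

/-- `P` and `Q` are equal up to renaming of variables and actor names. -/
def Proc.EqUpToRenaming (P Q : Proc) : Prop :=
  ∃ (σ : Equiv.Perm Var) (τ : Equiv.Perm ActorName), Q = P.mapVal (Value.rename σ τ)

def Atom.openAt (U : Value) (k : ℕ) : Atom → Atom
  | .bound j => if j = k then .val U else .bound j
  | .val v => .val v

mutual
def Expr.openAt (U : Value) (k : ℕ) : Expr → Expr
  | .atom a => .atom (a.openAt U k)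
  | .field f => .field f
  | .new C args => .new C (Expr.openAtList U k args)
def Expr.openAtList (U : Value) (k : ℕ) : List Expr → List Expr
  | [] => []
  | E :: Es => E.openAt U k :: Expr.openAtList U k Es
end

/-- Replace the variable bound by the `k`-th enclosing binder by the value `U`. For the body `P` of
`let x = E in P`, the term `P.openAt U 0` is `P{U/x}`. -/
def Proc.openAt (U : Value) : ℕ → Proc → Proc
  | _, .nil => .nil
  | k, .upd f E P => .upd f (E.openAt U k) (P.openAt U k)
  | k, .letIn E P => .letIn (E.openAt U k) (P.openAt U (k + 1))
  | k, .invoke x m args P =>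
      .invoke (x.openAt U k) m (Expr.openAtList U k args) (P.openAt U k)
  | k, .cond E E' P Q =>
      .cond (E.openAt U k) (E'.openAt U k) (P.openAt U k) (Q.openAt U k)
  | k, .plus P Q => .plus (P.openAt U k) (Q.openAt U k)

/-! ### Programs -/

/-- A definition `C.m(x₁, ..., xₙ) = P`. -/
structure MethodDef where
  cls : Cls
  meth : Meth
  params : List Var
  body : Proc

/-- A program: a main process, a table of the fields of the actor classes, and a finite set of
definitions. -/
structure Program where
  main : Proc
  fieldTable : List (Cls × List Fld)
  defs : List MethodDef

/-- The tuple of field names of a class (the empty tuple if the class is not in the table). -/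
def Program.fields (Pr : Program) (C : Cls) : List Fld :=
  (Pr.fieldTable.lookup C).getD []

/-- Terms of the source language: no dangling indices, no actor names. -/
def Proc.IsSource (P : Proc) : Prop :=
  P.LocallyClosed ∧ ∀ A, Expr.atom (.val (.actor A)) ∉ P.exprs

/-- `new C(E₁, ..., Eₙ)` is only applied to as many arguments as the class has fields. -/
def Program.NewArity (Pr : Program) (P : Proc) : Prop :=
  ∀ C args, Expr.new C args ∈ P.exprs → args.length = (Pr.fields C).length

/-- Source programs that are unambiguous and correct. -/
structure Program.WellFormed (Pr : Program) : Prop where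
  main_source : Pr.main.IsSource
  body_source : ∀ d ∈ Pr.defs, d.body.IsSource
  unambiguous : ∀ d ∈ Pr.defs, ∀ d' ∈ Pr.defs, d.cls = d'.cls → d.meth = d'.meth → d = d'
  main_newArity : Pr.NewArity Pr.main
  body_newArity : ∀ d ∈ Pr.defs, Pr.NewArity d.body
  body_fields : ∀ d ∈ Pr.defs, ∀ f,
    (Expr.field f ∈ d.body.exprs ∨ f ∈ d.body.updates) → f ∈ Pr.fields d.cls

/-- Bounded actors: `new` occurs in the main process only. -/
def Program.BoundedActors (Pr : Program) : Prop :=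
  ∀ d ∈ Pr.defs, ∀ C args, Expr.new C args ∉ d.body.exprs

/-- Read-only fields: there is no field update operation. -/
def Program.ReadOnly (Pr : Program) : Prop :=
  Pr.main.updates = [] ∧ ∀ d ∈ Pr.defs, d.body.updates = []

/-! ### Operational semantics -/

/-- A message `m(U₁, ..., Uₙ)`. -/
structure Msg where
  meth : Meth
  args : List Value

/-- The partial map from fields to values that is stored by an actor. -/
abbrev Store := Fld → Option Value

/-- `(P, φ, q)`. -/
structure ActorState where
  proc : Proc
  store : Store
  queue : List Msg

/-- A configuration: a set of terms `A ▷ (P, φ, q)`, at most one for each actor name `A`. -/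
abbrev Config := ActorName → Option ActorState

/-- The store `[f₁ ↦ U₁, ..., fₙ ↦ Uₙ]`. -/
def mkStore (fs : List Fld) (Us : List Value) : Store :=
  fun f => (fs.zip Us).lookup f

/-- The first unused actor name of class `C`. (The source language has no actor names, so the actor
names that occur in a configuration of a program are those of its actors.) -/
noncomputable def Config.freshActor (S : Config) (C : Cls) : ActorName :=
  .named C (sInf {i | S (.named C i) = none})

/-- The variable `x` occurs free in the process, the store or the queue of an actor, or is
`this`. -/
def Config.UsedVar (S : Config) (x : Var) : Prop :=
  x = this ∨ ∃ A s, S A = some s ∧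
    (x ∈ s.proc.freeVars ∨ (∃ f, s.store f = some (.var x)) ∨
      ∃ msg ∈ s.queue, Value.var x ∈ msg.args)

/-- The `k`-th (from `0`) of the unused variables in increasing order. -/
noncomputable def Config.freshVar (S : Config) (k : ℕ) : Var :=
  Nat.nth (fun x => ¬ S.UsedVar x) k

mutual
/-- `Eval Pr φ S E U S'`: in the store `φ` of an actor of the configuration `S`, the expression `E`
evaluates to `U`, and `S'` is `S` together with the actors created by the evaluation. -/
inductive Eval (Pr : Program) (φ : Store) : Config → Expr → Value → Config → Prop
  | val (S : Config) (U : Value) : Eval Pr φ S (.atom (.val U)) U S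
  | field (S : Config) (f : Fld) (U : Value) (h : φ f = some U) : Eval Pr φ S (.field f) U S
  | new (S S' : Config) (C : Cls) (args : List Expr) (Us : List Value)
      (h : EvalList Pr φ S args Us S') :
      Eval Pr φ S (.new C args) (.actor (S'.freshActor C))
        (Function.update S' (S'.freshActor C) (some ⟨.nil, mkStore (Pr.fields C) Us, []⟩))
inductive EvalList (Pr : Program) (φ : Store) :
    Config → List Expr → List Value → Config → Prop
  | nil (S : Config) : EvalList Pr φ S [] [] S
  | cons (S S' S'' : Config) (E : Expr) (Es : List Expr) (U : Value) (Us : List Value)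
      (h : Eval Pr φ S E U S') (hs : EvalList Pr φ S' Es Us S'') :
      EvalList Pr φ S (E :: Es) (U :: Us) S''
end

/-- The free variables of a method body other than `this` and the formal parameters, without
repetitions. -/
def MethodDef.localVars (d : MethodDef) : List Var :=
  (d.body.freeVars.filter (fun x => x ≠ this ∧ x ∉ d.params)).dedup

/-- The body of the method `d`, instantiated in the configuration `S` for the actor `A` and the
arguments `Us`: `this` is replaced by `A`, the formal parameters by `Us`, and the other free
variables by the least unused variables. -/
noncomputable def MethodDef.instantiate (d : MethodDef) (S : Config) (A : ActorName)
    (Us : List Value) : Proc :=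
  d.body.mapVal (Value.subst fun x =>
    if x = this then .actor A
    else match (d.params.zip Us).lookup x with
      | some U => U
      | none => .var (S.freshVar (d.localVars.idxOf x)))

/-- The transition relation between configurations. -/
inductive Step (Pr : Program) : Config → Config → Prop
  | upd (S S' : Config) (A : ActorName) (f : Fld) (E : Expr) (P : Proc) (φ : Store)
      (q : List Msg) (U : Value)
      (hA : S A = some ⟨.upd f E P, φ, q⟩) (hE : Eval Pr φ S E U S') :
      Step Pr S (Function.update S' A (some ⟨P, Function.update φ f (some U), q⟩))
  | letIn (S S' : Config) (A : ActorName) (E : Expr) (P : Proc) (φ : Store) (q : List Msg)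
      (U : Value)
      (hA : S A = some ⟨.letIn E P, φ, q⟩) (hE : Eval Pr φ S E U S') :
      Step Pr S (Function.update S' A (some ⟨P.openAt U 0, φ, q⟩))
  | invokeSelf (S S' : Config) (A : ActorName) (m : Meth) (Es : List Expr) (P : Proc)
      (φ : Store) (q : List Msg) (Us : List Value)
      (hA : S A = some ⟨.invoke (.val (.actor A)) m Es P, φ, q⟩)
      (hE : EvalList Pr φ S Es Us S') :
      Step Pr S (Function.update S' A (some ⟨P, φ, q ++ [⟨m, Us⟩]⟩))
  | invoke (S S' : Config) (A B : ActorName) (m : Meth) (Es : List Expr) (P Q : Proc)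
      (φ ψ : Store) (q r : List Msg) (Us : List Value) (hAB : A ≠ B)
      (hA : S A = some ⟨.invoke (.val (.actor B)) m Es P, φ, q⟩)
      (hB : S B = some ⟨Q, ψ, r⟩)
      (hE : EvalList Pr φ S Es Us S') :
      Step Pr S (Function.update (Function.update S' A (some ⟨P, φ, q⟩)) B
        (some ⟨Q, ψ, r ++ [⟨m, Us⟩]⟩))
  | inst (S : Config) (C : Cls) (i : ℕ) (d : MethodDef) (φ : Store) (Us : List Value)
      (q : List Msg) (hd : d ∈ Pr.defs) (hC : d.cls = C)
      (hlen : d.params.length = Us.length)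
      (hA : S (.named C i) = some ⟨.nil, φ, ⟨d.meth, Us⟩ :: q⟩) :
      Step Pr S (Function.update S (.named C i)
        (some ⟨d.instantiate S (.named C i) Us, φ, q⟩))
  | eqMatch (S S' : Config) (A : ActorName) (E E' : Expr) (P Q : Proc) (φ : Store)
      (q : List Msg) (U : Value)
      (hA : S A = some ⟨.cond E E' P Q, φ, q⟩)
      (hE : EvalList Pr φ S [E, E'] [U, U] S') :
      Step Pr S (Function.update S' A (some ⟨P, φ, q⟩))
  | neMatch (S S' : Config) (A : ActorName) (E E' : Expr) (P Q : Proc) (φ : Store)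
      (q : List Msg) (U V : Value) (hUV : U ≠ V)
      (hA : S A = some ⟨.cond E E' P Q, φ, q⟩)
      (hE : EvalList Pr φ S [E, E'] [U, V] S') :
      Step Pr S (Function.update S' A (some ⟨Q, φ, q⟩))
  | plusLeft (S : Config) (A : ActorName) (P Q : Proc) (φ : Store) (q : List Msg)
      (hA : S A = some ⟨.plus P Q, φ, q⟩) :
      Step Pr S (Function.update S A (some ⟨P, φ, q⟩))
  | plusRight (S : Config) (A : ActorName) (P Q : Proc) (φ : Store) (q : List Msg)
      (hA : S A = some ⟨.plus P Q, φ, q⟩) :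
      Step Pr S (Function.update S A (some ⟨Q, φ, q⟩))

/-- The initial configuration `ℵ ▷ (P, ∅, ε)`, where `P` is the main process. -/
def Program.initial (Pr : Program) : Config
  | .root => some ⟨Pr.main, fun _ => none, []⟩
  | .named _ _ => none

/-- Some computation of the program traverses a configuration with a term `A ▷ (P', φ, q)` such that
`P'` is equal to `P` up to renaming of variables and actor names. -/
def Program.ReachesProc (Pr : Program) (P : Proc) : Prop :=
  ∃ S, Relation.ReflTransGen (Step Pr) Pr.initial S ∧
    ∃ A s, S A = some s ∧ P.EqUpToRenaming s.proc

/-! ### Codes of programs and processes as natural numbers, for use as inputs of algorithms -/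

/-- The code of a finite sequence of natural numbers. -/
def codeList : List ℕ → ℕ
  | [] => 0
  | n :: l => Nat.pair n (codeList l) + 1

def ActorName.code : ActorName → ℕ
  | .root => 0
  | .named C i => Nat.pair C i + 1

def Value.code : Value → ℕ
  | .var x => Nat.pair 0 x
  | .actor A => Nat.pair 1 A.code

def Atom.code : Atom → ℕ
  | .bound k => Nat.pair 0 k
  | .val v => Nat.pair 1 v.code

mutual
def Expr.code : Expr → ℕ
  | .atom a => Nat.pair 0 a.code
  | .field f => Nat.pair 1 f
  | .new C args => Nat.pair 2 (Nat.pair C (Expr.codeArgs args))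
def Expr.codeArgs : List Expr → ℕ
  | [] => 0
  | E :: Es => Nat.pair E.code (Expr.codeArgs Es) + 1
end

def Proc.code : Proc → ℕ
  | .nil => Nat.pair 0 0
  | .upd f E P => Nat.pair 1 (Nat.pair f (Nat.pair E.code P.code))
  | .letIn E P => Nat.pair 2 (Nat.pair E.code P.code)
  | .invoke x m args P =>
      Nat.pair 3 (Nat.pair x.code (Nat.pair m (Nat.pair (Expr.codeArgs args) P.code)))
  | .cond E E' P Q =>
      Nat.pair 4 (Nat.pair E.code (Nat.pair E'.code (Nat.pair P.code Q.code)))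
  | .plus P Q => Nat.pair 5 (Nat.pair P.code Q.code)

def MethodDef.code (d : MethodDef) : ℕ :=
  Nat.pair d.cls (Nat.pair d.meth (Nat.pair (codeList d.params) d.body.code))

def Program.code (Pr : Program) : ℕ :=
  Nat.pair Pr.main.code
    (Nat.pair (codeList (Pr.fieldTable.map fun e => Nat.pair e.1 (codeList e.2)))
      (codeList (Pr.defs.map MethodDef.code)))

end ActorLang

-- Methods neither update fields nor create actors. So the actors are created by the main process
-- alone, their number is bounded by the code of the program, and an actor remembers nothing between
-- two messages: what it does with a message depends on that message and on its constant store. Only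
-- two things remain unbounded, the fresh variables and the queues.
--
-- Fresh variables. Stores and the main process contain only variables of the main process. Any
-- other variable can be compared only with variables that came with the same message, or with those
-- that the running method has introduced itself, because it is forgotten when the method ends.
-- Hence identities of such variables across different messages never matter: every message may be
-- renamed separately (`MsgRel` chooses one matching per message), and the position of the first
-- occurrence in the argument tuple serves as a name. So finitely many messages suffice. A machine
-- on natural numbers works with these canonical messages and with closures instead of substituted
-- terms; it simulates the program and is simulated by it (`Sim.move_of_step`, `Sim.step_of_move`),
-- and a test on serialized terms decides equality up to renaming (`closureMatches_iff`).
--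
-- Queues. The core is a bound on the length of a shortest run to a goal, for actors without memory
-- (`ActorSystem.exists_run_le`). Trace the goal back: the goal process was started by a message,
-- which was sent while an earlier message was processed, and so on back to the main component. This
-- yields a chain of messages. All other messages and processes matter only as obstacles: before a
-- link of the chain is taken from a queue, the actor has to complete its current process and
-- everything in front of the link. `MsgOk ws A m` and `ProcOk ws A p` say that `m` or `p` is no
-- obstacle if the remaining chain visits the actors `ws` in this order. Reading a run backwards
-- shows that every reachable goal has a chain without obstacles (`covered_of_run`). The obstacle
-- conditions become weaker when visits are deleted (`msgOk_mono`), so the part of a chain between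
-- two occurrences of the same message can be cut out (`Wins.exists_nodup`); a chain without
-- repetitions is no longer than the number of messages. Conversely, a chain without obstacles can
-- be executed by letting act only the main component, up to the first link, and then the actors of
-- the chain in turn (`MainWins.exists_run`). Each visit empties a queue up to the next link and
-- enlarges the bound for the queues by a factor linear in the size of the processes, which gives an
-- exponential bound for the whole run.
--
-- The decision procedure explores all runs of the machine up to this bound; the search is primitive
-- recursive (`primrecPred_machineReaches`).

/-! ### Primitive recursive functions, in a form that `fun_prop` composes -/

attribute [fun_prop] Primrec PrimrecPred

namespace ActorLang

section PrimrecRules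
variable {α β γ σ : Type*} [Primcodable α] [Primcodable β] [Primcodable γ] [Primcodable σ]

@[fun_prop] theorem primrec_id : Primrec (fun a : α => a) := Primrec.id

@[fun_prop] theorem primrec_const (c : β) : Primrec (fun _ : α => c) := Primrec.const c

@[fun_prop] theorem primrec_comp {f : β → γ} {g : α → β} (hf : Primrec f) (hg : Primrec g) :
    Primrec (fun a => f (g a)) := hf.comp hg

@[fun_prop] theorem primrec_fst {f : α → β × γ} (hf : Primrec f) : Primrec (fun a => (f a).1) :=
  Primrec.fst.comp hf

@[fun_prop] theorem primrec_snd {f : α → β × γ} (hf : Primrec f) : Primrec (fun a => (f a).2) :=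
  Primrec.snd.comp hf

@[fun_prop] theorem primrec_mk {f : α → β} {g : α → γ} (hf : Primrec f) (hg : Primrec g) :
    Primrec (fun a => (f a, g a)) := hf.pair hg

@[fun_prop] theorem primrec_add {f g : α → ℕ} (hf : Primrec f) (hg : Primrec g) :
    Primrec fun a => f a + g a := Primrec.nat_add.comp hf hg

@[fun_prop] theorem primrec_sub {f g : α → ℕ} (hf : Primrec f) (hg : Primrec g) :
    Primrec fun a => f a - g a := Primrec.nat_sub.comp hf hg

@[fun_prop] theorem primrec_mul {f g : α → ℕ} (hf : Primrec f) (hg : Primrec g) :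
    Primrec fun a => f a * g a := Primrec.nat_mul.comp hf hg

@[fun_prop] theorem primrec_pow {f g : α → ℕ} (hf : Primrec f) (hg : Primrec g) :
    Primrec fun a => f a ^ g a := by
  refine (Primrec.nat_rec' (h := fun a p => p.2 * f a) hg (Primrec.const 1)
    (Primrec.nat_mul.comp (Primrec.snd.comp Primrec.snd) (hf.comp Primrec.fst))).of_eq ?_
  intro a
  induction g a with
  | zero => rfl
  | succ n ih => rw [pow_succ, ← ih]

@[fun_prop] theorem primrec_natPair {f g : α → ℕ} (hf : Primrec f) (hg : Primrec g) :
    Primrec fun a => Nat.pair (f a) (g a) := Primrec₂.natPair.comp hf hg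

@[fun_prop] theorem primrec_unpair {f : α → ℕ} (hf : Primrec f) :
    Primrec fun a => (f a).unpair := Primrec.unpair.comp hf

@[fun_prop] theorem primrecPred_eq [DecidableEq β] {f g : α → β} (hf : Primrec f)
    (hg : Primrec g) : PrimrecPred fun a => f a = g a := Primrec.eq.comp hf hg

@[fun_prop] theorem primrecPred_lt {f g : α → ℕ} (hf : Primrec f) (hg : Primrec g) :
    PrimrecPred fun a => f a < g a := Primrec.nat_lt.comp hf hg

@[fun_prop] theorem primrecPred_not {p : α → Prop} (hp : PrimrecPred p) :
    PrimrecPred fun a => ¬ p a := hp.not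

@[fun_prop] theorem primrecPred_ne [DecidableEq β] {f g : α → β} (hf : Primrec f)
    (hg : Primrec g) : PrimrecPred fun a => f a ≠ g a := (Primrec.eq.comp hf hg).not

@[fun_prop] theorem primrecPred_and {p q : α → Prop} (hp : PrimrecPred p) (hq : PrimrecPred q) :
    PrimrecPred fun a => p a ∧ q a := hp.and hq

@[fun_prop] theorem primrecPred_or {p q : α → Prop} (hp : PrimrecPred p) (hq : PrimrecPred q) :
    PrimrecPred fun a => p a ∨ q a := hp.or hq

@[fun_prop] theorem primrecPred_imp {p q : α → Prop} (hp : PrimrecPred p) (hq : PrimrecPred q) :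
    PrimrecPred fun a => p a → q a := by
  classical
  exact (hp.not.or hq).of_eq fun a => imp_iff_not_or.symm

@[fun_prop] theorem primrecPred_iff {p q : α → Prop} (hp : PrimrecPred p) (hq : PrimrecPred q) :
    PrimrecPred fun a => p a ↔ q a :=
  ((primrecPred_imp hp hq).and (primrecPred_imp hq hp)).of_eq fun _ => iff_def.symm

@[fun_prop] theorem primrec_ite {c : α → Prop} [DecidablePred c] {f g : α → β}
    (hc : PrimrecPred c) (hf : Primrec f) (hg : Primrec g) :
    Primrec fun a => if c a then f a else g a := Primrec.ite hc hf hg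

@[fun_prop] theorem primrec_some {f : α → β} (hf : Primrec f) :
    Primrec fun a => some (f a) := Primrec.option_some.comp hf

@[fun_prop] theorem primrec_optionMap {f : α → Option β} {g : α → β → σ} (hf : Primrec f)
    (hg : Primrec fun p : α × β => g p.1 p.2) : Primrec fun a => (f a).map (g a) :=
  Primrec.option_map hf hg

@[fun_prop] theorem primrec_optionBind {f : α → Option β} {g : α → β → Option σ}
    (hf : Primrec f) (hg : Primrec fun p : α × β => g p.1 p.2) :
    Primrec fun a => (f a).bind (g a) := Primrec.option_bind hf hg

@[fun_prop] theorem primrec_getD {f : α → Option β} {g : α → β} (hf : Primrec f)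
    (hg : Primrec g) : Primrec fun a => (f a).getD (g a) := Primrec.option_getD.comp hf hg

@[fun_prop] theorem primrec_isSome {f : α → Option β} (hf : Primrec f) :
    Primrec fun a => (f a).isSome := Primrec.option_isSome.comp hf

@[fun_prop] theorem primrec_toList {f : α → Option β} (hf : Primrec f) :
    Primrec fun a => (f a).toList :=
  (Primrec.option_casesOn (f := fun _ => ([] : List β)) (g := fun _ b => [b]) hf
    (Primrec.const []) (Primrec.list_cons.comp Primrec.snd (Primrec.const []))).of_eq
    fun a => by cases f a <;> rfl

@[fun_prop] theorem primrec_cons {f : α → β} {g : α → List β} (hf : Primrec f)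
    (hg : Primrec g) : Primrec fun a => f a :: g a := Primrec.list_cons.comp hf hg

@[fun_prop] theorem primrec_append {f g : α → List β} (hf : Primrec f) (hg : Primrec g) :
    Primrec fun a => f a ++ g a := Primrec.list_append.comp hf hg

@[fun_prop] theorem primrec_map {f : α → List β} {g : α → β → σ} (hf : Primrec f)
    (hg : Primrec fun p : α × β => g p.1 p.2) : Primrec fun a => (f a).map (g a) :=
  Primrec.list_map hf hg

@[fun_prop] theorem primrec_flatMap {f : α → List β} {g : α → β → List σ} (hf : Primrec f)
    (hg : Primrec fun p : α × β => g p.1 p.2) : Primrec fun a => (f a).flatMap (g a) :=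
  Primrec.list_flatMap hf hg

@[fun_prop] theorem primrec_filterMap {f : α → List β} {g : α → β → Option σ} (hf : Primrec f)
    (hg : Primrec fun p : α × β => g p.1 p.2) : Primrec fun a => (f a).filterMap (g a) :=
  Primrec.listFilterMap hf hg

@[fun_prop] theorem primrec_foldl {f : α → List β} {g : α → σ} {h : α → σ → β → σ}
    (hf : Primrec f) (hg : Primrec g) (hh : Primrec fun p : α × σ × β => h p.1 p.2.1 p.2.2) :
    Primrec fun a => (f a).foldl (h a) (g a) :=
  Primrec.list_foldl (h := fun a p => h a p.1 p.2) hf hg hh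

@[fun_prop] theorem primrec_length {f : α → List β} (hf : Primrec f) :
    Primrec fun a => (f a).length := Primrec.list_length.comp hf

@[fun_prop] theorem primrec_reverse {f : α → List β} (hf : Primrec f) :
    Primrec fun a => (f a).reverse := Primrec.list_reverse.comp hf

@[fun_prop] theorem primrec_range {f : α → ℕ} (hf : Primrec f) :
    Primrec fun a => List.range (f a) := Primrec.list_range.comp hf

@[fun_prop] theorem primrec_take {f : α → ℕ} {g : α → List β} (hf : Primrec f)
    (hg : Primrec g) : Primrec fun a => (g a).take (f a) := Primrec.list_take.comp hf hg

@[fun_prop] theorem primrec_drop {f : α → ℕ} {g : α → List β} (hf : Primrec f)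
    (hg : Primrec g) : Primrec fun a => (g a).drop (f a) := Primrec.list_drop.comp hf hg

@[fun_prop] theorem primrec_getElem? {f : α → List β} {g : α → ℕ} (hf : Primrec f)
    (hg : Primrec g) : Primrec fun a => (f a)[g a]? := Primrec.list_getElem?.comp hf hg

@[fun_prop] theorem primrec_idxOf [DecidableEq β] {f : α → β} {g : α → List β}
    (hf : Primrec f) (hg : Primrec g) : Primrec fun a => (g a).idxOf (f a) :=
  Primrec.list_idxOf.comp hf hg

@[fun_prop] theorem primrec_lookup [DecidableEq β] {f : α → β} {g : α → List (β × γ)}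
    (hf : Primrec f) (hg : Primrec g) : Primrec fun a => (g a).lookup (f a) :=
  Primrec.listLookup.comp hf hg

@[fun_prop] theorem primrec_headI {f : α → List ℕ} (hf : Primrec f) :
    Primrec fun a => (f a).headI := Primrec.list_headI.comp hf

@[fun_prop] theorem primrec_tail {f : α → List β} (hf : Primrec f) :
    Primrec fun a => (f a).tail := Primrec.list_tail.comp hf

@[fun_prop] theorem primrec_head? {f : α → List β} (hf : Primrec f) :
    Primrec fun a => (f a).head? := Primrec.list_head?.comp hf

@[fun_prop] theorem primrec_filter {f : α → List β} {p : α → β → Prop}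
    [∀ a, DecidablePred (p a)] (hf : Primrec f) (hp : PrimrecPred fun x : α × β => p x.1 x.2) :
    Primrec fun a => (f a).filter fun b => p a b := by
  refine (primrec_filterMap (g := fun a b => if p a b then some b else none) hf
    (@primrec_ite _ _ _ _ (fun x : α × β => p x.1 x.2) (fun x => inferInstance) _ _ hp
      (by fun_prop) (by fun_prop))).of_eq ?_
  intro a
  induction f a with
  | nil => rfl
  | cons b l ih => by_cases h : p a b <;> simp [h, ih]

@[fun_prop] theorem primrecPred_forallMem {f : α → List β} {p : α → β → Prop} (hf : Primrec f)
    (hp : PrimrecPred fun x : α × β => p x.1 x.2) : PrimrecPred fun a => ∀ b ∈ f a, p a b := by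
  classical
  refine (primrecPred_eq (f := fun a => (f a).filter fun b => ¬ p a b) (g := fun _ => [])
    (primrec_filter hf (by fun_prop)) (by fun_prop)).of_eq ?_
  intro a
  simp

@[fun_prop] theorem primrecPred_existsMem {f : α → List β} {p : α → β → Prop} (hf : Primrec f)
    (hp : PrimrecPred fun x : α × β => p x.1 x.2) : PrimrecPred fun a => ∃ b ∈ f a, p a b := by
  refine (primrecPred_not (primrecPred_forallMem (p := fun a b => ¬ p a b) hf
    (primrecPred_not hp))).of_eq ?_
  intro a
  simp

@[fun_prop] theorem primrec_zip {f : α → List β} {g : α → List γ} (hf : Primrec f)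
    (hg : Primrec g) : Primrec fun a => (f a).zip (g a) := by
  have : Primrec fun a => (List.range (f a).length).filterMap fun i =>
      ((f a)[i]?).bind fun b => ((g a)[i]?).map fun c => (b, c) := by fun_prop
  refine this.of_eq fun a => ?_
  generalize f a = l
  generalize g a = l'
  induction l generalizing l' with
  | nil => simp
  | cons b l ih =>
    cases l' with
    | nil => simp
    | cons c l' =>
      rw [List.length_cons, List.range_succ_eq_map, List.filterMap_cons, List.filterMap_map]
      simpa [Function.comp_def] using ih l'

@[fun_prop] theorem primrec_listOfNat {f : α → ℕ} (hf : Primrec f) :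
    Primrec fun a => Denumerable.ofNat (List ℕ) (f a) := (Primrec.ofNat (List ℕ)).comp hf

@[fun_prop] theorem primrec_iterate {f : α → ℕ} {g : α → β} {h : α → β → β} (hf : Primrec f)
    (hg : Primrec g) (hh : Primrec fun p : α × β => h p.1 p.2) :
    Primrec fun a => (h a)^[f a] (g a) := Primrec.nat_iterate hf hg hh

end PrimrecRules

/-- The table of the first `n` values of the function defined by course-of-values recursion
with the body `g`. -/
def courseTable {σ : Type*} (g : List σ → σ) : ℕ → List σ
  | 0 => []
  | n + 1 => courseTable g n ++ [g (courseTable g n)]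

/-- Course-of-values recursion. -/
def courseRec {σ : Type*} (g : List σ → σ) (n : ℕ) : σ := g (courseTable g n)

@[simp] theorem length_courseTable {σ : Type*} (g : List σ → σ) (n : ℕ) :
    (courseTable g n).length = n := by
  induction n with
  | zero => rfl
  | succ n ih => simp [courseTable, ih]

theorem courseTable_getElem? {σ : Type*} (g : List σ → σ) {m n : ℕ} (h : m < n) :
    (courseTable g n)[m]? = some (courseRec g m) := by
  induction n with
  | zero => omega
  | succ n ih =>
    rw [courseTable]
    rcases Nat.lt_succ_iff_lt_or_eq.1 h with h | rfl
    · rw [List.getElem?_append_left (by simpa using h), ih h]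
    · simp [courseRec]

theorem primrec_courseRec {σ : Type*} [Primcodable σ] {g : List σ → σ} (hg : Primrec g) :
    Primrec (courseRec g) := by
  have h : Primrec (courseTable g) := by
    refine (Primrec.nat_rec₁ (f := fun _ l => l ++ [g l]) ([] : List σ)
      (Primrec.list_append.comp Primrec.snd (Primrec.list_cons.comp (hg.comp Primrec.snd)
        (Primrec.const [])))).of_eq fun n => ?_
    induction n with
    | zero => rfl
    | succ n ih => simp only [courseTable, ← ih]
  exact hg.comp h

end ActorLang

/-! ### A machine on natural numbers that simulates the programs -/

namespace ActorLang

/-- A symbol of a serialized term: its kind and two parameters. Kinds `0`, ..., `3` are those of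
expressions (bound variables, values, fields, `new`), and `4`, ..., `9` those of processes. -/
abbrev Token := ℕ × ℕ × ℕ

/-- The serializations of the expression, the tuple of expressions, and the process with a given
code. -/
abbrev TokenTriple := List Token × List Token × List Token

/-- The third component of a token for a bound variable counts the `let`s of the serialized term
around the occurrence. The occurrence is bound inside the term iff its index is below this count;
otherwise the difference is a position in the environment of a closure. -/
def liftToken (t : Token) : Token := if t.1 = 0 then (0, t.2.1, t.2.2 + 1) else t

def atomTokens (r : ℕ) : List Token :=
  if r.unpair.1 = 0 then [(0, r.unpair.2, 0)] else [(1, r.unpair.2, 0)]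

def codeLength (n : ℕ) : ℕ := (Denumerable.ofNat (List ℕ) n).length

def tripleAt (l : List TokenTriple) (m : ℕ) : TokenTriple := (l[m]?).getD ([], [], [])

/-- The table `l` holds the results for all smaller codes, so `l.length` is the code under
consideration. Terms are written in postfix order, with the arity in the token of `new`: evaluation
becomes a left fold with a stack, and a serialization can be parsed from its end. -/
def exprTokensStep (l : List TokenTriple) : List Token :=
  if l.length.unpair.1 = 0 then atomTokens l.length.unpair.2
  else if l.length.unpair.1 = 1 then [(2, l.length.unpair.2, 0)]
  else (tripleAt l l.length.unpair.2.unpair.2).2.1 ++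
    [(3, l.length.unpair.2.unpair.1, codeLength l.length.unpair.2.unpair.2)]

def argsTokensStep (l : List TokenTriple) : List Token :=
  if l.length = 0 then []
  else (tripleAt l (l.length - 1).unpair.1).1 ++ (tripleAt l (l.length - 1).unpair.2).2.1

/-- The case of processes, for the process with the constructor `t` and the components coded by
`r`. -/
def procTokensCase (l : List TokenTriple) (t r : ℕ) : List Token :=
  if t = 0 then [(4, 0, 0)]
  else if t = 1 then
    (tripleAt l r.unpair.2.unpair.1).1 ++ (tripleAt l r.unpair.2.unpair.2).2.2 ++
      [(5, r.unpair.1, 0)]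
  else if t = 2 then
    (tripleAt l r.unpair.1).1 ++ (tripleAt l r.unpair.2).2.2.map liftToken ++ [(6, 0, 0)]
  else if t = 3 then
    atomTokens r.unpair.1 ++ (tripleAt l r.unpair.2.unpair.2.unpair.1).2.1 ++
      (tripleAt l r.unpair.2.unpair.2.unpair.2).2.2 ++
      [(7, r.unpair.2.unpair.1, codeLength r.unpair.2.unpair.2.unpair.1)]
  else if t = 4 then
    (tripleAt l r.unpair.1).1 ++ (tripleAt l r.unpair.2.unpair.1).1 ++
      (tripleAt l r.unpair.2.unpair.2.unpair.1).2.2 ++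
      (tripleAt l r.unpair.2.unpair.2.unpair.2).2.2 ++ [(8, 0, 0)]
  else (tripleAt l r.unpair.1).2.2 ++ (tripleAt l r.unpair.2).2.2 ++ [(9, 0, 0)]

def tokensStep (l : List TokenTriple) : TokenTriple :=
  (exprTokensStep l, argsTokensStep l,
    procTokensCase l l.length.unpair.1 l.length.unpair.2)

def tokens : ℕ → TokenTriple := courseRec tokensStep

def exprTokens (n : ℕ) : List Token := (tokens n).1
def argsTokens (n : ℕ) : List Token := (tokens n).2.1
def procTokens (n : ℕ) : List Token := (tokens n).2.2

/-- The code of a process, the values of the bound variables, an assignment for some of its free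
variables, and a shift for the others. -/
abbrev Closure := ℕ × List ℕ × List (ℕ × ℕ) × ℕ

abbrev Message := ℕ × List ℕ

/-- The names of the actors, with their stores. -/
abbrev Actors := List (ℕ × List (ℕ × ℕ))

/-- The actors and the state of the root actor. -/
abbrev MainState := Actors × Closure

abbrev LocalState := Closure × List Message

/-- The last component lists the states of the actors other than the root actor, where a later
entry for the same actor is void. -/
abbrev Machine := MainState × List (ℕ × LocalState)

/-- The shift plays the role of choosing fresh variables. It is `0` for the main process, whose
variables keep their names. -/
def resolve (c : Closure) (v : ℕ) : ℕ :=
  if v.unpair.1 = 0 then (c.2.2.1.lookup v.unpair.2).getD (Nat.pair 0 (c.2.2.2 + v.unpair.2)) else v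

/-- As a value, `named C i` has the code `Nat.pair 1 (Nat.pair C i + 1)` and the root has `Nat.pair
1 0`; the first two conditions exclude variables and the root. -/
def hasClass (v C : ℕ) : Prop :=
  v.unpair.1 ≠ 0 ∧ v.unpair.2 ≠ 0 ∧ (v.unpair.2 - 1).unpair.1 = C

instance (v C : ℕ) : Decidable (hasClass v C) := inferInstanceAs (Decidable (_ ∧ _ ∧ _))

/-- The names of a class are used up in order, so the number of its actors is the first unused
index. -/
def newName (acts : Actors) (C : ℕ) : ℕ :=
  Nat.pair 1 (Nat.pair C (acts.filter fun e => hasClass e.1 C).length + 1)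

def fieldsOf (n C : ℕ) : List ℕ :=
  ((((Denumerable.ofNat (List ℕ) n.unpair.2.unpair.1).map Nat.unpair).lookup C).map
    fun fs => Denumerable.ofNat (List ℕ) fs).getD []

/-- Evaluation of a token, with a stack of values. -/
def evalToken (n : ℕ) (φ : List (ℕ × ℕ)) (c : Closure) (s : Option (List ℕ × Actors))
    (t : Token) : Option (List ℕ × Actors) :=
  s.bind fun s =>
    if t.1 = 0 then (c.2.1[t.2.1]?).map fun v => (v :: s.1, s.2)
    else if t.1 = 1 then some (resolve c t.2.1 :: s.1, s.2)
    else if t.1 = 2 then (φ.lookup t.2.1).map fun v => (v :: s.1, s.2)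
    -- The last argument is on top of the stack, hence the reversal.
    else some (newName s.2 t.2.1 :: s.1.drop t.2.2,
      s.2 ++ [(newName s.2 t.2.1, (fieldsOf n t.2.1).zip (s.1.take t.2.2).reverse)])

def evalTokens (n : ℕ) (φ : List (ℕ × ℕ)) (c : Closure) (acts : Actors) (ts : List Token) :
    Option (List ℕ × Actors) :=
  ts.foldl (evalToken n φ c) (some ([], acts))

/-- A renaming of the variables that are not less than `b` in a tuple of values. -/
def canonVal (b : ℕ) (vs : List ℕ) (v : ℕ) : ℕ :=
  if v.unpair.1 = 0 ∧ ¬ v.unpair.2 < b then Nat.pair 0 (b + vs.idxOf v) else v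

/-- Variables below `b` may also occur in stores and keep their identity. Of any other variable only
the equalities within the tuple matter, and the position of its first occurrence records these. This
leaves finitely many tuples of each length. -/
def canon (b : ℕ) (vs : List ℕ) : List ℕ := vs.map fun v => canonVal b vs v

/-- The possible results of a step of a process: a message, the continuation, and the actors. -/
abbrev Outcome := Option (ℕ × Message) × Closure × Actors

/-- There is no case for field updates, which read-only programs do not contain. -/
def procStepsCase (n : ℕ) (φ : List (ℕ × ℕ)) (acts : Actors) (c : Closure) (t r : ℕ) :
    List Outcome :=
  if t = 2 then
    (evalTokens n φ c acts (exprTokens r.unpair.1)).toList.map fun s =>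
      (none, (r.unpair.2, s.1.headI :: c.2.1, c.2.2), s.2)
  else if t = 3 then
    (evalTokens n φ c acts (atomTokens r.unpair.1)).toList.flatMap fun s₀ =>
      (evalTokens n φ c acts (argsTokens r.unpair.2.unpair.2.unpair.1)).toList.map fun s =>
        (some (s₀.1.headI, (r.unpair.2.unpair.1, canon (n.unpair.1 + 1) s.1.reverse)),
          (r.unpair.2.unpair.2.unpair.2, c.2), s.2)
  else if t = 4 then
    (evalTokens n φ c acts (exprTokens r.unpair.1 ++ exprTokens r.unpair.2.unpair.1)).toList.map
      fun s => (none, (if s.1.headI = s.1.tail.headI then r.unpair.2.unpair.2.unpair.1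
        else r.unpair.2.unpair.2.unpair.2, c.2), s.2)
  else if t = 5 then
    [(none, (r.unpair.1, c.2), acts), (none, (r.unpair.2, c.2), acts)]
  else []

def procSteps (n : ℕ) (φ : List (ℕ × ℕ)) (acts : Actors) (c : Closure) : List Outcome :=
  procStepsCase n φ acts c c.1.unpair.1 c.1.unpair.2

/-- The closures that the actor `v` can start upon the message `m`. -/
def starts (n v : ℕ) (m : Message) : List Closure :=
  ((Denumerable.ofNat (List ℕ) n.unpair.2.unpair.2).filter fun d =>
    hasClass v d.unpair.1 ∧ d.unpair.2.unpair.1 = m.1 ∧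
      codeLength d.unpair.2.unpair.2.unpair.1 = m.2.length).map fun d =>
    (d.unpair.2.unpair.2.unpair.2, [],
      (0, v) :: (Denumerable.ofNat (List ℕ) d.unpair.2.unpair.2.unpair.1).zip m.2,
      -- Variables of the main process are at most its code, and canonical argument tuples use at
      -- most `m.2.length` variables beyond; local variables are shifted past both.
      n.unpair.1 + 1 + m.2.length)

def idleState : LocalState := ((0, [], [], 0), [])

def stateAt (l : List (ℕ × LocalState)) (v : ℕ) : LocalState := (l.lookup v).getD idleState

def Known (acts : Actors) (o : Option (ℕ × Message)) : Prop :=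
  ∀ x ∈ o.toList, (acts.lookup x.1).isSome = true

instance (acts : Actors) (o : Option (ℕ × Message)) : Decidable (Known acts o) :=
  inferInstanceAs (Decidable (∀ x ∈ o.toList, (acts.lookup x.1).isSome = true))

def post (o : Option (ℕ × Message)) (l : List (ℕ × LocalState)) : List (ℕ × LocalState) :=
  o.toList.foldl (fun l x => (x.1, ((stateAt l x.1).1, (stateAt l x.1).2 ++ [x.2])) :: l) l

def mainMoves (n : ℕ) (S : Machine) : List Machine :=
  ((procSteps n [] S.1.1 S.1.2).filter fun r => Known S.1.1 r.1).map fun r =>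
    ((r.2.2, r.2.1), post r.1 S.2)

/-- The list of actors after the step is discarded, since methods contain no `new`. Only the main
process extends the list. -/
def procMoves (n : ℕ) (S : Machine) (v : ℕ) : List Machine :=
  ((procSteps n ((S.1.1.lookup v).getD []) S.1.1 (stateAt S.2 v).1).filter
    fun r => Known S.1.1 r.1).map fun r =>
      (S.1, post r.1 ((v, (r.2.1, (stateAt S.2 v).2)) :: S.2))

def startMoves (n : ℕ) (S : Machine) (v : ℕ) : List Machine :=
  if (stateAt S.2 v).1.1 = 0 then
    (stateAt S.2 v).2.head?.toList.flatMap fun m => (starts n v m).map fun c =>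
      (S.1, (v, (c, (stateAt S.2 v).2.tail)) :: S.2)
  else []

def moves (n : ℕ) (S : Machine) : List Machine :=
  mainMoves n S ++ S.1.1.flatMap fun e => procMoves n S e.1 ++ startMoves n S e.1

def initialMachine (n : ℕ) : Machine := (([(Nat.pair 1 0, [])], (n.unpair.1, [], [], 0)), [])

/-! The serialization of the process that is represented by a closure. -/

def closeToken (c : Closure) (t : Token) : Token :=
  if t.1 = 0 then
    if t.2.1 < t.2.2 then (0, t.2.1, 0) else (1, (c.2.1[t.2.1 - t.2.2]?).getD 0, 0)
  else if t.1 = 1 then (1, resolve c t.2.1, 0)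
  else t

def closureTokens (c : Closure) : List Token := (procTokens c.1).map fun t => closeToken c t

/-- The first three conditions compare the two terms at one position: equal kinds, variables against
variables and actor names against actor names, and equality of everything else. The last one
compares two positions and makes the correspondence of values bijective. -/
def TokenCompat (x y : Token × Token) : Prop :=
  x.1.1 = x.2.1 ∧ (x.1.1 = 1 → x.1.2.1.unpair.1 = x.2.2.1.unpair.1) ∧
    (x.1.1 ≠ 1 → x.1 = x.2) ∧ (x.1.1 = 1 → y.1.1 = 1 → (x.1.2.1 = y.1.2.1 ↔ x.2.2.1 = y.2.2.1))

/-- Equality of two serialized processes up to renaming. -/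
def TokensMatch (l l' : List Token) : Prop :=
  l.length = l'.length ∧ ∀ x ∈ l.zip l', ∀ y ∈ l.zip l', TokenCompat x y

/-- The closure `c` represents the process with the code `p`, up to renaming. -/
def ClosureMatches (p : ℕ) (c : Closure) : Prop :=
  TokensMatch (closureTokens (p, [], [], 0)) (closureTokens c)

/-- Some actor of the machine has a process equal to the one with the code `p`, up to renaming. -/
def Accepts (p : ℕ) (S : Machine) : Prop :=
  ClosureMatches p S.1.2 ∨
    ∃ e ∈ S.1.1, e.1 ≠ Nat.pair 1 0 ∧ ClosureMatches p (stateAt S.2 e.1).1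

/-- The machines that can be reached in at most `k` steps. -/
def explore (n k : ℕ) : List Machine :=
  (fun l : List Machine => l ++ l.flatMap fun S => moves n S)^[k] [initialMachine n]

/-! Everything is primitive recursive. -/

section PrimrecMachine
variable {α : Type*} [Primcodable α]

@[fun_prop] theorem primrec_liftToken {f : α → Token} (hf : Primrec f) :
    Primrec fun a => liftToken (f a) := by unfold liftToken; fun_prop

@[fun_prop] theorem primrec_atomTokens {f : α → ℕ} (hf : Primrec f) :
    Primrec fun a => atomTokens (f a) := by unfold atomTokens; fun_prop

@[fun_prop] theorem primrec_codeLength {f : α → ℕ} (hf : Primrec f) :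
    Primrec fun a => codeLength (f a) := by unfold codeLength; fun_prop

@[fun_prop] theorem primrec_tripleAt {f : α → List TokenTriple} {g : α → ℕ} (hf : Primrec f)
    (hg : Primrec g) : Primrec fun a => tripleAt (f a) (g a) := by unfold tripleAt; fun_prop

@[fun_prop] theorem primrec_exprTokensStep : Primrec exprTokensStep := by
  unfold exprTokensStep; fun_prop

@[fun_prop] theorem primrec_argsTokensStep : Primrec argsTokensStep := by
  unfold argsTokensStep; fun_prop

@[fun_prop] theorem primrec_procTokensCase {l : α → List TokenTriple} {t r : α → ℕ}
    (hl : Primrec l) (ht : Primrec t) (hr : Primrec r) :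
    Primrec fun a => procTokensCase (l a) (t a) (r a) := by
  unfold procTokensCase; fun_prop

theorem primrec_tokens : Primrec tokens := by
  refine primrec_courseRec ?_
  unfold tokensStep
  fun_prop

@[fun_prop] theorem primrec_exprTokens : Primrec exprTokens := Primrec.fst.comp primrec_tokens
@[fun_prop] theorem primrec_argsTokens : Primrec argsTokens :=
  Primrec.fst.comp (Primrec.snd.comp primrec_tokens)
@[fun_prop] theorem primrec_procTokens : Primrec procTokens :=
  Primrec.snd.comp (Primrec.snd.comp primrec_tokens)

@[fun_prop] theorem primrec_resolve {c : α → Closure} {v : α → ℕ} (hc : Primrec c)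
    (hv : Primrec v) : Primrec fun a => resolve (c a) (v a) := by unfold resolve; fun_prop

@[fun_prop] theorem primrecPred_hasClass {v C : α → ℕ} (hv : Primrec v) (hC : Primrec C) :
    PrimrecPred fun a => hasClass (v a) (C a) := by unfold hasClass; fun_prop

@[fun_prop] theorem primrec_newName {acts : α → Actors} {C : α → ℕ} (ha : Primrec acts)
    (hC : Primrec C) : Primrec fun a => newName (acts a) (C a) := by unfold newName; fun_prop

@[fun_prop] theorem primrec_fieldsOf {n C : α → ℕ} (hn : Primrec n) (hC : Primrec C) :
    Primrec fun a => fieldsOf (n a) (C a) := by unfold fieldsOf; fun_prop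

@[fun_prop] theorem primrec_evalToken {n : α → ℕ} {φ : α → List (ℕ × ℕ)} {c : α → Closure}
    {s : α → Option (List ℕ × Actors)} {t : α → Token} (hn : Primrec n) (hφ : Primrec φ)
    (hc : Primrec c) (hs : Primrec s) (ht : Primrec t) :
    Primrec fun a => evalToken (n a) (φ a) (c a) (s a) (t a) := by
  unfold evalToken; fun_prop

@[fun_prop] theorem primrec_evalTokens {n : α → ℕ} {φ : α → List (ℕ × ℕ)} {c : α → Closure}
    {s : α → Actors} {t : α → List Token} (hn : Primrec n) (hφ : Primrec φ)
    (hc : Primrec c) (hs : Primrec s) (ht : Primrec t) :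
    Primrec fun a => evalTokens (n a) (φ a) (c a) (s a) (t a) := by
  unfold evalTokens; fun_prop

@[fun_prop] theorem primrec_canon {b : α → ℕ} {vs : α → List ℕ} (hb : Primrec b)
    (hv : Primrec vs) : Primrec fun a => canon (b a) (vs a) := by
  unfold canon canonVal; fun_prop

@[fun_prop] theorem primrec_procSteps {n : α → ℕ} {φ : α → List (ℕ × ℕ)} {acts : α → Actors}
    {c : α → Closure} (hn : Primrec n) (hφ : Primrec φ) (ha : Primrec acts) (hc : Primrec c) :
    Primrec fun a => procSteps (n a) (φ a) (acts a) (c a) := by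
  unfold procSteps procStepsCase; fun_prop

@[fun_prop] theorem primrec_starts {n v : α → ℕ} {m : α → Message} (hn : Primrec n)
    (hv : Primrec v) (hm : Primrec m) : Primrec fun a => starts (n a) (v a) (m a) := by
  unfold starts; fun_prop

@[fun_prop] theorem primrec_stateAt {l : α → List (ℕ × LocalState)} {v : α → ℕ}
    (hl : Primrec l) (hv : Primrec v) : Primrec fun a => stateAt (l a) (v a) := by
  unfold stateAt; fun_prop

@[fun_prop] theorem primrecPred_known {acts : α → Actors} {o : α → Option (ℕ × Message)}
    (ha : Primrec acts) (ho : Primrec o) : PrimrecPred fun a => Known (acts a) (o a) := by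
  unfold Known; fun_prop

@[fun_prop] theorem primrec_post {l : α → List (ℕ × LocalState)} {o : α → Option (ℕ × Message)}
    (ho : Primrec o) (hl : Primrec l) : Primrec fun a => post (o a) (l a) := by
  unfold post; fun_prop

@[fun_prop] theorem primrec_mainMoves {n : α → ℕ} {S : α → Machine} (hn : Primrec n)
    (hS : Primrec S) : Primrec fun a => mainMoves (n a) (S a) := by
  unfold mainMoves; fun_prop

@[fun_prop] theorem primrec_procMoves {n v : α → ℕ} {S : α → Machine}
    (hn : Primrec n) (hS : Primrec S) (hv : Primrec v) :
    Primrec fun a => procMoves (n a) (S a) (v a) := by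
  unfold procMoves; fun_prop

@[fun_prop] theorem primrec_startMoves {n v : α → ℕ} {S : α → Machine}
    (hn : Primrec n) (hS : Primrec S) (hv : Primrec v) :
    Primrec fun a => startMoves (n a) (S a) (v a) := by
  unfold startMoves; fun_prop

@[fun_prop] theorem primrec_moves {n : α → ℕ} {S : α → Machine} (hn : Primrec n)
    (hS : Primrec S) : Primrec fun a => moves (n a) (S a) := by
  unfold moves; fun_prop

@[fun_prop] theorem primrec_explore {n k : α → ℕ} (hn : Primrec n) (hk : Primrec k) :
    Primrec fun a => explore (n a) (k a) := by
  unfold explore initialMachine; fun_prop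

@[fun_prop] theorem primrec_closureTokens {c : α → Closure} (hc : Primrec c) :
    Primrec fun a => closureTokens (c a) := by
  unfold closureTokens closeToken; fun_prop

@[fun_prop] theorem primrecPred_tokenCompat {x y : α → Token × Token} (hx : Primrec x)
    (hy : Primrec y) : PrimrecPred fun a => TokenCompat (x a) (y a) := by
  unfold TokenCompat; fun_prop

@[fun_prop] theorem primrecPred_accepts {p : α → ℕ} {S : α → Machine} (hp : Primrec p)
    (hS : Primrec S) : PrimrecPred fun a => Accepts (p a) (S a) := by
  unfold Accepts ClosureMatches TokensMatch; fun_prop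

end PrimrecMachine

end ActorLang

/-! ### Systems of actors that keep no state between messages -/

namespace ActorLang

/-- A system with a main component, which never receives messages, and actors, whose behaviour is
determined by the last message that they have received. -/
structure ActorSystem (γ α π μ : Type*) where
  mainStep : γ → Option (α × μ) → γ → Prop
  step : α → π → Option (α × μ) → π → Prop
  start : α → μ → π → Prop
  idle : π → Prop

namespace ActorSystem

variable {γ α π μ : Type*} (Y : ActorSystem γ α π μ)

/-- The process `p` of the actor `A` can be completed, such that all messages are allowed. -/
inductive Completes (A : α) (Ok : α → μ → Prop) : π → Prop
  | idle (p : π) (h : Y.idle p) : Completes A Ok p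
  | step (p p' : π) (o : Option (α × μ)) (h : Y.step A p o p')
      (ho : ∀ x ∈ o, Ok x.1 x.2) (hp : Completes A Ok p') : Completes A Ok p

variable {Y} in
theorem Completes.mono {A : α} {Ok Ok' : α → μ → Prop} (h : ∀ B m, Ok B m → Ok' B m) {p : π}
    (hp : Y.Completes A Ok p) : Y.Completes A Ok' p := by
  induction hp with
  | idle p hi => exact .idle p hi
  | step p p' o hs ho _ ih => exact .step p p' o hs (fun x hx => h _ _ (ho x hx)) ih

variable [DecidableEq α]

/-- Append a message to the queue of its target. -/
def send : Option (α × μ) → (α → π × List μ) → (α → π × List μ)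
  | none, c => c
  | some x, c => Function.update c x.1 ((c x.1).1, (c x.1).2 ++ [x.2])

inductive Next : γ × (α → π × List μ) → γ × (α → π × List μ) → Prop
  | main (g g' : γ) (c : α → π × List μ) (o : Option (α × μ)) (h : Y.mainStep g o g') :
      Next (g, c) (g', send o c)
  | step (g : γ) (c : α → π × List μ) (A : α) (o : Option (α × μ)) (p : π)
      (h : Y.step A (c A).1 o p) : Next (g, c) (g, send o (Function.update c A (p, (c A).2)))
  | start (g : γ) (c : α → π × List μ) (A : α) (m : μ) (q : List μ) (p : π)
      (hi : Y.idle (c A).1) (hq : (c A).2 = m :: q) (h : Y.start A m p) :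
      Next (g, c) (g, Function.update c A (p, q))

/-- Runs with a given number of steps. -/
inductive Run : ℕ → γ × (α → π × List μ) → γ × (α → π × List μ) → Prop
  | refl (s : γ × (α → π × List μ)) : Run 0 s s
  | head {n : ℕ} {s t u : γ × (α → π × List μ)} (h : Y.Next s t) (hr : Run n t u) :
      Run (n + 1) s u

variable {Y} in
theorem Run.trans {m n : ℕ} {s t u : γ × (α → π × List μ)} (h : Y.Run m s t) (h' : Y.Run n t u) :
    Y.Run (m + n) s u := by
  induction h with
  | refl => simpa using h'
  | head hn _ ih =>
    have := Run.head hn (ih h')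
    rwa [Nat.add_right_comm] at this

/-- The message `m` for `A` is no obstacle if the actors are visited in the order `ws`: it can be
processed at the next visit of `A`, and so can the messages that this entails. -/
def MsgOk : List α → α → μ → Prop
  | [], _, _ => True
  | B :: ws, A, m => if A = B then ∃ p, Y.start A m p ∧ Y.Completes A (MsgOk ws) p else MsgOk ws A m

/-- The same for the current process of an actor. -/
def ProcOk : List α → α → π → Prop
  | [], _, _ => True
  | B :: ws, A, p => if A = B then Y.Completes A (MsgOk Y ws) p else ProcOk ws A p

-- Obstacles and the deletion of visits

variable {Y}

/-- If a visit is deleted, then the processing of a message is only postponed to the next visit of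
its target, and the messages sent then have fewer visits ahead of them. It suffices to delete the
first visit. -/
theorem msgOk_mono {vs ws : List α} (h : vs.Sublist ws) :
    ∀ {A : α} {m : μ}, Y.MsgOk ws A m → Y.MsgOk vs A m := by
  have key : ∀ (ws : List α) (B A : α) (m : μ), Y.MsgOk (B :: ws) A m → Y.MsgOk ws A m := by
    intro ws
    induction ws with
    | nil => intros; trivial
    | cons C ws ih =>
      intro B A m hm
      by_cases hB : A = B
      · rw [MsgOk, if_pos hB] at hm
        obtain ⟨p, hp, hc⟩ := hm
        -- By the induction hypothesis, what the processing of `m` sends is still harmless after the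
        -- visit of `C`.
        have hws : ∀ D k, Y.MsgOk (C :: ws) D k → Y.MsgOk ws D k := ih C
        clear hB
        by_cases hC : A = C
        · rw [MsgOk, if_pos hC]
          exact ⟨p, hp, hc.mono hws⟩
        · rw [MsgOk, if_neg hC]
          -- `C` is another actor, so `m` stays in the queue at that visit; the claim is again the
          -- deletion of a first visit of `A`, now in front of `ws`.
          refine ih A A m ?_
          rw [MsgOk, if_pos rfl]
          exact ⟨p, hp, hc.mono hws⟩
      · rwa [MsgOk, if_neg hB] at hm
  induction h with
  | slnil => intro A m hm; exact hm
  | cons B _ ih => intro A m hm; exact ih (key _ _ _ _ hm)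
  | cons_cons B _ ih =>
    intro A m hm
    rw [MsgOk] at hm ⊢
    split_ifs at hm ⊢ with hA
    · obtain ⟨p, hp, hc⟩ := hm
      exact ⟨p, hp, hc.mono fun _ _ => ih⟩
    · exact ih hm

/-- The process is completed at the first visit of `A` in `ws`, if any; the messages are then
required to be harmless only for the visits after it. -/
theorem procOk_of_completes {A : α} : ∀ {ws : List α} {p : π},
    Y.Completes A (Y.MsgOk ws) p → Y.ProcOk ws A p
  | [], _, _ => trivial
  | B :: ws, p, h => by
    have h' := h.mono fun C m => msgOk_mono (List.sublist_cons_self B ws) (A := C) (m := m)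
    rw [ProcOk]
    split_ifs
    · exact h'
    · exact procOk_of_completes h'

theorem procOk_mono {vs ws : List α} (h : vs.Sublist ws) :
    ∀ {A : α} {p : π}, Y.ProcOk ws A p → Y.ProcOk vs A p := by
  induction h with
  | slnil => intro A p hp; exact hp
  | cons B _ ih =>
    intro A p hp
    refine ih ?_
    rw [ProcOk] at hp
    split_ifs at hp
    · exact procOk_of_completes hp
    · exact hp
  | cons_cons B h ih =>
    intro A p hp
    rw [ProcOk] at hp ⊢
    split_ifs at hp ⊢ with hA
    · exact hp.mono fun _ _ => msgOk_mono h
    · exact ih hp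

theorem procOk_of_idle {A : α} {p : π} (h : Y.idle p) (ws : List α) : Y.ProcOk ws A p :=
  procOk_of_completes (.idle p h)

theorem procOk_of_step {A : α} {p p' : π} {o : Option (α × μ)} (h : Y.step A p o p') :
    ∀ {ws : List α}, (∀ x ∈ o, Y.MsgOk ws x.1 x.2) → Y.ProcOk ws A p' → Y.ProcOk ws A p
  | [], _, _ => trivial
  | B :: ws, ho, hp => by
    have ho' : ∀ x ∈ o, Y.MsgOk ws x.1 x.2 :=
      fun x hx => msgOk_mono (List.sublist_cons_self B ws) (ho x hx)
    rw [ProcOk] at hp ⊢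
    split_ifs at hp ⊢
    · exact .step p p' o h ho' hp
    · exact procOk_of_step h ho' hp

/-- A variant in which the messages of `A` need not be considered for its next visit. -/
theorem procOk_of_step' {A B : α} {p p' : π} {o : Option (α × μ)} (h : Y.step A p o p')
    {ws : List α} (ho : ∀ x ∈ o, Y.MsgOk ws x.1 x.2) (hp : Y.ProcOk (B :: ws) A p') :
    Y.ProcOk (B :: ws) A p := by
  rw [ProcOk] at hp ⊢
  split_ifs at hp ⊢
  · exact .step p p' o h ho hp
  · exact procOk_of_step h ho hp

theorem msgOk_of_start {A : α} {m : μ} {p : π} (h : Y.start A m p) :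
    ∀ {ws : List α}, Y.ProcOk ws A p → Y.MsgOk ws A m
  | [], _ => trivial
  | B :: ws, hp => by
    rw [ProcOk] at hp
    rw [MsgOk]
    split_ifs at hp ⊢
    · exact ⟨p, h, hp⟩
    · exact msgOk_of_start h hp

variable (Y) in
/-- The process `p` of the actor `A` leads to the goal through the chain `cs` of messages, each of
which is sent while the previous one is processed. -/
inductive Wins (G : α → π → Prop) : α → π → List (α × μ) → Prop
  | goal (A : α) (p : π) (h : G A p) : Wins G A p []
  | step (A : α) (p p' : π) (o : Option (α × μ)) (cs : List (α × μ)) (h : Y.step A p o p')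
      (ho : ∀ x ∈ o, Y.MsgOk (cs.map Prod.fst) x.1 x.2) (hp : Wins G A p' cs) : Wins G A p cs
  | chain (A : α) (p p' : π) (x : α × μ) (q : π) (cs : List (α × μ))
      (h : Y.step A p (some x) p') (hp : Y.ProcOk (x.1 :: cs.map Prod.fst) A p')
      (hs : Y.start x.1 x.2 q) (hq : Wins G x.1 q cs) : Wins G A p (x :: cs)

variable (Y) in
/-- The same for the main component. -/
inductive MainWins (G : α → π → Prop) : γ → List (α × μ) → Prop
  | step (g g' : γ) (o : Option (α × μ)) (cs : List (α × μ)) (h : Y.mainStep g o g')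
      (ho : ∀ x ∈ o, Y.MsgOk (cs.map Prod.fst) x.1 x.2) (hp : MainWins G g' cs) : MainWins G g cs
  | chain (g g' : γ) (x : α × μ) (q : π) (cs : List (α × μ))
      (h : Y.mainStep g (some x) g') (hs : Y.start x.1 x.2 q) (hq : Wins Y G x.1 q cs) :
      MainWins G g (x :: cs)

-- Chains without repetitions

variable {G : α → π → Prop}

/-- A chain can be entered at any of its messages, since the process that a message starts does not
depend on what its target did before. -/
theorem Wins.suffix {A : α} {p : π} {cs : List (α × μ)} (h : Y.Wins G A p cs) (l : List (α × μ))
    (x : α × μ) (r : List (α × μ)) (hcs : cs = l ++ x :: r) :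
    ∃ q, Y.start x.1 x.2 q ∧ Y.Wins G x.1 q r := by
  induction h generalizing l with
  | goal => simp at hcs
  | step _ _ _ _ _ _ _ _ ih => exact ih l hcs
  | chain A p p' y q cs _ _ hs hq ih =>
    cases l with
    | nil =>
      obtain ⟨rfl, rfl⟩ : y = x ∧ cs = r := by simpa using hcs
      exact ⟨q, hs, hq⟩
    | cons z l => exact ih l (by simpa using (List.cons.inj hcs).2)

/-- If the message `x` occurs again later in the chain, then its first occurrence can already start
the process with which the later one goes on, and everything in between is cut out. The obstacle
conditions survive because the visits of the shorter chain form a sublist. -/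
theorem Wins.exists_nodup {A : α} {p : π} {cs : List (α × μ)} (h : Y.Wins G A p cs) :
    ∃ cs' : List (α × μ), cs'.Sublist cs ∧ cs'.Nodup ∧ Y.Wins G A p cs' := by
  induction h with
  | goal A p h => exact ⟨[], List.Sublist.refl _, List.nodup_nil, .goal A p h⟩
  | step A p p' o cs h ho _ ih =>
    obtain ⟨cs', hsub, hnd, hw⟩ := ih
    exact ⟨cs', hsub, hnd, .step A p p' o cs' h (fun x hx => msgOk_mono (hsub.map _) (ho x hx)) hw⟩
  | chain A p p' x q cs h hp hs _ ih =>
    obtain ⟨cs', hsub, hnd, hw⟩ := ih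
    by_cases hx : x ∈ cs'
    · obtain ⟨l, r, rfl⟩ := List.append_of_mem hx
      obtain ⟨q', hs', hw'⟩ := hw.suffix l x r rfl
      have hsub' : (x :: r).Sublist (x :: cs) :=
        ((List.sublist_append_right l (x :: r)).trans hsub).trans (List.sublist_cons_self x cs)
      have hsub'' : r.Sublist cs :=
        ((List.sublist_cons_self x r).trans (List.sublist_append_right l (x :: r))).trans hsub
      exact ⟨x :: r, hsub', (List.nodup_append.1 hnd).2.1,
        .chain A p p' x q' r h (procOk_mono ((hsub''.map _).cons_cons _) hp) hs' hw'⟩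
    · exact ⟨x :: cs', hsub.cons_cons x, List.nodup_cons.2 ⟨hx, hnd⟩,
        .chain A p p' x q cs' h (procOk_mono ((hsub.map _).cons_cons _) hp) hs hw⟩

theorem MainWins.exists_nodup {g : γ} {cs : List (α × μ)} (h : Y.MainWins G g cs) :
    ∃ cs' : List (α × μ), cs'.Sublist cs ∧ cs'.Nodup ∧ Y.MainWins G g cs' := by
  induction h with
  | step g g' o cs h ho _ ih =>
    obtain ⟨cs', hsub, hnd, hw⟩ := ih
    exact ⟨cs', hsub, hnd, .step g g' o cs' h (fun x hx => msgOk_mono (hsub.map _) (ho x hx)) hw⟩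
  | chain g g' x q cs h hs hw =>
    obtain ⟨cs', hsub, hnd, hw'⟩ := hw.exists_nodup
    by_cases hx : x ∈ cs'
    · obtain ⟨l, r, rfl⟩ := List.append_of_mem hx
      obtain ⟨q', hs', hw''⟩ := hw'.suffix l x r rfl
      exact ⟨x :: r, ((List.sublist_append_right l (x :: r)).trans hsub).trans
        (List.sublist_cons_self x cs), (List.nodup_append.1 hnd).2.1, .chain g g' x q' r h hs' hw''⟩
    · exact ⟨x :: cs', hsub.cons_cons x, List.nodup_cons.2 ⟨hx, hnd⟩, .chain g g' x q cs' h hs hw'⟩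

/-- The messages of the chains are sent by steps of the system. -/
theorem Wins.forall_mem {V : α × μ → Prop} (hV : ∀ A p x p', Y.step A p (some x) p' → V x)
    {A : α} {p : π} {cs : List (α × μ)} (h : Y.Wins G A p cs) : ∀ x ∈ cs, V x := by
  induction h with
  | goal => simp
  | step _ _ _ _ _ _ _ _ ih => exact ih
  | chain A p p' x q cs h _ _ _ ih => exact List.forall_mem_cons.2 ⟨hV _ _ _ _ h, ih⟩

theorem MainWins.forall_mem {V : α × μ → Prop} (hV : ∀ A p x p', Y.step A p (some x) p' → V x)
    (hV' : ∀ g x g', Y.mainStep g (some x) g' → V x) {g : γ} {cs : List (α × μ)}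
    (h : Y.MainWins G g cs) : ∀ x ∈ cs, V x := by
  induction h with
  | step _ _ _ _ _ _ _ ih => exact ih
  | chain g g' x q cs h _ hw => exact List.forall_mem_cons.2 ⟨hV' _ _ _ h, hw.forall_mem hV⟩

end ActorSystem


-- From runs to chains, reading a run backwards

namespace ActorSystem

variable {γ α π μ : Type*} [DecidableEq α] {Y : ActorSystem γ α π μ} {G : α → π → Prop}

def inbox (o : Option (α × μ)) (D : α) : List μ :=
  o.toList.flatMap fun x => if x.1 = D then [x.2] else []

theorem mem_inbox {o : Option (α × μ)} {D : α} {m : μ} : m ∈ inbox o D ↔ o = some (D, m) := by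
  rcases o with _ | ⟨B, k⟩
  · simp [inbox]
  · by_cases h : B = D <;> simp [inbox, h, eq_comm]

theorem length_inbox_le (o : Option (α × μ)) (D : α) : (inbox o D).length ≤ 1 := by
  rcases o with _ | ⟨B, k⟩
  · simp [inbox]
  · by_cases h : B = D <;> simp [inbox, h]

theorem send_apply (o : Option (α × μ)) (c : α → π × List μ) (D : α) :
    send o c D = ((c D).1, (c D).2 ++ inbox o D) := by
  rcases o with _ | ⟨B, k⟩
  · simp [send, inbox]
  · by_cases h : D = B
    · subst h; simp [send, inbox]
    · simp [send, inbox, h, Ne.symm h]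

/-- At most one message is appended in a step, so a given entry of the new queue is either an old
one or that message, at the very end. In the proofs below this tells whether the step sends the
first link of the chain. -/
theorem append_inbox_eq {o : Option (α × μ)} {A : α} {x l₁ l₂ : List μ} {m : μ}
    (h : x ++ inbox o A = l₁ ++ m :: l₂) :
    (∃ l, x = l₁ ++ m :: l ∧ l₂ = l ++ inbox o A) ∨ (x = l₁ ∧ l₂ = [] ∧ o = some (A, m)) := by
  have hlen := length_inbox_le o A
  have hmem : inbox o A = [m] → o = some (A, m) := fun h => mem_inbox.1 (by simp [h])
  rcases List.append_eq_append_iff.1 h with ⟨as, rfl, h'⟩ | ⟨bs, rfl, h'⟩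
  · rw [h'] at hlen
    obtain ⟨rfl, rfl⟩ : as = [] ∧ l₂ = [] := by
      simp only [List.length_append, List.length_cons] at hlen
      exact ⟨List.length_eq_zero_iff.1 (by omega), List.length_eq_zero_iff.1 (by omega)⟩
    exact .inr ⟨by simp, rfl, hmem h'⟩
  · cases bs with
    | nil =>
      rw [List.nil_append] at h'
      rw [← h'] at hlen
      obtain rfl : l₂ = [] := List.length_eq_zero_iff.1 (by simpa using hlen)
      exact .inr ⟨by simp, rfl, hmem h'.symm⟩
    | cons b bs =>
      obtain ⟨rfl, rfl⟩ := List.cons.inj h'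
      exact .inl ⟨bs, rfl, rfl⟩

variable (Y G) in
/-- The goal can be reached through a chain of messages that begins in the given configuration. -/
inductive Covered (g : γ) (c : α → π × List μ) : Prop
  | proc (A : α) (cs : List (α × μ)) (h : Y.Wins G A (c A).1 cs)
      (hp : ∀ D, D ≠ A → Y.ProcOk (cs.map Prod.fst) D (c D).1)
      (hm : ∀ D, ∀ m ∈ (c D).2, Y.MsgOk (cs.map Prod.fst) D m)
  | msg (A : α) (m : μ) (q : π) (cs : List (α × μ)) (l₁ l₂ : List μ)
      (hq : (c A).2 = l₁ ++ m :: l₂) (hs : Y.start A m q) (h : Y.Wins G A q cs)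
      (hp : ∀ D, Y.ProcOk (A :: cs.map Prod.fst) D (c D).1)
      (h₁ : ∀ k ∈ l₁, Y.MsgOk (A :: cs.map Prod.fst) A k)
      (h₂ : ∀ k ∈ l₂, Y.MsgOk (cs.map Prod.fst) A k)
      (hm : ∀ D, D ≠ A → ∀ k ∈ (c D).2, Y.MsgOk (cs.map Prod.fst) D k)
  | main (cs : List (α × μ)) (h : Y.MainWins G g cs)
      (hp : ∀ D, Y.ProcOk (cs.map Prod.fst) D (c D).1)
      (hm : ∀ D, ∀ m ∈ (c D).2, Y.MsgOk (cs.map Prod.fst) D m)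

theorem msgOk_cons_of_ne {A D : α} (h : D ≠ A) {ws : List α} {m : μ} :
    Y.MsgOk (A :: ws) D m ↔ Y.MsgOk ws D m := by rw [MsgOk, if_neg h]

theorem procOk_cons_of_ne {A D : α} (h : D ≠ A) {ws : List α} {p : π} :
    Y.ProcOk (A :: ws) D p ↔ Y.ProcOk ws D p := by rw [ProcOk, if_neg h]

/-- The chain of the later configuration also serves the earlier one, with the step of the main
component put in front where the main component begins it or sends its first link. -/
theorem Covered.of_main {g g' : γ} {c : α → π × List μ} {o : Option (α × μ)}
    (h : Y.mainStep g o g') (hc : Y.Covered G g' (send o c)) : Y.Covered G g c := by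
  have hmem : ∀ {D m}, m ∈ (c D).2 → m ∈ (send o c D).2 := fun h => by
    rw [send_apply]; exact List.mem_append_left _ h
  have hfst : ∀ D, (send o c D).1 = (c D).1 := fun D => by rw [send_apply]
  cases hc with
  | proc A cs hw hp hm =>
    simp only [hfst] at hw hp
    exact .proc A cs hw hp fun D m hm' => hm D m (hmem hm')
  | msg A m q cs l₁ l₂ hq hs hw hp h₁ h₂ hm =>
    simp only [hfst] at hp
    have hm' : ∀ D, D ≠ A → ∀ k ∈ (c D).2, Y.MsgOk (cs.map Prod.fst) D k :=
      fun D hD k hk => hm D hD k (hmem hk)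
    rw [send_apply] at hq
    rcases append_inbox_eq hq with ⟨l, hl, rfl⟩ | ⟨hl, rfl, rfl⟩
    · exact .msg A m q cs l₁ l hl hs hw hp h₁ (fun k hk => h₂ k (List.mem_append_left _ hk)) hm'
    -- The first link of the chain is the message sent in this step, so the chain now begins in the
    -- main component. The messages before it in the queue are exactly the old queue of `A`.
    · refine .main ((A, m) :: cs) (.chain g g' (A, m) q cs h hs hw) hp fun D k hk => ?_
      by_cases hD : D = A
      · subst hD; exact h₁ k (hl ▸ hk)
      · exact (msgOk_cons_of_ne hD).2 (hm' D hD k hk)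
  | main cs hw hp hm =>
    simp only [hfst] at hp
    refine .main cs (.step g g' o cs h ?_ hw) hp fun D m hm' => hm D m (hmem hm')
    rintro ⟨D, m⟩ rfl
    exact hm D m (by rw [send_apply]; exact List.mem_append_right _ (mem_inbox.2 rfl))

/-- If the step sends the first link, the chain now begins in the process of `A`. Otherwise the step
is put in front of the chain, or in front of the completion of an obstacle. -/
theorem Covered.of_step {g : γ} {c : α → π × List μ} {A : α} {o : Option (α × μ)} {p : π}
    (h : Y.step A (c A).1 o p)
    (hc : Y.Covered G g (send o (Function.update c A (p, (c A).2)))) : Y.Covered G g c := by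
  set c' := send o (Function.update c A (p, (c A).2)) with hc'
  have hsnd : ∀ D, (c' D).2 = (c D).2 ++ inbox o D := fun D => by
    rw [hc', send_apply]
    by_cases hD : D = A
    · subst hD; simp
    · simp [hD]
  have hmem : ∀ {D m}, m ∈ (c D).2 → m ∈ (c' D).2 := fun {D m} h => by
    rw [hsnd]; exact List.mem_append_left _ h
  have hsent : ∀ x ∈ o, x.2 ∈ (c' x.1).2 := by
    rintro ⟨D, m⟩ rfl
    rw [hsnd]
    exact List.mem_append_right _ (mem_inbox.2 rfl)
  have hA : (c' A).1 = p := by rw [hc', send_apply]; simp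
  have hne : ∀ {D}, D ≠ A → (c' D).1 = (c D).1 := fun {D} hD => by
    rw [hc', send_apply]; simp [hD]
  cases hc with
  | proc B cs hw hp hm =>
    have hm' : ∀ D, ∀ k ∈ (c D).2, Y.MsgOk (cs.map Prod.fst) D k :=
      fun D k hk => hm D k (hmem hk)
    have ho : ∀ x ∈ o, Y.MsgOk (cs.map Prod.fst) x.1 x.2 := fun x hx => hm _ _ (hsent x hx)
    by_cases hB : B = A
    · subst hB
      rw [hA] at hw
      exact .proc B cs (.step B _ p o cs h ho hw) (fun D hD => hne hD ▸ hp D hD) hm'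
    · refine .proc B cs (hne hB ▸ hw) (fun D hD => ?_) hm'
      by_cases hDA : D = A
      · subst hDA
        exact procOk_of_step h ho (hA ▸ hp D hD)
      · exact hne hDA ▸ hp D hD
  | msg B m q cs l₁ l₂ hq hs hw hp h₁ h₂ hm =>
    have hm' : ∀ D, D ≠ B → ∀ k ∈ (c D).2, Y.MsgOk (cs.map Prod.fst) D k :=
      fun D hD k hk => hm D hD k (hmem hk)
    rw [hsnd] at hq
    rcases append_inbox_eq hq with ⟨l, hl, rfl⟩ | ⟨hl, rfl, rfl⟩
    · have ho : ∀ x ∈ o, Y.MsgOk (cs.map Prod.fst) x.1 x.2 := by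
        rintro ⟨D, k⟩ hx
        by_cases hD : D = B
        · subst hD
          -- A message to `B` itself was queued behind the link `m`, so it only has to be harmless
          -- after the visit of `B`.
          exact h₂ k (List.mem_append_right _ (mem_inbox.2 (by simpa using hx)))
        · exact hm D hD k (hsent _ hx)
      refine .msg B m q cs l₁ l hl hs hw (fun D => ?_) h₁
        (fun k hk => h₂ k (List.mem_append_left _ hk)) hm'
      by_cases hDA : D = A
      · subst hDA
        exact procOk_of_step' h ho (hA ▸ hp D)
      · exact hne hDA ▸ hp D
    -- The message just sent is the first link.
    · refine .proc A ((B, m) :: cs) (.chain A _ p (B, m) q cs h (hA ▸ hp A) hs hw)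
        (fun D hD => hne hD ▸ hp D) fun D k hk => ?_
      by_cases hD : D = B
      · subst hD; exact h₁ k (hl ▸ hk)
      · exact (msgOk_cons_of_ne hD).2 (hm' D hD k hk)
  | main cs hw hp hm =>
    refine .main cs hw (fun D => ?_) fun D k hk => hm D k (hmem hk)
    by_cases hDA : D = A
    · subst hDA
      exact procOk_of_step h (fun x hx => hm _ _ (hsent x hx)) (hA ▸ hp D)
    · exact hne hDA ▸ hp D

/-- Before the step the actor is idle, and an idle process is never an obstacle; what has to be
known about the started process is transferred to the message that starts it. -/
theorem Covered.of_start {g : γ} {c : α → π × List μ} {A : α} {m : μ} {q : List μ} {p : π}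
    (hi : Y.idle (c A).1) (hq : (c A).2 = m :: q) (h : Y.start A m p)
    (hc : Y.Covered G g (Function.update c A (p, q))) : Y.Covered G g c := by
  set c' := Function.update c A (p, q) with hc'
  have hA : c' A = (p, q) := by simp [hc']
  have hne : ∀ {D}, D ≠ A → c' D = c D := fun {D} hD => by simp [hc', hD]
  have hall : ∀ ws, Y.ProcOk ws A p → (∀ D, ∀ k ∈ (c' D).2, Y.MsgOk ws D k) →
      ∀ D, ∀ k ∈ (c D).2, Y.MsgOk ws D k := by
    intro ws hp hm D k hk
    by_cases hD : D = A
    · subst hD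
      rw [hq] at hk
      rcases List.mem_cons.1 hk with rfl | hk
      · exact msgOk_of_start h hp
      · exact hm D k (by rw [hA]; exact hk)
    · exact hm D k (by rw [hne hD]; exact hk)
  have hprocs : ∀ ws, (∀ D, D ≠ A → Y.ProcOk ws D (c' D).1) → ∀ D, Y.ProcOk ws D (c D).1 := by
    intro ws hp D
    by_cases hD : D = A
    · subst hD; exact procOk_of_idle hi ws
    · exact hne hD ▸ hp D hD
  cases hc with
  | proc B cs hw hp hm =>
    by_cases hB : B = A
    · subst hB
      rw [hA] at hw
      -- The chain used to begin in the process just started; now it begins with its message, which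
      -- is the head of the queue.
      refine .msg B m p cs [] q hq h hw
        (hprocs _ fun D hD => (procOk_cons_of_ne hD).2 (hp D hD)) (by simp)
        (fun k hk => hm B k (by rw [hA]; exact hk))
        fun D hD k hk => hm D k (by rw [hne hD]; exact hk)
    · refine .proc B cs (hne hB ▸ hw) (fun D _ => ?_) (hall _ ?_ hm)
      · by_cases hD : D = A
        · subst hD; exact procOk_of_idle hi _
        · exact hne hD ▸ hp D ‹_›
      · have := hp A (Ne.symm hB)
        rwa [hA] at this
  | msg B k r cs l₁ l₂ hl hs hw hp h₁ h₂ hm =>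
    have hpA : Y.ProcOk (B :: cs.map Prod.fst) A p := by
      have := hp A
      rwa [hA] at this
    by_cases hB : B = A
    · subst hB
      rw [hA] at hl
      refine .msg B k r cs (m :: l₁) l₂ (by rw [hq, show q = l₁ ++ k :: l₂ from hl]; rfl) hs hw
        (hprocs _ fun D _ => hp D) ?_ h₂ fun D hD x hx => hm D hD x (by rw [hne hD]; exact hx)
      exact List.forall_mem_cons.2 ⟨msgOk_of_start h hpA, h₁⟩
    · refine .msg B k r cs l₁ l₂ (by rw [← hne hB]; exact hl) hs hw (hprocs _ fun D _ => hp D) h₁ h₂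
        fun D hD x hx => ?_
      by_cases hDA : D = A
      · subst hDA
        rw [hq] at hx
        rcases List.mem_cons.1 hx with rfl | hx
        · exact msgOk_of_start h ((procOk_cons_of_ne hD).1 hpA)
        · exact hm D hD x (by rw [hA]; exact hx)
      · exact hm D hD x (by rw [hne hDA]; exact hx)
  | main cs hw hp hm =>
    refine .main cs hw (hprocs _ fun D _ => hp D) (hall _ ?_ hm)
    have := hp A
    rwa [hA] at this

/-- At the end of the run the chain is empty, no visits are ahead, and nothing is an obstacle. The
three lemmas on single steps carry this back to the beginning. -/
theorem covered_of_run {n : ℕ} {s t : γ × (α → π × List μ)} (h : Y.Run n s t)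
    (ht : ∃ A, G A (t.2 A).1) : Y.Covered G s.1 s.2 := by
  induction h with
  | refl s =>
    obtain ⟨A, hA⟩ := ht
    exact .proc A [] (.goal A _ hA) (fun _ _ => trivial) fun _ _ _ => trivial
  | head hn _ ih =>
    have ih := ih ht
    cases hn with
    | main g g' c o h => exact .of_main h ih
    | step g c A o p h => exact .of_step h ih
    | start g c A m q p hi hq h => exact .of_start hi hq h ih

/-- Initially the queues are empty and the actors neither move nor satisfy the goal, so that the
chain can only begin in the main component. -/
theorem mainWins_of_run {n : ℕ} {g : γ} {p₀ : π} {t : γ × (α → π × List μ)}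
    (h : Y.Run n (g, fun _ => (p₀, [])) t) (ht : ∃ A, G A (t.2 A).1)
    (hG : ∀ A, ¬ G A p₀) (hp₀ : ∀ A o p, ¬ Y.step A p₀ o p) : ∃ cs, Y.MainWins G g cs := by
  cases covered_of_run h ht with
  | proc A cs hw _ _ =>
    cases hw with
    | goal _ _ h => exact absurd h (hG A)
    | step _ _ _ _ _ h _ _ => exact absurd h (hp₀ _ _ _)
    | chain _ _ _ _ _ _ h _ _ _ => exact absurd h (hp₀ _ _ _)
  | msg A m q cs l₁ l₂ hq => simp at hq
  | main cs hw _ _ => exact ⟨cs, hw⟩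

end ActorSystem


-- From chains to runs of bounded length

namespace ActorSystem

variable {γ α π μ : Type*} [DecidableEq α] {Y : ActorSystem γ α π μ} {G : α → π → Prop}

theorem Run.one {s t : γ × (α → π × List μ)} (h : Y.Next s t) : Y.Run 1 s t :=
  .head h (.refl t)

/-- The processes of all actors have size at most `K`, and the queues have length at most `L`. -/
def Bounded (size : π → ℕ) (K L : ℕ) (c : α → π × List μ) : Prop :=
  ∀ D, size (c D).1 ≤ K ∧ (c D).2.length ≤ L

theorem Bounded.send {size : π → ℕ} {K L : ℕ} {c : α → π × List μ} (h : Bounded size K L c)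
    (o : Option (α × μ)) : Bounded size K (L + 1) (send o c) := fun D => by
  rw [send_apply]
  refine ⟨(h D).1, ?_⟩
  have := (h D).2
  have := length_inbox_le o D
  simp only [List.length_append]
  omega

theorem Bounded.update {size : π → ℕ} {K L : ℕ} {c : α → π × List μ} (h : Bounded size K L c)
    (A : α) {x : π × List μ} (hx : size x.1 ≤ K) (hx' : x.2.length ≤ L) :
    Bounded size K L (Function.update c A x) := fun D => by
  by_cases hD : D = A
  · subst hD; simpa using ⟨hx, hx'⟩
  · simpa [hD] using h D

variable (Y) in
/-- Nothing but the actor `B` can be an obstacle. -/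
def Clear (ws : List α) (B : α) (c : α → π × List μ) : Prop :=
  ∀ D, D ≠ B → Y.ProcOk ws D (c D).1 ∧ ∀ m ∈ (c D).2, Y.MsgOk ws D m

theorem Clear.send {ws : List α} {B : α} {c : α → π × List μ} (h : Y.Clear ws B c)
    {o : Option (α × μ)} (ho : ∀ x ∈ o, x.1 ≠ B → Y.MsgOk ws x.1 x.2) :
    Y.Clear ws B (send o c) := fun D hD => by
  rw [send_apply]
  refine ⟨(h D hD).1, fun m hm => ?_⟩
  rcases List.mem_append.1 hm with hm | hm
  · exact (h D hD).2 m hm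
  · exact ho (D, m) (mem_inbox.1 hm) hD

theorem Clear.update {ws : List α} {B : α} {c : α → π × List μ} (h : Y.Clear ws B c)
    (x : π × List μ) : Y.Clear ws B (Function.update c B x) := fun D hD => by
  simpa [hD] using h D hD

variable {size : π → ℕ} {K : ℕ}

/-- An actor completes its current process. -/
theorem exists_run_completes (hsize : ∀ A p o p', Y.step A p o p' → size p' < size p)
    {B : α} {ws : List α} {p : π} (h : Y.Completes B (Y.MsgOk ws) p) (g : γ) :
    ∀ {c : α → π × List μ} {L : ℕ}, (c B).1 = p → Y.Clear ws B c → Bounded size K L c →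
      ∃ n c' e, n ≤ size p ∧ Y.Run n (g, c) (g, c') ∧ Y.idle (c' B).1 ∧
        (c' B).2 = (c B).2 ++ e ∧ (∀ m ∈ e, Y.MsgOk ws B m) ∧ Y.Clear ws B c' ∧
        Bounded size K (L + n) c' := by
  induction h with
  | idle p hi =>
    rintro c L rfl hc hb
    exact ⟨0, c, [], by simp, .refl _, hi, by simp, by simp, hc, hb⟩
  | step p p' o hs ho _ ih =>
    rintro c L rfl hc hb
    have hlt := hsize _ _ _ _ hs
    set c₁ := ActorSystem.send o (Function.update c B (p', (c B).2)) with hc₁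
    have h₁ : c₁ B = (p', (c B).2 ++ inbox o B) := by rw [hc₁, send_apply]; simp
    have hb₁ : Bounded size K (L + 1) c₁ :=
      (hb.update B (x := (p', (c B).2)) (hlt.le.trans (hb B).1) (hb B).2).send o
    obtain ⟨n, c', e, hn, hr, hi, hq, he, hcl, hb'⟩ :=
      ih (c := c₁) (by rw [h₁]) ((hc.update _).send fun x hx _ => ho x hx) hb₁
    refine ⟨n + 1, c', inbox o B ++ e, by omega, .head (.step g c B o p' hs) hr, hi, ?_, ?_, hcl, ?_⟩
    · rw [hq, h₁, List.append_assoc]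
    · intro m hm
      rcases List.mem_append.1 hm with hm | hm
      · exact ho (B, m) (mem_inbox.1 hm)
      · exact he m hm
    · rwa [show L + (n + 1) = L + 1 + n by omega]

/-- An actor processes its queue up to a given message. -/
theorem exists_run_flush (hsize : ∀ A p o p', Y.step A p o p' → size p' < size p)
    (hstart : ∀ A m p, Y.start A m p → size p ≤ K) {B : α} {ws : List α} {m : μ} (g : γ) :
    ∀ {l₁ l₂ : List μ} {c : α → π × List μ} {L : ℕ}, (c B).2 = l₁ ++ m :: l₂ →
      Y.Completes B (Y.MsgOk ws) (c B).1 →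
      (∀ k ∈ l₁, ∃ p, Y.start B k p ∧ Y.Completes B (Y.MsgOk ws) p) →
      (∀ k ∈ l₂, Y.MsgOk ws B k) → Y.Clear ws B c → Bounded size K L c →
      ∃ n c' l, n ≤ K + l₁.length * (K + 1) ∧ Y.Run n (g, c) (g, c') ∧ Y.idle (c' B).1 ∧
        (c' B).2 = m :: l ∧ (∀ k ∈ l, Y.MsgOk ws B k) ∧ Y.Clear ws B c' ∧
        Bounded size K (L + n) c' := by
  intro l₁
  induction l₁ with
  | nil =>
    intro l₂ c L hq hp _ h₂ hcl hb
    obtain ⟨n, c', e, hn, hr, hi, hq', he, hcl', hb'⟩ :=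
      exists_run_completes hsize hp g rfl hcl hb
    refine ⟨n, c', l₂ ++ e, by have := (hb B).1; simp; omega, hr, hi, by rw [hq', hq]; simp, ?_,
      hcl', hb'⟩
    intro k hk
    rcases List.mem_append.1 hk with hk | hk
    exacts [h₂ k hk, he k hk]
  | cons x l₁ ih =>
    intro l₂ c L hq hp h₁ h₂ hcl hb
    obtain ⟨n, c', e, hn, hr, hi, hq', he, hcl', hb'⟩ :=
      exists_run_completes hsize hp g rfl hcl hb
    obtain ⟨p, hs, hc⟩ := h₁ x (by simp)
    rw [hq] at hq'
    have hlen := (hb' B).2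
    rw [hq'] at hlen
    simp only [List.cons_append, List.length_cons, List.length_append] at hlen
    -- The messages `e` that `B` has sent to itself are behind `m`; they join `l₂` and are not
    -- processed at this visit, so the number of messages to process is not affected.
    obtain ⟨n', c'', l, hn', hr', hi', hq'', hl, hcl'', hb''⟩ :=
      ih (l₂ := l₂ ++ e) (c := Function.update c' B (p, l₁ ++ m :: (l₂ ++ e))) (L := L + n)
        (by simp) (by simpa using hc) (fun k hk => h₁ k (by simp [hk]))
        (by
          intro k hk
          rcases List.mem_append.1 hk with hk | hk
          exacts [h₂ k hk, he k hk])
        (hcl'.update _) (hb'.update B (hstart _ _ _ hs)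
          (by simp only [List.length_append, List.length_cons]; omega))
    refine ⟨n + 1 + n', c'', l, ?_, (hr.trans (.one (.start g c' B x _ p hi ?_ hs))).trans hr', hi',
      hq'', hl, hcl'', ?_⟩
    · have := (hb B).1
      simp only [List.length_cons]
      rw [Nat.succ_mul]
      omega
    · rw [hq']; simp
    · intro D
      have := hb'' D
      exact ⟨this.1, by omega⟩

/-- An actor processes its queue up to a given message, and starts processing this message. -/
theorem exists_run_visit (hsize : ∀ A p o p', Y.step A p o p' → size p' < size p)
    (hstart : ∀ A m p, Y.start A m p → size p ≤ K) {B : α} {ws : List α} {m : μ} {q : π} (g : γ)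
    {l : List μ} {c : α → π × List μ} {L : ℕ} (hq : (c B).2 = l ++ [m]) (hs : Y.start B m q)
    (hp : ∀ D, Y.ProcOk (B :: ws) D (c D).1) (hl : ∀ k ∈ l, Y.MsgOk (B :: ws) B k)
    (hm : ∀ D, D ≠ B → ∀ k ∈ (c D).2, Y.MsgOk (B :: ws) D k) (hb : Bounded size K L c) :
    ∃ n c', n ≤ (L + 1) * (K + 1) ∧ Y.Run n (g, c) (g, c') ∧ (c' B).1 = q ∧
      (∀ D, D ≠ B → Y.ProcOk ws D (c' D).1) ∧ (∀ D, ∀ k ∈ (c' D).2, Y.MsgOk ws D k) ∧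
      Bounded size K (L + n) c' := by
  have hpB := hp B
  rw [ProcOk, if_pos rfl] at hpB
  have hcl : Y.Clear ws B c := fun D hD =>
    ⟨(procOk_cons_of_ne hD).1 (hp D), fun k hk => (msgOk_cons_of_ne hD).1 (hm D hD k hk)⟩
  have hl' : ∀ k ∈ l, ∃ p, Y.start B k p ∧ Y.Completes B (Y.MsgOk ws) p := fun k hk => by
    have := hl k hk
    rwa [MsgOk, if_pos rfl] at this
  obtain ⟨n, c', l', hn, hr, hi, hq', hl'', hcl', hb'⟩ :=
    exists_run_flush hsize hstart g hq hpB hl' (by simp) hcl hb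
  have hlen := (hb B).2
  have hlen' := (hb' B).2
  rw [hq] at hlen
  rw [hq'] at hlen'
  simp only [List.length_append, List.length_cons] at hlen hlen'
  refine ⟨n + 1, Function.update c' B (q, l'), ?_,
    hr.trans (.one (.start g c' B m l' q hi hq' hs)), by simp, ?_, ?_, ?_⟩
  · have : l.length * (K + 1) + (K + 1) + (K + 1) ≤ (L + 1) * (K + 1) := by
      rw [← Nat.succ_mul, ← Nat.succ_mul]
      exact Nat.mul_le_mul_right _ (by omega)
    omega
  · intro D hD
    simpa [hD] using (hcl' D hD).1
  · intro D k hk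
    by_cases hD : D = B
    · subst hD
      exact hl'' k (by simpa using hk)
    · exact (hcl' D hD).2 k (by simpa [hD] using hk)
  · exact Bounded.update (fun D => ⟨(hb' D).1, (hb' D).2.trans (by omega)⟩) B (hstart _ _ _ hs)
      (by simp only; omega)

/-- The numerical estimate for a link of a chain. -/
theorem chain_estimate {K L s t n k X' : ℕ}
    (ht : t ≤ (L + 1 + 1) * (K + 1)) (hX' : X' = L + 1 + t + 2 * K + 2)
    (hn : n + X' ≤ X' * (4 * K + 9) ^ (k + 1)) :
    1 + t + n + (L + 2 * s + 2) ≤ (L + 2 * s + 2) * (4 * K + 9) ^ (k + 1 + 1) := by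
  set R := (4 * K + 9) ^ (k + 1) with hR
  have hR1 : 1 ≤ R := Nat.one_le_pow _ _ (by omega)
  -- With the bound for `t`, `X'` is at most `L * K + 2 * L + 4 * K + 5`. The base `4 * K + 9`
  -- exceeds the factor here by one, which absorbs the summand `L + 2 * s + 2` of the claim.
  have h1 : X' ≤ (L + 2 * s + 2) * (4 * K + 8) := by
    rw [hX']
    nlinarith [Nat.zero_le (L * K), Nat.zero_le (s * K)]
  have h2 : X' * R ≤ (L + 2 * s + 2) * (4 * K + 8) * R := Nat.mul_le_mul_right _ h1
  have h3 : L + 2 * s + 2 ≤ (L + 2 * s + 2) * R := Nat.le_mul_of_pos_right _ hR1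
  calc 1 + t + n + (L + 2 * s + 2) ≤ (n + X') + (L + 2 * s + 2) := by omega
    _ ≤ (L + 2 * s + 2) * (4 * K + 8) * R + (L + 2 * s + 2) * R := by omega
    _ = (L + 2 * s + 2) * (4 * K + 9) ^ (k + 1 + 1) := by
      rw [pow_succ (4 * K + 9) (k + 1), ← hR]; ring

/-- A step lengthens the queues by at most one and reduces the size of the process by at least one.
So `L + 2 * s + 2` drops by at least one, which pays for the step; this is why the size is counted
twice. -/
theorem step_estimate {K L s s' n k : ℕ} (hs : s' < s)
    (hn : n + (L + 1 + 2 * s' + 2) ≤ (L + 1 + 2 * s' + 2) * (4 * K + 9) ^ (k + 1)) :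
    n + 1 + (L + 2 * s + 2) ≤ (L + 2 * s + 2) * (4 * K + 9) ^ (k + 1) := by
  set R := (4 * K + 9) ^ (k + 1) with hR
  have hR1 : 4 * K + 9 ≤ R := by
    rw [hR, pow_succ]
    exact Nat.le_mul_of_pos_left _ (Nat.pow_pos (by omega))
  obtain ⟨d, rfl⟩ : ∃ d, s = s' + 1 + d := ⟨s - s' - 1, by omega⟩
  nlinarith [Nat.zero_le (d * R), Nat.zero_le (d * K), Nat.mul_le_mul_left d hR1]

/-- The inequality bounds `n` by a nonnegative multiple of `L + 1 + t + 2 * s + 2`, so `s` may be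
replaced by the larger `K`. -/
theorem size_estimate {K L t s n k : ℕ} (hs : s ≤ K)
    (hn : n + (L + 1 + t + 2 * s + 2) ≤ (L + 1 + t + 2 * s + 2) * (4 * K + 9) ^ (k + 1)) :
    n + (L + 1 + t + 2 * K + 2) ≤ (L + 1 + t + 2 * K + 2) * (4 * K + 9) ^ (k + 1) := by
  have h1 : 1 ≤ (4 * K + 9) ^ (k + 1) := Nat.one_le_pow _ _ (by omega)
  generalize (4 * K + 9) ^ (k + 1) = R at *
  obtain ⟨d, rfl⟩ : ∃ d, K = s + d := ⟨K - s, by omega⟩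
  nlinarith [Nat.le_mul_of_pos_right (2 * d) h1]

/-- The current process runs until it sends the next link; then the target of the link is visited
and clears its queue up to the link, while all other actors rest. The obstacle conditions are
exactly what makes this possible, and they hold again for the rest of the chain. The estimate
multiplies by `4 * K + 9` for each link. -/
theorem Wins.exists_run (hsize : ∀ A p o p', Y.step A p o p' → size p' < size p)
    (hstart : ∀ A m p, Y.start A m p → size p ≤ K) (g : γ) {A : α} {p : π} {cs : List (α × μ)}
    (h : Y.Wins G A p cs) : ∀ {c : α → π × List μ} {L : ℕ}, (c A).1 = p →
      (∀ D, D ≠ A → Y.ProcOk (cs.map Prod.fst) D (c D).1) →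
      (∀ D, ∀ k ∈ (c D).2, Y.MsgOk (cs.map Prod.fst) D k) → Bounded size K L c →
      ∃ n c', Y.Run n (g, c) (g, c') ∧ (∃ A', G A' (c' A').1) ∧
        n + (L + 2 * size p + 2) ≤ (L + 2 * size p + 2) * (4 * K + 9) ^ (cs.length + 1) := by
  induction h with
  | goal A p h =>
    rintro c L rfl - - -
    exact ⟨0, c, .refl _, ⟨A, h⟩, by
      rw [Nat.zero_add]; exact Nat.le_mul_of_pos_right _ (Nat.pow_pos (by omega))⟩
  | step A p p' o cs hs ho _ ih =>
    rintro c L rfl hp hm hb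
    have hlt := hsize _ _ _ _ hs
    obtain ⟨n, c', hr, hg, hn⟩ :=
      ih (c := ActorSystem.send o (Function.update c A (p', (c A).2))) (L := L + 1)
        (by rw [send_apply]; simp) (fun D hD => by rw [send_apply]; simpa [hD] using hp D hD)
        (by
          intro D k hk
          rw [send_apply] at hk
          rcases List.mem_append.1 hk with hk | hk
          · by_cases hD : D = A
            · subst hD; exact hm D k (by simpa using hk)
            · exact hm D k (by simpa [hD] using hk)
          · exact ho (D, k) (mem_inbox.1 hk))
        ((hb.update A (x := (p', (c A).2)) (hlt.le.trans (hb A).1) (hb A).2).send o)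
    exact ⟨n + 1, c', .head (.step g c A o p' hs) hr, hg, step_estimate hlt hn⟩
  | chain A p p' x q cs hs hp' hst _ ih =>
    rintro c L rfl hp hm hb
    have hlt := hsize _ _ _ _ hs
    obtain ⟨B, m⟩ := x
    set c₁ := ActorSystem.send (some (B, m)) (Function.update c A (p', (c A).2)) with hc₁
    have hsnd : ∀ D, (c₁ D).2 = (c D).2 ++ inbox (some (B, m)) D := fun D => by
      rw [hc₁, send_apply]
      by_cases hD : D = A
      · subst hD; simp
      · simp [hD]
    have hb₁ : Bounded size K (L + 1) c₁ :=
      (hb.update A (x := (p', (c A).2)) (hlt.le.trans (hb A).1) (hb A).2).send _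
    obtain ⟨t, c₂, ht, hr, hq, hp₂, hm₂, hb₂⟩ :=
      exists_run_visit hsize hstart (ws := cs.map Prod.fst) g (c := c₁) (l := (c B).2)
        (by rw [hsnd]; simp [inbox]) hst
        (by
          intro D
          by_cases hD : D = A
          · subst hD; rw [hc₁, send_apply]; simpa using hp'
          · rw [hc₁, send_apply]; simpa [hD] using hp D hD)
        (hm B)
        (by
          intro D hD k hk
          rw [hsnd] at hk
          rcases List.mem_append.1 hk with hk | hk
          · exact hm D k hk
          · simp [inbox, Ne.symm hD] at hk) hb₁
    obtain ⟨n, c', hr', hg, hn⟩ := ih hq hp₂ hm₂ hb₂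
    refine ⟨1 + t + n, c', ((Run.one (.step g c A _ p' hs)).trans hr).trans hr', hg,
      chain_estimate ht rfl (size_estimate (hstart _ _ _ hst) hn)⟩
theorem MainWins.exists_run (hsize : ∀ A p o p', Y.step A p o p' → size p' < size p)
    (hstart : ∀ A m p, Y.start A m p → size p ≤ K) {mainSize : γ → ℕ}
    (hmain : ∀ g o g', Y.mainStep g o g' → mainSize g' < mainSize g) {g : γ}
    {cs : List (α × μ)} (h : Y.MainWins G g cs) :
    ∀ {c : α → π × List μ} {L : ℕ}, (∀ D, Y.idle (c D).1) →
      (∀ D, ∀ k ∈ (c D).2, Y.MsgOk (cs.map Prod.fst) D k) → Bounded size K L c →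
      ∃ n g' c', Y.Run n (g, c) (g', c') ∧ (∃ A', G A' (c' A').1) ∧
        n + (L + 2 * mainSize g + 2) ≤
          (L + 2 * mainSize g + 2) * (4 * K + 9) ^ (cs.length + 1) := by
  induction h with
  | step g g' o cs hs ho _ ih =>
    intro c L hi hm hb
    obtain ⟨n, g'', c', hr, hg, hn⟩ :=
      ih (c := ActorSystem.send o c) (L := L + 1) (fun D => by rw [send_apply]; exact hi D)
        (by
          intro D k hk
          rw [send_apply] at hk
          rcases List.mem_append.1 hk with hk | hk
          · exact hm D k hk
          · exact ho (D, k) (mem_inbox.1 hk))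
        (hb.send o)
    exact ⟨n + 1, g'', c', .head (.main g g' c o hs) hr, hg, step_estimate (hmain _ _ _ hs) hn⟩
  | chain g g' x q cs hs hst hw =>
    intro c L hi hm hb
    obtain ⟨B, m⟩ := x
    obtain ⟨t, c₂, ht, hr, hq, hp₂, hm₂, hb₂⟩ :=
      exists_run_visit hsize hstart (ws := cs.map Prod.fst) g' (c := ActorSystem.send (some (B, m)) c)
        (l := (c B).2) (by rw [send_apply]; simp [inbox]) hst
        (fun D => by rw [send_apply]; exact procOk_of_idle (hi D) _)
        (hm B)
        (by
          intro D hD k hk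
          rw [send_apply] at hk
          rcases List.mem_append.1 hk with hk | hk
          · exact hm D k hk
          · simp [inbox, Ne.symm hD] at hk) (hb.send _)
    obtain ⟨n, c', hr', hg, hn⟩ := hw.exists_run hsize hstart g' hq hp₂ hm₂ hb₂
    exact ⟨1 + t + n, g', c', ((Run.one (.main g g' c _ hs)).trans hr).trans hr', hg,
      chain_estimate ht rfl (size_estimate (hstart _ _ _ hst) hn)⟩

/-- If the actors can reach a goal, then they can do so in a bounded number of steps, where `N`
bounds the number of messages that can be sent. -/
theorem exists_run_le (hsize : ∀ A p o p', Y.step A p o p' → size p' < size p)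
    (hstart : ∀ A m p, Y.start A m p → size p ≤ K) {mainSize : γ → ℕ}
    (hmain : ∀ g o g', Y.mainStep g o g' → mainSize g' < mainSize g)
    {V : Finset (α × μ)} (hV : ∀ A p x p', Y.step A p (some x) p' → x ∈ V)
    (hV' : ∀ g x g', Y.mainStep g (some x) g' → x ∈ V) {N : ℕ} (hN : V.card ≤ N)
    {p₀ : π} (hG : ∀ A, ¬ G A p₀) (hp₀ : ∀ A o p, ¬ Y.step A p₀ o p) (hi : Y.idle p₀)
    (hK : size p₀ ≤ K) {n : ℕ} {g : γ} {t : γ × (α → π × List μ)}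
    (h : Y.Run n (g, fun _ => (p₀, [])) t) (ht : ∃ A, G A (t.2 A).1) :
    ∃ k t', k ≤ (2 * mainSize g + 2) * (4 * K + 9) ^ (N + 1) ∧
      Y.Run k (g, fun _ => (p₀, [])) t' ∧ ∃ A, G A (t'.2 A).1 := by
  obtain ⟨cs₀, hw₀⟩ := mainWins_of_run h ht hG hp₀
  obtain ⟨cs, -, hnd, hw⟩ := hw₀.exists_nodup
  -- All links are messages in `V`, and they are distinct.
  have hlen : cs.length ≤ N := by
    classical
    rw [← List.toFinset_card_of_nodup hnd]
    refine (Finset.card_le_card fun x hx => ?_).trans hN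
    exact hw.forall_mem hV hV' x (List.mem_toFinset.1 hx)
  obtain ⟨k, g', c', hr, hg, hk⟩ := hw.exists_run hsize hstart hmain (c := fun _ => (p₀, [])) (L := 0)
    (fun _ => hi) (by simp) (fun _ => ⟨hK, by simp⟩)
  refine ⟨k, _, ?_, hr, hg⟩
  have : (4 * K + 9) ^ (cs.length + 1) ≤ (4 * K + 9) ^ (N + 1) :=
    Nat.pow_le_pow_right (by omega) (by omega)
  have := Nat.mul_le_mul_left (2 * mainSize g + 2) this
  rw [Nat.zero_add] at hk
  omega

/-- The main component can be run alone. -/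
theorem Run.main {n : ℕ} {s t : γ × (α → π × List μ)} (h : Y.Run n s t) {mainSize : γ → ℕ}
    (hmain : ∀ g o g', Y.mainStep g o g' → mainSize g' < mainSize g)
    (c : α → π × List μ) :
    ∃ k c', k ≤ mainSize s.1 ∧ Y.Run k (s.1, c) (t.1, c') ∧ ∀ D, (c' D).1 = (c D).1 := by
  induction h generalizing c with
  | refl s => exact ⟨0, c, by simp, .refl _, fun _ => rfl⟩
  | head hn _ ih =>
    cases hn with
    | main g g' c₁ o h =>
      obtain ⟨k, c', hk, hr, hc⟩ := ih (ActorSystem.send o c)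
      have := hmain _ _ _ h
      exact ⟨k + 1, c', by simp only at hk ⊢; omega, .head (.main g g' c o h) hr, fun D => by
        rw [hc, send_apply]⟩
    | step g c₁ A o p h => exact ih c
    | start g c₁ A m q p hi hq h => exact ih c

end ActorSystem


/-! ### Serialization of the components of a term -/

theorem unpair_add_le (n : ℕ) : n.unpair.1 + n.unpair.2 ≤ n := by
  conv_rhs => rw [← Nat.pair_unpair n]
  exact Nat.add_le_pair _ _

theorem tripleAt_courseTable {m n : ℕ} (h : m < n) :
    tripleAt (courseTable tokensStep n) m = tokens m := by
  rw [tripleAt, courseTable_getElem? _ h]; rfl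

theorem exprTokens_of_atom {n : ℕ} (h : n.unpair.1 = 0) :
    exprTokens n = atomTokens n.unpair.2 := by
  simp [exprTokens, tokens, courseRec, tokensStep, exprTokensStep, h]

theorem exprTokens_of_field {n : ℕ} (h : n.unpair.1 = 1) :
    exprTokens n = [(2, n.unpair.2, 0)] := by
  simp [exprTokens, tokens, courseRec, tokensStep, exprTokensStep, h]

theorem exprTokens_of_new {n : ℕ} (h : 1 < n.unpair.1) :
    exprTokens n = argsTokens n.unpair.2.unpair.2 ++
      [(3, n.unpair.2.unpair.1, codeLength n.unpair.2.unpair.2)] := by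
  have h1 := unpair_add_le n
  have h2 := unpair_add_le n.unpair.2
  simp [exprTokens, tokens, courseRec, tokensStep, exprTokensStep, argsTokens,
    show n.unpair.1 ≠ 0 by omega, show n.unpair.1 ≠ 1 by omega,
    tripleAt_courseTable (show n.unpair.2.unpair.2 < n by omega)]

@[simp] theorem argsTokens_zero : argsTokens 0 = [] := by
  simp [argsTokens, tokens, courseRec, tokensStep, argsTokensStep]

theorem argsTokens_succ (n : ℕ) :
    argsTokens (n + 1) = exprTokens n.unpair.1 ++ argsTokens n.unpair.2 := by
  have h1 := unpair_add_le n
  simp [exprTokens, tokens, courseRec, tokensStep, argsTokensStep, argsTokens,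
    tripleAt_courseTable (show n.unpair.2 < n + 1 by omega),
    tripleAt_courseTable (show n.unpair.1 < n + 1 by omega)]

theorem procTokens_of_nil {n : ℕ} (h : n.unpair.1 = 0) : procTokens n = [(4, 0, 0)] := by
  simp [procTokens, tokens, courseRec, tokensStep, procTokensCase, h]

theorem procTokens_of_upd {n : ℕ} (h : n.unpair.1 = 1) :
    procTokens n = exprTokens n.unpair.2.unpair.2.unpair.1 ++
      procTokens n.unpair.2.unpair.2.unpair.2 ++ [(5, n.unpair.2.unpair.1, 0)] := by
  have h1 := unpair_add_le n
  have h2 := unpair_add_le n.unpair.2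
  have h3 := unpair_add_le n.unpair.2.unpair.2
  simp [procTokens, tokens, courseRec, tokensStep, procTokensCase, h, exprTokens,
    tripleAt_courseTable (show n.unpair.2.unpair.2.unpair.1 < n by omega),
    tripleAt_courseTable (show n.unpair.2.unpair.2.unpair.2 < n by omega)]

theorem procTokens_of_letIn {n : ℕ} (h : n.unpair.1 = 2) :
    procTokens n = exprTokens n.unpair.2.unpair.1 ++
      (procTokens n.unpair.2.unpair.2).map liftToken ++ [(6, 0, 0)] := by
  have h1 := unpair_add_le n
  have h2 := unpair_add_le n.unpair.2
  simp [procTokens, tokens, courseRec, tokensStep, procTokensCase, h, exprTokens,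
    tripleAt_courseTable (show n.unpair.2.unpair.1 < n by omega),
    tripleAt_courseTable (show n.unpair.2.unpair.2 < n by omega)]

theorem procTokens_of_invoke {n : ℕ} (h : n.unpair.1 = 3) :
    procTokens n = atomTokens n.unpair.2.unpair.1 ++
      argsTokens n.unpair.2.unpair.2.unpair.2.unpair.1 ++
      procTokens n.unpair.2.unpair.2.unpair.2.unpair.2 ++
      [(7, n.unpair.2.unpair.2.unpair.1,
        codeLength n.unpair.2.unpair.2.unpair.2.unpair.1)] := by
  have h1 := unpair_add_le n
  have h2 := unpair_add_le n.unpair.2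
  have h3 := unpair_add_le n.unpair.2.unpair.2
  have h4 := unpair_add_le n.unpair.2.unpair.2.unpair.2
  simp [procTokens, tokens, courseRec, tokensStep, procTokensCase, h, argsTokens,
    tripleAt_courseTable (show n.unpair.2.unpair.2.unpair.2.unpair.1 < n by omega),
    tripleAt_courseTable (show n.unpair.2.unpair.2.unpair.2.unpair.2 < n by omega)]

theorem procTokens_of_cond {n : ℕ} (h : n.unpair.1 = 4) :
    procTokens n = exprTokens n.unpair.2.unpair.1 ++ exprTokens n.unpair.2.unpair.2.unpair.1 ++
      procTokens n.unpair.2.unpair.2.unpair.2.unpair.1 ++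
      procTokens n.unpair.2.unpair.2.unpair.2.unpair.2 ++ [(8, 0, 0)] := by
  have h1 := unpair_add_le n
  have h2 := unpair_add_le n.unpair.2
  have h3 := unpair_add_le n.unpair.2.unpair.2
  have h4 := unpair_add_le n.unpair.2.unpair.2.unpair.2
  simp [procTokens, tokens, courseRec, tokensStep, procTokensCase, h, exprTokens,
    tripleAt_courseTable (show n.unpair.2.unpair.1 < n by omega),
    tripleAt_courseTable (show n.unpair.2.unpair.2.unpair.1 < n by omega),
    tripleAt_courseTable (show n.unpair.2.unpair.2.unpair.2.unpair.1 < n by omega),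
    tripleAt_courseTable (show n.unpair.2.unpair.2.unpair.2.unpair.2 < n by omega)]

theorem procTokens_of_plus {n : ℕ} (h : 4 < n.unpair.1) :
    procTokens n = procTokens n.unpair.2.unpair.1 ++ procTokens n.unpair.2.unpair.2 ++
      [(9, 0, 0)] := by
  have h1 := unpair_add_le n
  have h2 := unpair_add_le n.unpair.2
  simp [procTokens, tokens, courseRec, tokensStep, procTokensCase,
    show n.unpair.1 ≠ 0 by omega, show n.unpair.1 ≠ 1 by omega, show n.unpair.1 ≠ 2 by omega,
    show n.unpair.1 ≠ 3 by omega, show n.unpair.1 ≠ 4 by omega,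
    tripleAt_courseTable (show n.unpair.2.unpair.1 < n by omega),
    tripleAt_courseTable (show n.unpair.2.unpair.2 < n by omega)]

theorem length_atomTokens (n : ℕ) : (atomTokens n).length = 1 := by
  unfold atomTokens; split_ifs <;> rfl

/-- Since evaluation creates at most one actor and pushes at most one value per token, this bounds
both by the code. The extra `1` for an expression is paid, within a tuple, by the successor in the
code of a nonempty list. -/
theorem length_exprTokens_le (n : ℕ) :
    (exprTokens n).length ≤ n + 1 ∧ (argsTokens n).length ≤ n := by
  induction n using Nat.strong_induction_on with
  | _ n ih =>
    have h1 := unpair_add_le n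
    constructor
    · rcases Nat.lt_trichotomy n.unpair.1 1 with h | h | h
      · rw [exprTokens_of_atom (by omega), length_atomTokens]; omega
      · rw [exprTokens_of_field h]; simp
      · have h2 := unpair_add_le n.unpair.2
        have := (ih n.unpair.2.unpair.2 (by omega)).2
        rw [exprTokens_of_new h]
        simp
        omega
    · cases n with
      | zero => simp
      | succ n =>
        have h2 := unpair_add_le n
        have h3 := (ih n.unpair.1 (by omega)).1
        have h4 := (ih n.unpair.2 (by omega)).2
        rw [argsTokens_succ, List.length_append]
        omega

/-! ### The moves of the machine as a relation -/

/-- The states of the main component and of the actors. -/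
abbrev Conf := MainState × (ℕ → LocalState)

def Machine.conf (S : Machine) : Conf := (S.1, stateAt S.2)

open ActorSystem (send send_apply)

/-- The list of states of a `Machine` keeps void entries, so different lists may describe the same
situation; here the states form a function of the actor. -/
inductive Move (n : ℕ) : Conf → Conf → Prop
  | main (g : MainState) (c : ℕ → LocalState) (o : Option (ℕ × Message)) (p : Closure)
      (acts : Actors) (h : (o, p, acts) ∈ procSteps n [] g.1 g.2) (ho : Known g.1 o) :
      Move n (g, c) ((acts, p), send o c)
  | proc (g : MainState) (c : ℕ → LocalState) (v : ℕ) (φ : List (ℕ × ℕ))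
      (o : Option (ℕ × Message)) (p : Closure) (acts : Actors) (hv : g.1.lookup v = some φ)
      (h : (o, p, acts) ∈ procSteps n φ g.1 (c v).1) (ho : Known g.1 o) :
      Move n (g, c) (g, send o (Function.update c v (p, (c v).2)))
  | start (g : MainState) (c : ℕ → LocalState) (v : ℕ) (m : Message) (q : List Message)
      (p : Closure) (hv : (g.1.lookup v).isSome) (hi : (c v).1.1 = 0) (hq : (c v).2 = m :: q)
      (h : p ∈ starts n v m) : Move n (g, c) (g, Function.update c v (p, q))

theorem stateAt_cons (v : ℕ) (x : LocalState) (l : List (ℕ × LocalState)) :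
    stateAt ((v, x) :: l) = Function.update (stateAt l) v x := by
  funext w
  by_cases h : w = v
  · subst h; simp [stateAt]
  · have : (w == v) = false := by simpa using h
    simp [stateAt, List.lookup_cons, h, this]

theorem stateAt_post (o : Option (ℕ × Message)) (l : List (ℕ × LocalState)) :
    stateAt (post o l) = send o (stateAt l) := by
  cases o with
  | none => rfl
  | some x => simp [post, stateAt_cons, send]

theorem lookup_isSome_iff {β : Type*} {l : List (ℕ × β)} {v : ℕ} :
    (l.lookup v).isSome ↔ ∃ e ∈ l, e.1 = v := by
  induction l with
  | nil => simp
  | cons e l ih =>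
    by_cases h : v = e.1
    · subst h; simp
    · have : (v == e.1) = false := by simpa using h
      rw [List.lookup_cons, this]
      simp [ih, Ne.symm h]

theorem exists_mem_moves_iff {n : ℕ} {S : Machine} {t : Conf} :
    (∃ S' ∈ moves n S, S'.conf = t) ↔ Move n S.conf t := by
  constructor
  · rintro ⟨S', hS', rfl⟩
    simp only [moves, List.mem_append, List.mem_flatMap] at hS'
    rcases hS' with hS' | ⟨e, he, hS' | hS'⟩
    · simp only [mainMoves, List.mem_map, List.mem_filter, decide_eq_true_eq] at hS'
      obtain ⟨⟨o, p, acts⟩, ⟨h, ho⟩, rfl⟩ := hS'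
      have := Move.main S.1 (stateAt S.2) o p acts h ho
      simpa [Machine.conf, stateAt_post] using this
    · simp only [procMoves, List.mem_map, List.mem_filter, decide_eq_true_eq] at hS'
      obtain ⟨⟨o, p, acts⟩, ⟨h, ho⟩, rfl⟩ := hS'
      obtain ⟨φ, hφ⟩ := Option.isSome_iff_exists.1
        (lookup_isSome_iff.2 ⟨e, he, rfl⟩ : (S.1.1.lookup e.1).isSome)
      rw [hφ, Option.getD_some] at h
      have := Move.proc S.1 (stateAt S.2) e.1 φ o p acts hφ h ho
      simpa [Machine.conf, stateAt_post, stateAt_cons] using this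
    · rw [startMoves] at hS'
      split_ifs at hS' with hi
      · rcases hq : (stateAt S.2 e.1).2 with _ | ⟨m, q⟩
        · simp [hq] at hS'
        · simp only [hq, List.head?_cons, Option.toList_some, List.flatMap_singleton,
            List.mem_map, List.tail_cons] at hS'
          obtain ⟨p, hp, rfl⟩ := hS'
          have := Move.start S.1 (stateAt S.2) e.1 m q p (lookup_isSome_iff.2 ⟨e, he, rfl⟩) hi hq hp
          simpa [Machine.conf, stateAt_cons] using this
      · simp at hS'
  · intro h
    obtain ⟨S', hS', hc⟩ : ∃ S' ∈ moves n S, S'.conf = t := by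
      generalize hs : S.conf = s at h
      cases h with
      | main g c o p acts h ho =>
        obtain ⟨rfl, rfl⟩ := Prod.mk.inj hs
        refine ⟨((acts, p), post o S.2), ?_, by simp [Machine.conf, stateAt_post]⟩
        simp only [moves, List.mem_append, mainMoves, List.mem_map, List.mem_filter,
          decide_eq_true_eq]
        exact .inl ⟨(o, p, acts), ⟨h, ho⟩, rfl⟩
      | proc g c v φ o p acts hv h ho =>
        obtain ⟨rfl, rfl⟩ := Prod.mk.inj hs
        refine ⟨(S.1, post o ((v, (p, (stateAt S.2 v).2)) :: S.2)), ?_,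
          by simp [Machine.conf, stateAt_post, stateAt_cons]⟩
        obtain ⟨e, he, rfl⟩ := lookup_isSome_iff.1 (Option.isSome_iff_exists.2 ⟨φ, hv⟩)
        simp only [moves, List.mem_append, List.mem_flatMap, procMoves, List.mem_map,
          List.mem_filter, decide_eq_true_eq]
        exact .inr ⟨e, he, .inl ⟨(o, p, acts), ⟨by rwa [hv], ho⟩, rfl⟩⟩
      | start g c v m q p hv hi hq h =>
        obtain ⟨rfl, rfl⟩ := Prod.mk.inj hs
        refine ⟨(S.1, (v, (p, q)) :: S.2), ?_, by simp [Machine.conf, stateAt_cons]⟩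
        obtain ⟨e, he, rfl⟩ := lookup_isSome_iff.1 hv
        simp only [moves, List.mem_append, List.mem_flatMap]
        refine .inr ⟨e, he, .inr ?_⟩
        rw [startMoves, if_pos hi, hq]
        simpa using h
    exact ⟨S', hS', hc⟩

/-- Runs of the machine with a given number of moves. -/
inductive Moves (n : ℕ) : ℕ → Conf → Conf → Prop
  | refl (s : Conf) : Moves n 0 s s
  | tail {k : ℕ} {s t u : Conf} (h : Moves n k s t) (ht : Move n t u) : Moves n (k + 1) s u

theorem Moves.head {n k : ℕ} {s t u : Conf} (h : Move n s t) (h' : Moves n k t u) :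
    Moves n (k + 1) s u := by
  induction h' with
  | refl => exact .tail (.refl _) h
  | tail _ ht ih => exact .tail (ih h) ht

theorem mem_explore_succ {n k : ℕ} {S : Machine} :
    S ∈ explore n (k + 1) ↔ S ∈ explore n k ∨ ∃ S' ∈ explore n k, S ∈ moves n S' := by
  rw [explore, Function.iterate_succ_apply', ← explore]
  simp [List.mem_append, List.mem_flatMap]

theorem exists_mem_explore_iff {n k : ℕ} {t : Conf} :
    (∃ S ∈ explore n k, S.conf = t) ↔ ∃ j ≤ k, Moves n j (initialMachine n).conf t := by
  constructor
  · rintro ⟨S, hS, rfl⟩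
    induction k generalizing S with
    | zero =>
      obtain rfl : S = initialMachine n := by simpa [explore] using hS
      exact ⟨0, le_rfl, .refl _⟩
    | succ k ih =>
      rcases mem_explore_succ.1 hS with hS | ⟨S', hS', hS⟩
      · obtain ⟨j, hj, h⟩ := ih S hS
        exact ⟨j, by omega, h⟩
      · obtain ⟨j, hj, h⟩ := ih S' hS'
        exact ⟨j + 1, by omega, h.tail (exists_mem_moves_iff.1 ⟨S, hS, rfl⟩)⟩
  · rintro ⟨j, hj, h⟩
    induction k generalizing j t with
    | zero =>
      obtain rfl : j = 0 := by omega
      cases h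
      exact ⟨initialMachine n, by simp [explore], rfl⟩
    | succ k ih =>
      cases h with
      | refl =>
        obtain ⟨S, hS, h⟩ := ih 0 (by omega) (.refl _)
        exact ⟨S, mem_explore_succ.2 (.inl hS), h⟩
      | tail h ht =>
        obtain ⟨S', hS', rfl⟩ := ih _ (by omega) h
        obtain ⟨S, hS, h⟩ := exists_mem_moves_iff.2 ht
        exact ⟨S, mem_explore_succ.2 (.inr ⟨S', hS', hS⟩), h⟩


/-! ### Evaluation and steps of processes -/

/-- If `v` is an actor name, then that of an existing actor. -/
def Scoped (acts : Actors) (v : ℕ) : Prop := v.unpair.1 ≠ 0 → (acts.lookup v).isSome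

theorem Scoped.mono {acts acts' : Actors} (h : acts <+: acts') {v : ℕ} (hv : Scoped acts v) :
    Scoped acts' v := fun h' => List.Sublist.lookup_isSome h.sublist (hv h')

theorem scoped_of_unpair_eq_zero {acts : Actors} {v : ℕ} (h : v.unpair.1 = 0) : Scoped acts v :=
  fun h' => absurd h h'

theorem scoped_zero (acts : Actors) : Scoped acts 0 := scoped_of_unpair_eq_zero (by simp)

def ScopedStores (acts : Actors) : Prop := ∀ e ∈ acts, ∀ x ∈ e.2, Scoped acts x.2

/-- The token is not an actor name. -/
def PlainToken (t : Token) : Prop := t.1 = 1 → t.2.1.unpair.1 = 0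

/-- The environment of a closure refers to existing actors. -/
def ScopedEnv (acts : Actors) (e : List ℕ × List (ℕ × ℕ) × ℕ) : Prop :=
  (∀ u ∈ e.1, Scoped acts u) ∧ ∀ x ∈ e.2.1, Scoped acts x.2

theorem mem_snd_of_lookup {β : Type*} {l : List (ℕ × β)} {k : ℕ} {b : β}
    (h : l.lookup k = some b) : ∃ e ∈ l, e.2 = b := by
  obtain ⟨l₁, l₂, rfl, -⟩ := List.lookup_eq_some_iff.1 h
  exact ⟨(k, b), by simp, rfl⟩

theorem scoped_resolve {acts : Actors} {c : Closure} (hc : ScopedEnv acts c.2) {v : ℕ}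
    (hv : v.unpair.1 = 0) : Scoped acts (resolve c v) := by
  rw [resolve, if_pos hv]
  cases h : c.2.2.1.lookup v.unpair.2 with
  | none => exact scoped_of_unpair_eq_zero (by simp)
  | some u =>
    obtain ⟨e, he, rfl⟩ := mem_snd_of_lookup h
    exact hc.2 e he

theorem evalToken_spec {n : ℕ} {φ : List (ℕ × ℕ)} {c : Closure} {s s' : List ℕ × Actors}
    {t : Token} (h : evalToken n φ c (some s) t = some s') :
    s.2 <+: s'.2 ∧ s'.2.length ≤ s.2.length + 1 ∧ s'.1.length ≤ s.1.length + 1 ∧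
      (PlainToken t → ScopedEnv s.2 c.2 → (∀ x ∈ φ, Scoped s.2 x.2) →
        (∀ u ∈ s.1, Scoped s.2 u) → ScopedStores s.2 →
          (∀ u ∈ s'.1, Scoped s'.2 u) ∧ ScopedStores s'.2) := by
  simp only [evalToken, Option.bind_some] at h
  split_ifs at h with h0 h1 h2
  · obtain ⟨v, hv, rfl⟩ := Option.map_eq_some_iff.1 h
    refine ⟨List.prefix_rfl, by simp, by simp, fun _ hc _ hs hst => ⟨?_, hst⟩⟩
    exact List.forall_mem_cons.2 ⟨hc.1 v (List.mem_of_getElem? hv), hs⟩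
  · cases h
    refine ⟨List.prefix_rfl, by simp, by simp, fun ht hc _ hs hst => ⟨?_, hst⟩⟩
    exact List.forall_mem_cons.2 ⟨scoped_resolve hc (ht h1), hs⟩
  · obtain ⟨v, hv, rfl⟩ := Option.map_eq_some_iff.1 h
    refine ⟨List.prefix_rfl, by simp, by simp, fun _ _ hφ hs hst => ⟨?_, hst⟩⟩
    obtain ⟨e, he, rfl⟩ := mem_snd_of_lookup hv
    exact List.forall_mem_cons.2 ⟨hφ e he, hs⟩
  · cases h
    have hp : s.2 <+: s.2 ++ [(newName s.2 t.2.1,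
      (fieldsOf n t.2.1).zip (s.1.take t.2.2).reverse)] := List.prefix_append _ _
    refine ⟨hp, by simp, by simp, fun _ _ _ hs hst => ⟨?_, ?_⟩⟩
    · refine List.forall_mem_cons.2 ⟨fun _ => ?_, fun u hu => (hs u (List.mem_of_mem_drop hu)).mono hp⟩
      exact lookup_isSome_iff.2 ⟨_, List.mem_append_right _ (List.mem_singleton_self _), rfl⟩
    · intro e he x hx
      rcases List.mem_append.1 he with he | he
      · exact (hst e he x hx).mono hp
      · obtain rfl := List.mem_singleton.1 he
        exact (hs _ (List.mem_of_mem_take (List.mem_reverse.1 (List.of_mem_zip hx).2))).mono hp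

theorem foldl_evalToken_none (n : ℕ) (φ : List (ℕ × ℕ)) (c : Closure) (ts : List Token) :
    ts.foldl (evalToken n φ c) none = none := by
  induction ts with
  | nil => rfl
  | cons t ts ih => rw [List.foldl_cons]; exact ih

theorem foldl_evalToken_spec {n : ℕ} {φ : List (ℕ × ℕ)} {c : Closure} {ts : List Token} :
    ∀ {s s' : List ℕ × Actors}, ts.foldl (evalToken n φ c) (some s) = some s' →
    s.2 <+: s'.2 ∧ s'.2.length ≤ s.2.length + ts.length ∧
      s'.1.length ≤ s.1.length + ts.length ∧
      ((∀ t ∈ ts, PlainToken t) → ScopedEnv s.2 c.2 → (∀ x ∈ φ, Scoped s.2 x.2) →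
        (∀ u ∈ s.1, Scoped s.2 u) → ScopedStores s.2 →
          (∀ u ∈ s'.1, Scoped s'.2 u) ∧ ScopedStores s'.2) := by
  induction ts with
  | nil =>
    intro s s' h
    cases h
    exact ⟨List.prefix_rfl, by simp, by simp, fun _ _ _ hs hst => ⟨hs, hst⟩⟩
  | cons t ts ih =>
    intro s s' h
    rw [List.foldl_cons] at h
    cases h₁ : evalToken n φ c (some s) t with
    | none => rw [h₁, foldl_evalToken_none] at h; cases h
    | some s₁ =>
      rw [h₁] at h
      obtain ⟨hp, hl, hl', hs⟩ := evalToken_spec h₁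
      obtain ⟨hp', hm, hm', hs'⟩ := ih h
      refine ⟨hp.trans hp', by simp only [List.length_cons]; omega,
        by simp only [List.length_cons]; omega, fun ht hc hφ hu hst => ?_⟩
      obtain ⟨hu', hst'⟩ := hs (ht t (by simp)) hc hφ hu hst
      exact hs' (fun t ht' => ht t (by simp [ht']))
        ⟨fun u hu => (hc.1 u hu).mono hp, fun x hx => (hc.2 x hx).mono hp⟩
        (fun x hx => (hφ x hx).mono hp) hu' hst'

/-- Only `new` (kind 3) reads or changes the list of actors. Hence the steps of methods do not
depend on how many actors the main process has created so far, apart from the store of the actor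
itself. -/
theorem foldl_evalToken_static {n : ℕ} {φ : List (ℕ × ℕ)} {c : Closure} {ts : List Token}
    (hts : ∀ t ∈ ts, t.1 < 3) (acts acts' : Actors) : ∀ l : List ℕ,
    ts.foldl (evalToken n φ c) (some (l, acts)) =
      (ts.foldl (evalToken n φ c) (some (l, acts'))).map fun s => (s.1, acts) := by
  induction ts with
  | nil => intro l; rfl
  | cons t ts ih =>
    intro l
    have ih := ih fun t ht => hts t (by simp [ht])
    have ht := hts t (by simp)
    have hstep : ∀ acts, evalToken n φ c (some (l, acts)) t =
        (evalToken n φ c (some (l, [])) t).map fun s => (s.1, acts) := by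
      intro acts
      simp only [evalToken, Option.bind_some]
      split_ifs with h0 h1 h2
      · simp [Function.comp_def]
      · rfl
      · simp [Function.comp_def]
      · omega
    rw [List.foldl_cons, List.foldl_cons, hstep acts, hstep acts']
    cases evalToken n φ c (some (l, [])) t with
    | none => simp [foldl_evalToken_none]
    | some s => exact ih s.1

theorem kind_atomTokens {n : ℕ} : ∀ t ∈ atomTokens n, t.1 < 3 := by
  intro t ht
  unfold atomTokens at ht
  split_ifs at ht <;> (obtain rfl := List.mem_singleton.1 ht; simp)

theorem kind_exprTokens (n : ℕ) : (∀ t ∈ exprTokens n, t.1 ≤ 3) ∧ ∀ t ∈ argsTokens n, t.1 ≤ 3 := by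
  induction n using Nat.strong_induction_on with
  | _ n ih =>
    have h1 := unpair_add_le n
    constructor
    · intro t ht
      rcases Nat.lt_trichotomy n.unpair.1 1 with h | h | h
      · rw [exprTokens_of_atom (by omega)] at ht
        exact (kind_atomTokens t ht).le
      · rw [exprTokens_of_field h] at ht
        obtain rfl := List.mem_singleton.1 ht
        simp
      · have h2 := unpair_add_le n.unpair.2
        rw [exprTokens_of_new h] at ht
        rcases List.mem_append.1 ht with ht | ht
        · exact (ih n.unpair.2.unpair.2 (by omega)).2 t ht
        · obtain rfl := List.mem_singleton.1 ht
          simp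
    · cases n with
      | zero => simp
      | succ n =>
        have h2 := unpair_add_le n
        intro t ht
        rw [argsTokens_succ] at ht
        rcases List.mem_append.1 ht with ht | ht
        · exact (ih n.unpair.1 (by omega)).1 t ht
        · exact (ih n.unpair.2 (by omega)).2 t ht

theorem mem_procSteps {n : ℕ} {φ : List (ℕ × ℕ)} {acts acts' : Actors} {c p : Closure}
    {o : Option (ℕ × Message)} : (o, p, acts') ∈ procSteps n φ acts c ↔
      (c.1.unpair.1 = 2 ∧ ∃ l, evalTokens n φ c acts (exprTokens c.1.unpair.2.unpair.1) =
          some (l, acts') ∧ o = none ∧ p = (c.1.unpair.2.unpair.2, l.headI :: c.2.1, c.2.2)) ∨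
      (c.1.unpair.1 = 3 ∧ ∃ l₀ acts₀ l, evalTokens n φ c acts (atomTokens c.1.unpair.2.unpair.1) =
          some (l₀, acts₀) ∧ evalTokens n φ c acts
            (argsTokens c.1.unpair.2.unpair.2.unpair.2.unpair.1) = some (l, acts') ∧
          o = some (l₀.headI, (c.1.unpair.2.unpair.2.unpair.1,
            canon (n.unpair.1 + 1) l.reverse)) ∧
          p = (c.1.unpair.2.unpair.2.unpair.2.unpair.2, c.2)) ∨
      (c.1.unpair.1 = 4 ∧ ∃ l, evalTokens n φ c acts (exprTokens c.1.unpair.2.unpair.1 ++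
          exprTokens c.1.unpair.2.unpair.2.unpair.1) = some (l, acts') ∧ o = none ∧
          p = (if l.headI = l.tail.headI then c.1.unpair.2.unpair.2.unpair.2.unpair.1
            else c.1.unpair.2.unpair.2.unpair.2.unpair.2, c.2)) ∨
      (c.1.unpair.1 = 5 ∧ acts' = acts ∧ o = none ∧
        (p = (c.1.unpair.2.unpair.1, c.2) ∨ p = (c.1.unpair.2.unpair.2, c.2))) := by
  unfold procSteps procStepsCase
  split_ifs with h2 h3 h4 h5
  · simp only [h2, List.mem_map, Option.mem_toList, Prod.mk.injEq, Prod.exists,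
      true_and, Nat.reduceEqDiff, false_and, or_false]
    constructor
    · rintro ⟨l, a, h, rfl, rfl, rfl⟩
      exact ⟨l, h, rfl, rfl⟩
    · rintro ⟨l, h, rfl, rfl⟩
      exact ⟨l, _, h, rfl, rfl, rfl⟩
  · simp only [h3, List.mem_flatMap, List.mem_map, Option.mem_toList,
      Prod.mk.injEq, Prod.exists, true_and, Nat.reduceEqDiff, false_and, or_false, false_or]
    constructor
    · rintro ⟨l₀, a₀, h₀, l, a, h, rfl, rfl, rfl⟩
      exact ⟨l₀, a₀, l, h₀, h, rfl, rfl⟩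
    · rintro ⟨l₀, a₀, l, h₀, h, rfl, rfl⟩
      exact ⟨l₀, a₀, h₀, l, _, h, rfl, rfl, rfl⟩
  · simp only [h4, List.mem_map, Option.mem_toList, Prod.mk.injEq, Prod.exists,
      true_and, Nat.reduceEqDiff, false_and, or_false, false_or]
    constructor
    · rintro ⟨l, a, h, rfl, rfl, rfl⟩
      exact ⟨l, h, rfl, rfl⟩
    · rintro ⟨l, h, rfl, rfl⟩
      exact ⟨l, _, h, rfl, rfl, rfl⟩
  · simp only [h5, List.mem_cons, List.not_mem_nil, Prod.mk.injEq,
      true_and, Nat.reduceEqDiff, false_and, or_false, false_or]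
    constructor
    · rintro (⟨rfl, rfl, rfl⟩ | ⟨rfl, rfl, rfl⟩)
      exacts [⟨rfl, rfl, .inl rfl⟩, ⟨rfl, rfl, .inr rfl⟩]
    · rintro ⟨rfl, rfl, rfl | rfl⟩
      exacts [.inl ⟨rfl, rfl, rfl⟩, .inr ⟨rfl, rfl, rfl⟩]
  · simp [h2, h3, h4, h5]

/-- Properties of tokens that are inherited by the continuation of a process. -/
theorem forall_procTokens_of_step {n : ℕ} {φ : List (ℕ × ℕ)} {acts acts' : Actors} {c p : Closure}
    {o : Option (ℕ × Message)} (h : (o, p, acts') ∈ procSteps n φ acts c) {Q : Token → Prop}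
    (hQ : ∀ t, Q (liftToken t) → Q t) (hc : ∀ t ∈ procTokens c.1, Q t) :
    ∀ t ∈ procTokens p.1, Q t := by
  intro t ht
  rcases mem_procSteps.1 h with ⟨hk, l, -, -, rfl⟩ | ⟨hk, l₀, a₀, l, -, -, -, rfl⟩ |
    ⟨hk, l, -, -, rfl⟩ | ⟨hk, -, -, rfl | rfl⟩
  · rw [procTokens_of_letIn hk] at hc
    refine hQ t (hc _ ?_)
    simp only [List.mem_append, List.mem_map]
    exact .inl (.inr ⟨t, ht, rfl⟩)
  · rw [procTokens_of_invoke hk] at hc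
    exact hc t (by simp only [List.mem_append]; exact .inl (.inr ht))
  · rw [procTokens_of_cond hk] at hc
    refine hc t ?_
    simp only [List.mem_append]
    split_ifs at ht
    exacts [.inl (.inl (.inr ht)), .inl (.inr ht)]
  · rw [procTokens_of_plus (by omega)] at hc
    exact hc t (by simp only [List.mem_append]; exact .inl (.inl ht))
  · rw [procTokens_of_plus (by omega)] at hc
    exact hc t (by simp only [List.mem_append]; exact .inl (.inr ht))

/-- The code of a process contains the codes of the evaluated expressions besides that of the
continuation, and the number of the constructor is a surplus. Thus created actors are paid for by
the decrease of the code, and the number of actors stays bounded along the main process. -/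
theorem procSteps_size {n : ℕ} {φ : List (ℕ × ℕ)} {acts acts' : Actors} {c p : Closure}
    {o : Option (ℕ × Message)} (h : (o, p, acts') ∈ procSteps n φ acts c) :
    p.1 < c.1 ∧ p.1 + acts'.length < c.1 + acts.length ∧ acts <+: acts' := by
  have h1 := unpair_add_le c.1
  have h2 := unpair_add_le c.1.unpair.2
  have h3 := unpair_add_le c.1.unpair.2.unpair.2
  have h4 := unpair_add_le c.1.unpair.2.unpair.2.unpair.2
  rcases mem_procSteps.1 h with ⟨hk, l, he, -, rfl⟩ | ⟨hk, l₀, a₀, l, -, he, -, rfl⟩ |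
    ⟨hk, l, he, -, rfl⟩ | ⟨hk, rfl, -, rfl | rfl⟩
  · obtain ⟨hp, hl, -, -⟩ := foldl_evalToken_spec he
    have := (length_exprTokens_le c.1.unpair.2.unpair.1).1
    simp only at hl ⊢
    exact ⟨by omega, by omega, hp⟩
  · obtain ⟨hp, hl, -, -⟩ := foldl_evalToken_spec he
    have := (length_exprTokens_le c.1.unpair.2.unpair.2.unpair.2.unpair.1).2
    simp only at hl ⊢
    exact ⟨by omega, by omega, hp⟩
  · obtain ⟨hp, hl, -, -⟩ := foldl_evalToken_spec he
    have := (length_exprTokens_le c.1.unpair.2.unpair.1).1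
    have := (length_exprTokens_le c.1.unpair.2.unpair.2.unpair.1).1
    simp only [List.length_append] at hl ⊢
    split_ifs <;> exact ⟨by omega, by omega, hp⟩
  · simp only
    exact ⟨by omega, by omega, List.prefix_rfl⟩
  · simp only
    exact ⟨by omega, by omega, List.prefix_rfl⟩

theorem headI_mem_or {l : List ℕ} : l.headI ∈ l ∨ l.headI = 0 := by
  cases l with
  | nil => exact .inr rfl
  | cons a l => exact .inl (by simp)

theorem mem_canon {b : ℕ} {vs : List ℕ} {u : ℕ} (h : u ∈ canon b vs) :
    (u.unpair.1 = 0 → u.unpair.2 < b + vs.length) ∧ (u.unpair.1 ≠ 0 → u ∈ vs) := by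
  obtain ⟨v, hv, rfl⟩ := List.mem_map.1 h
  unfold canonVal
  split_ifs with hb
  · refine ⟨fun _ => ?_, fun h => absurd (by simp) h⟩
    have := List.idxOf_lt_length_of_mem hv
    simpa using this
  · refine ⟨fun h0 => ?_, fun _ => hv⟩
    have : v.unpair.2 < b := by
      by_contra h'
      exact hb ⟨h0, h'⟩
    omega

theorem length_canon (b : ℕ) (vs : List ℕ) : (canon b vs).length = vs.length := by simp [canon]

/-- Actor names cannot be invented: plain tokens contain none, so each one comes from the
environment, from a store, or from `new`. -/
theorem procSteps_scoped {n : ℕ} {φ : List (ℕ × ℕ)} {acts acts' : Actors} {c p : Closure}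
    {o : Option (ℕ × Message)} (h : (o, p, acts') ∈ procSteps n φ acts c)
    (hc : ∀ t ∈ procTokens c.1, PlainToken t) (he : ScopedEnv acts c.2)
    (hφ : ∀ x ∈ φ, Scoped acts x.2) (hs : ScopedStores acts) :
    ScopedEnv acts' p.2 ∧ (∀ x ∈ o, ∀ u ∈ x.2.2, Scoped acts' u) ∧ ScopedStores acts' := by
  have hp := (procSteps_size h).2.2
  have he' : ScopedEnv acts' c.2 :=
    ⟨fun u hu => (he.1 u hu).mono hp, fun x hx => (he.2 x hx).mono hp⟩
  rcases mem_procSteps.1 h with ⟨hk, l, hl, rfl, rfl⟩ | ⟨hk, l₀, a₀, l, -, hl, rfl, rfl⟩ |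
    ⟨hk, l, hl, rfl, rfl⟩ | ⟨hk, rfl, rfl, rfl | rfl⟩
  · rw [procTokens_of_letIn hk] at hc
    obtain ⟨-, -, -, h'⟩ := foldl_evalToken_spec hl
    obtain ⟨hu, hst⟩ := h' (fun t ht => hc t (by simp [ht])) he hφ (by simp) hs
    refine ⟨⟨List.forall_mem_cons.2 ⟨?_, he'.1⟩, he'.2⟩, by simp, hst⟩
    rcases headI_mem_or (l := l) with h0 | h0
    · exact hu _ h0
    · rw [h0]; exact scoped_zero _
  · rw [procTokens_of_invoke hk] at hc
    obtain ⟨-, -, -, h'⟩ := foldl_evalToken_spec hl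
    obtain ⟨hu, hst⟩ := h' (fun t ht => hc t (by simp [ht])) he hφ (by simp) hs
    refine ⟨he', ?_, hst⟩
    intro x hx u hu' h0
    obtain rfl := Option.mem_some_iff.1 hx
    exact hu u (by simpa using (mem_canon hu').2 h0) h0
  · rw [procTokens_of_cond hk] at hc
    obtain ⟨-, -, -, h'⟩ := foldl_evalToken_spec hl
    obtain ⟨hu, hst⟩ := h' (fun t ht => hc t (by
      rcases List.mem_append.1 ht with ht | ht <;> simp [ht])) he hφ (by simp) hs
    exact ⟨he', by simp, hst⟩
  · exact ⟨he', by simp, hs⟩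
  · exact ⟨he', by simp, hs⟩

/-- With `procSteps_scoped`, this confines the messages to a finite set: the last bound is the
effect of `canon`. -/
theorem procSteps_sent {n : ℕ} {φ : List (ℕ × ℕ)} {acts acts' : Actors} {c p : Closure}
    {o : Option (ℕ × Message)} (h : (o, p, acts') ∈ procSteps n φ acts c) :
    ∀ x ∈ o, x.2.1 ≤ c.1 ∧ x.2.2.length ≤ c.1 ∧
      ∀ u ∈ x.2.2, u.unpair.1 = 0 → u.unpair.2 < n.unpair.1 + 1 + x.2.2.length := by
  have h1 := unpair_add_le c.1
  have h2 := unpair_add_le c.1.unpair.2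
  have h3 := unpair_add_le c.1.unpair.2.unpair.2
  have h4 := unpair_add_le c.1.unpair.2.unpair.2.unpair.2
  rcases mem_procSteps.1 h with ⟨hk, l, hl, rfl, rfl⟩ | ⟨hk, l₀, a₀, l, -, hl, rfl, rfl⟩ |
    ⟨hk, l, hl, rfl, rfl⟩ | ⟨hk, rfl, rfl, -⟩
  · simp
  · intro x hx
    obtain rfl := Option.mem_some_iff.1 hx
    obtain ⟨-, -, h', -⟩ := foldl_evalToken_spec hl
    have := (length_exprTokens_le c.1.unpair.2.unpair.2.unpair.2.unpair.1).2
    simp only [List.length_nil] at h'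
    refine ⟨by simp only; omega, by simp only [length_canon, List.length_reverse]; omega, ?_⟩
    intro u hu hu0
    have := (mem_canon hu).1 hu0
    rwa [length_canon]
  · simp
  · simp

theorem procSteps_static {n : ℕ} {φ : List (ℕ × ℕ)} {acts acts' : Actors} {c p : Closure}
    {o : Option (ℕ × Message)} (h : (o, p, acts') ∈ procSteps n φ acts c)
    (hc : ∀ t ∈ procTokens c.1, t.1 ≠ 3) (acts₁ : Actors) :
    (o, p, acts₁) ∈ procSteps n φ acts₁ c := by
  have key : ∀ ts l acts', (∀ t ∈ ts, t.1 < 3) → evalTokens n φ c acts ts = some (l, acts') →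
      evalTokens n φ c acts₁ ts = some (l, acts₁) := by
    intro ts l acts' hts h
    have := foldl_evalToken_static (φ := φ) (n := n) (c := c) hts acts₁ acts []
    rw [evalTokens] at h ⊢
    rw [this, h]
    rfl
  rcases mem_procSteps.1 h with ⟨hk, l, hl, rfl, rfl⟩ | ⟨hk, l₀, a₀, l, hl₀, hl, rfl, rfl⟩ |
    ⟨hk, l, hl, rfl, rfl⟩ | ⟨hk, rfl, rfl, hp⟩
  · rw [procTokens_of_letIn hk] at hc
    refine mem_procSteps.2 (.inl ⟨hk, l, key _ _ _ (fun t ht => ?_) hl, rfl, rfl⟩)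
    exact lt_of_le_of_ne ((kind_exprTokens _).1 t ht) (hc t (by simp [ht]))
  · rw [procTokens_of_invoke hk] at hc
    refine mem_procSteps.2 (.inr (.inl ⟨hk, l₀, acts₁, l, key _ _ _ kind_atomTokens hl₀,
      key _ _ _ (fun t ht => ?_) hl, rfl, rfl⟩))
    exact lt_of_le_of_ne ((kind_exprTokens _).2 t ht) (hc t (by simp [ht]))
  · rw [procTokens_of_cond hk] at hc
    refine mem_procSteps.2 (.inr (.inr (.inl ⟨hk, l, key _ _ _ (fun t ht => ?_) hl, rfl, rfl⟩)))
    rcases List.mem_append.1 ht with ht | ht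
    · exact lt_of_le_of_ne ((kind_exprTokens _).1 t ht) (hc t (by simp [ht]))
    · exact lt_of_le_of_ne ((kind_exprTokens _).1 t ht) (hc t (by simp [ht]))
  · exact mem_procSteps.2 (.inr (.inr (.inr ⟨hk, rfl, rfl, hp⟩)))


open ActorSystem (send send_apply)

/-! ### An invariant of the machine -/

/-- No actor names occur in the program with the code `n`, and `new` occurs in the main process
only. -/
def ProgramOk (n : ℕ) : Prop :=
  (∀ t ∈ procTokens n.unpair.1, PlainToken t) ∧
    ∀ d ∈ Denumerable.ofNat (List ℕ) n.unpair.2.unpair.2,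
      ∀ t ∈ procTokens d.unpair.2.unpair.2.unpair.2, PlainToken t ∧ t.1 ≠ 3

/-- The field `length` bounds the number of actors, the code of the main process being the reserve
for those still to come. By `known`, actors not yet created have neither a process nor messages. By
`plain`, the processes of actors contain no `new`. -/
structure Inv (n : ℕ) (s : Conf) : Prop where
  length : s.1.1.length + s.1.2.1 ≤ n + 1
  names : ∀ e ∈ s.1.1, e.1.unpair.1 ≠ 0
  mainSize : s.1.2.1 ≤ n
  mainPlain : ∀ t ∈ procTokens s.1.2.1, PlainToken t
  mainEnv : ScopedEnv s.1.1 s.1.2.2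
  stores : ScopedStores s.1.1
  size : ∀ v, (s.2 v).1.1 ≤ n
  plain : ∀ v, ∀ t ∈ procTokens (s.2 v).1.1, PlainToken t ∧ t.1 ≠ 3
  env : ∀ v, ScopedEnv s.1.1 (s.2 v).1.2
  msgs : ∀ v, ∀ m ∈ (s.2 v).2, ∀ u ∈ m.2, Scoped s.1.1 u
  known : ∀ v, (s.2 v).1.1 ≠ 0 ∨ (s.2 v).2 ≠ [] → (s.1.1.lookup v).isSome

theorem le_of_mem_ofNat {k d : ℕ} (h : d ∈ Denumerable.ofNat (List ℕ) k) : d ≤ k := by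
  have key : ∀ l : List ℕ, d ∈ l → d ≤ Encodable.encode l := by
    intro l
    induction l with
    | nil => simp
    | cons a l ih =>
      intro hd
      rw [Encodable.encode_list_cons]
      have := Nat.add_le_pair (Encodable.encode a) (Encodable.encode l)
      rw [Encodable.encode_nat] at this ⊢
      rcases List.mem_cons.1 hd with rfl | hd
      · omega
      · have := ih hd
        omega
  simpa using key _ h

theorem plainToken_of_lift {t : Token} (h : PlainToken (liftToken t)) : PlainToken t := by
  intro ht
  have h' : liftToken t = t := by simp [liftToken, ht]
  rw [h'] at h
  exact h ht

theorem kind_liftToken (t : Token) : (liftToken t).1 = t.1 := by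
  unfold liftToken
  split_ifs with h
  · exact h.symm
  · rfl

theorem ScopedEnv.mono {acts acts' : Actors} (h : acts <+: acts') {e}
    (he : ScopedEnv acts e) : ScopedEnv acts' e :=
  ⟨fun u hu => (he.1 u hu).mono h, fun x hx => (he.2 x hx).mono h⟩

theorem starts_spec {n v : ℕ} (hn : ProgramOk n) {m : Message} {p : Closure}
    (h : p ∈ starts n v m) :
    p.1 ≤ n ∧ (∀ t ∈ procTokens p.1, PlainToken t ∧ t.1 ≠ 3) ∧ p.2.1 = [] ∧
      ∀ x ∈ p.2.2.1, x.2 = v ∨ x.2 ∈ m.2 := by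
  obtain ⟨d, hd, rfl⟩ := List.mem_map.1 h
  have hd := (List.mem_filter.1 hd).1
  refine ⟨?_, hn.2 d hd, rfl, ?_⟩
  · have := le_of_mem_ofNat hd
    have := unpair_add_le n
    have := unpair_add_le n.unpair.2
    have := unpair_add_le d
    have := unpair_add_le d.unpair.2
    have := unpair_add_le d.unpair.2.unpair.2
    simp only
    omega
  · intro x hx
    rcases List.mem_cons.1 hx with rfl | hx
    · exact .inl rfl
    · exact .inr (List.of_mem_zip hx).2

theorem scoped_stores_lookup {acts : Actors} (h : ScopedStores acts) {v : ℕ}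
    {φ : List (ℕ × ℕ)} (hv : acts.lookup v = some φ) : ∀ x ∈ φ, Scoped acts x.2 := by
  obtain ⟨e, he, rfl⟩ := mem_snd_of_lookup hv
  exact h e he

theorem procSteps_names {n : ℕ} {φ : List (ℕ × ℕ)} {acts acts' : Actors} {c p : Closure}
    {o : Option (ℕ × Message)} (h : (o, p, acts') ∈ procSteps n φ acts c)
    (hn : ∀ e ∈ acts, e.1.unpair.1 ≠ 0) : ∀ e ∈ acts', e.1.unpair.1 ≠ 0 := by
  have key : ∀ (ts : List Token) (s s' : List ℕ × Actors),
      ts.foldl (evalToken n φ c) (some s) = some s' → (∀ e ∈ s.2, e.1.unpair.1 ≠ 0) →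
        ∀ e ∈ s'.2, e.1.unpair.1 ≠ 0 := by
    intro ts
    induction ts with
    | nil => intro s s' h hs; cases h; exact hs
    | cons t ts ih =>
      intro s s' h hs
      rw [List.foldl_cons] at h
      cases h₁ : evalToken n φ c (some s) t with
      | none => rw [h₁, foldl_evalToken_none] at h; cases h
      | some s₁ =>
        rw [h₁] at h
        refine ih s₁ s' h ?_
        simp only [evalToken, Option.bind_some] at h₁
        split_ifs at h₁
        · obtain ⟨_, -, rfl⟩ := Option.map_eq_some_iff.1 h₁; exact hs
        · cases h₁; exact hs
        · obtain ⟨_, -, rfl⟩ := Option.map_eq_some_iff.1 h₁; exact hs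
        · cases h₁
          intro e he
          rcases List.mem_append.1 he with he | he
          · exact hs e he
          · obtain rfl := List.mem_singleton.1 he
            simp [newName]
  rcases mem_procSteps.1 h with ⟨-, l, hl, -, -⟩ | ⟨-, l₀, a₀, l, -, hl, -, -⟩ |
    ⟨-, l, hl, -, -⟩ | ⟨-, rfl, -, -⟩
  · exact key _ _ _ hl hn
  · exact key _ _ _ hl hn
  · exact key _ _ _ hl hn
  · exact hn

theorem scoped_target {n : ℕ} {φ : List (ℕ × ℕ)} {acts acts' : Actors} {c p : Closure}
    {o : Option (ℕ × Message)} (h : (o, p, acts') ∈ procSteps n φ acts c)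
    (hc : ∀ t ∈ procTokens c.1, PlainToken t) (he : ScopedEnv acts c.2)
    (hφ : ∀ x ∈ φ, Scoped acts x.2) (hs : ScopedStores acts) : ∀ x ∈ o, Scoped acts x.1 := by
  rcases mem_procSteps.1 h with ⟨-, l, -, rfl, -⟩ | ⟨hk, l₀, a₀, l, hl, -, rfl, -⟩ |
    ⟨-, l, -, rfl, -⟩ | ⟨-, -, rfl, -⟩
  · simp
  · intro x hx
    obtain rfl := Option.mem_some_iff.1 hx
    rw [procTokens_of_invoke hk] at hc
    have hst := foldl_evalToken_static (n := n) (φ := φ) (c := c)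
      (kind_atomTokens (n := c.1.unpair.2.unpair.1)) acts acts []
    rw [evalTokens] at hl
    rw [hl] at hst
    obtain ⟨-, -, -, h'⟩ := foldl_evalToken_spec hl
    obtain ⟨hu, -⟩ := h' (fun t ht => hc t (by simp [ht])) he hφ (by simp) hs
    obtain rfl : a₀ = acts := by simpa using hst
    rcases headI_mem_or (l := l₀) with h0 | h0
    · exact hu _ h0
    · simp only [h0]; exact scoped_zero _
  · simp
  · simp

/-- Sending a message preserves the properties of the states of the actors. -/
theorem Inv.send {n : ℕ} {g : MainState} {c : ℕ → LocalState} (h : Inv n (g, c))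
    {o : Option (ℕ × Message)} (ho : ∀ x ∈ o, ∀ u ∈ x.2.2, Scoped g.1 u) (hk : Known g.1 o) :
    Inv n (g, send o c) where
  length := h.length
  names := h.names
  mainSize := h.mainSize
  mainPlain := h.mainPlain
  mainEnv := h.mainEnv
  stores := h.stores
  size v := by simp only [send_apply]; exact h.size v
  plain v := by simp only [send_apply]; exact h.plain v
  env v := by simp only [send_apply]; exact h.env v
  msgs v m hm := by
    simp only [send_apply] at hm
    rcases List.mem_append.1 hm with hm | hm
    · exact h.msgs v m hm
    · exact ho (v, m) (ActorSystem.mem_inbox.1 hm)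
  known v hv := by
    simp only [send_apply] at hv
    by_cases hi : ActorSystem.inbox o v = []
    · rw [hi, List.append_nil] at hv
      exact h.known v hv
    · obtain ⟨m, hm⟩ := List.exists_mem_of_ne_nil _ hi
      exact hk (v, m) (by rw [ActorSystem.mem_inbox.1 hm]; simp)

theorem Inv.update {n : ℕ} {g : MainState} {c : ℕ → LocalState} (h : Inv n (g, c)) {v : ℕ}
    (hv : (g.1.lookup v).isSome) {x : LocalState} (hx : x.1.1 ≤ n)
    (hp : ∀ t ∈ procTokens x.1.1, PlainToken t ∧ t.1 ≠ 3) (he : ScopedEnv g.1 x.1.2)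
    (hm : ∀ m ∈ x.2, ∀ u ∈ m.2, Scoped g.1 u) : Inv n (g, Function.update c v x) where
  length := h.length
  names := h.names
  mainSize := h.mainSize
  mainPlain := h.mainPlain
  mainEnv := h.mainEnv
  stores := h.stores
  size w := by
    by_cases hw : w = v
    · subst hw; simpa using hx
    · simpa [hw] using h.size w
  plain w := by
    by_cases hw : w = v
    · subst hw; simpa using hp
    · simpa [hw] using h.plain w
  env w := by
    by_cases hw : w = v
    · subst hw; simpa using he
    · simpa [hw] using h.env w
  msgs w := by
    by_cases hw : w = v
    · subst hw; simpa using hm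
    · simpa [hw] using h.msgs w
  known w hw' := by
    by_cases hw : w = v
    · subst hw; exact hv
    · exact h.known w (by simpa [hw] using hw')

theorem Known.mono {acts acts' : Actors} (h : acts <+: acts') {o : Option (ℕ × Message)}
    (ho : Known acts o) : Known acts' o := fun x hx =>
  List.Sublist.lookup_isSome h.sublist (ho x hx)

theorem Inv.move {n : ℕ} (hn : ProgramOk n) {s t : Conf} (h : Inv n s) (hm : Move n s t) :
    Inv n t := by
  cases hm with
  | main g c o p acts hp ho =>
    obtain ⟨hlt, hlen, hpre⟩ := procSteps_size hp
    obtain ⟨he, hsent, hst⟩ := procSteps_scoped hp h.mainPlain h.mainEnv (by simp) h.stores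
    have hl := h.length
    have hl' := h.mainSize
    simp only at hl hl'
    refine Inv.send (g := (acts, p)) ?_ hsent (ho.mono hpre)
    exact {
      length := by simp only; omega
      names := procSteps_names hp h.names
      mainSize := by simp only; omega
      mainPlain := forall_procTokens_of_step hp (fun _ => plainToken_of_lift) h.mainPlain
      mainEnv := he
      stores := hst
      size := h.size
      plain := h.plain
      env := fun v => (h.env v).mono hpre
      msgs := fun v m hm u hu => (h.msgs v m hm u hu).mono hpre
      known := fun v hv => List.Sublist.lookup_isSome hpre.sublist (h.known v hv) }
  | proc g c v φ o p acts hv hp ho =>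
    -- Methods create no actors, so the step can be taken with the list of actors unchanged.
    have hp := procSteps_static hp (fun t ht => (h.plain v t ht).2) g.1
    have hφ := scoped_stores_lookup h.stores hv
    obtain ⟨hlt, -, -⟩ := procSteps_size hp
    obtain ⟨he, hsent, -⟩ :=
      procSteps_scoped hp (fun t ht => (h.plain v t ht).1) (h.env v) hφ h.stores
    refine Inv.send (h.update (v := v) (x := (p, (c v).2)) (Option.isSome_iff_exists.2 ⟨φ, hv⟩) (hlt.le.trans (h.size v)) ?_ he (h.msgs v)) hsent ho
    exact forall_procTokens_of_step hp (Q := fun t => PlainToken t ∧ t.1 ≠ 3)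
      (fun t ht => ⟨plainToken_of_lift ht.1, by rw [← kind_liftToken]; exact ht.2⟩) (h.plain v)
  | start g c v m q p hv hi hq hp =>
    obtain ⟨hle, hpl, henv, hσ⟩ := starts_spec hn hp
    have hmsgs := h.msgs v
    simp only [hq] at hmsgs
    refine h.update hv hle hpl ⟨by rw [henv]; simp, fun x hx => ?_⟩
      fun k hk => hmsgs k (by simp [hk])
    rcases hσ x hx with hx | hx
    · rw [hx]; exact fun _ => hv
    · exact hmsgs m (by simp) _ hx

theorem stateAt_nil : stateAt [] = fun _ => idleState := by
  funext v; simp [stateAt]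

theorem inv_initial {n : ℕ} (hn : ProgramOk n) : Inv n (initialMachine n).conf := by
  have h1 := unpair_add_le n
  have h2 : procTokens 0 = [(4, 0, 0)] := procTokens_of_nil (by simp)
  refine {
    length := ?_, names := ?_, mainSize := ?_, mainPlain := hn.1, mainEnv := ?_, stores := ?_,
    size := ?_, plain := ?_, env := ?_, msgs := ?_, known := ?_ }
  all_goals
    simp [Machine.conf, initialMachine, stateAt_nil, idleState, ScopedEnv, ScopedStores, h2,
      PlainToken]
  all_goals omega

/-! ### A bound for the number of moves -/

/-- The values that can be sent if `Φ` are the actors. -/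
def sendableValues (n : ℕ) (Φ : Actors) : Finset ℕ :=
  (Φ.map Prod.fst).toFinset ∪ (Finset.range (2 * n + 2)).image (Nat.pair 0)

/-- The messages that can be sent if `Φ` are the actors, with their targets. -/
def sendableMessages (n : ℕ) (Φ : Actors) : Finset (ℕ × Message) :=
  ((Φ.map Prod.fst).toFinset ×ˢ Finset.range (n + 1) ×ˢ
    Fintype.piFinset fun _ : Fin n => Finset.insertNone (sendableValues n Φ)).image
      fun x => (x.1, x.2.1, (List.ofFn x.2.2).reduceOption)

/-- The factors count the targets, the method names, and the argument tuples: each of `n` slots is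
empty or holds one of at most `n + 1` actor names and `2 * n + 2` variables. -/
def messageBound (n : ℕ) : ℕ := (n + 1) * ((n + 1) * (3 * n + 4) ^ n)

/-- This is the bound of `ActorSystem.exists_run_le`, with `n` for the sizes of all processes and
`messageBound n` for the number of messages. -/
def moveBound (n : ℕ) : ℕ := (2 * n + 2) * (4 * n + 9) ^ (messageBound n + 1)

theorem card_sendableMessages_le {n : ℕ} {Φ : Actors} (h : Φ.length ≤ n + 1) :
    (sendableMessages n Φ).card ≤ messageBound n := by
  have h1 : (Φ.map Prod.fst).toFinset.card ≤ n + 1 :=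
    (List.toFinset_card_le _).trans (by simpa using h)
  have h2 : (sendableValues n Φ).card + 1 ≤ 3 * n + 4 := by
    have := Finset.card_union_le (Φ.map Prod.fst).toFinset
      ((Finset.range (2 * n + 2)).image (Nat.pair 0))
    have h3 := Finset.card_image_le (s := Finset.range (2 * n + 2)) (f := Nat.pair 0)
    rw [Finset.card_range] at h3
    rw [sendableValues]
    omega
  refine Finset.card_image_le.trans ?_
  rw [Finset.card_product, Finset.card_product, Finset.card_range, Fintype.card_piFinset]
  simp only [Finset.card_insertNone, Finset.prod_const, Finset.card_univ, Fintype.card_fin]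
  exact Nat.mul_le_mul h1 (Nat.mul_le_mul_left _ (Nat.pow_le_pow_left h2 n))

theorem reduceOption_ofFn_getElem? {β : Type*} {n : ℕ} {l : List β} (h : l.length ≤ n) :
    (List.ofFn fun i : Fin n => l[(i : ℕ)]?).reduceOption = l := by
  induction n generalizing l with
  | zero =>
    obtain rfl := List.length_eq_zero_iff.1 (Nat.le_zero.1 h)
    simp
  | succ n ih =>
    cases l with
    | nil =>
      rw [List.ofFn_succ]
      simp
    | cons b l =>
      rw [List.ofFn_succ]
      simpa using ih (l := l) (by simpa using h)

theorem mem_sendableMessages {n : ℕ} {Φ : Actors} {x : ℕ × Message}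
    (h1 : (Φ.lookup x.1).isSome) (h2 : x.2.1 ≤ n) (h3 : x.2.2.length ≤ n)
    (h4 : ∀ u ∈ x.2.2, Scoped Φ u ∧ (u.unpair.1 = 0 → u.unpair.2 < 2 * n + 2)) :
    x ∈ sendableMessages n Φ := by
  have hname : ∀ {v}, (Φ.lookup v).isSome → v ∈ (Φ.map Prod.fst).toFinset := by
    intro v hv
    obtain ⟨e, he, rfl⟩ := lookup_isSome_iff.1 hv
    exact List.mem_toFinset.2 (List.mem_map_of_mem he)
  refine Finset.mem_image.2 ⟨(x.1, x.2.1, fun i => x.2.2[(i : ℕ)]?), ?_, ?_⟩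
  · simp only [Finset.mem_product, Finset.mem_range, Fintype.mem_piFinset]
    refine ⟨hname h1, by omega, fun i => ?_⟩
    rw [Finset.mem_insertNone]
    intro u hu
    obtain ⟨hs, hu'⟩ := h4 u (List.mem_of_getElem? hu)
    rw [sendableValues, Finset.mem_union]
    by_cases h0 : u.unpair.1 = 0
    · refine .inr (Finset.mem_image.2 ⟨u.unpair.2, Finset.mem_range.2 (hu' h0), ?_⟩)
      conv_rhs => rw [← Nat.pair_unpair u, h0]
    · exact .inl (hname (hs h0))
  · simp [reduceOption_ofFn_getElem? h3]

/-- The machine with the final actors `Φ`, as a system of actors. -/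
def machineSystem (n : ℕ) (Φ : Actors) : ActorSystem MainState ℕ Closure Message where
  mainStep g o g' := (o, g'.2, g'.1) ∈ procSteps n [] g.1 g.2 ∧ g'.1 <+: Φ ∧
    ∀ x ∈ o, x.1.unpair.1 ≠ 0 ∧ x ∈ sendableMessages n Φ
  step v p o p' := ∃ φ, Φ.lookup v = some φ ∧ (o, p', Φ) ∈ procSteps n φ Φ p ∧
    ∀ x ∈ o, x.1.unpair.1 ≠ 0 ∧ x ∈ sendableMessages n Φ
  start v m p := p ∈ starts n v m
  idle p := p.1 = 0

theorem lookup_prefix {acts Φ : Actors} (h : acts <+: Φ) {v : ℕ} {φ : List (ℕ × ℕ)}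
    (hv : acts.lookup v = some φ) : Φ.lookup v = some φ := by
  obtain ⟨l, rfl⟩ := h
  rw [List.lookup_append, hv]; rfl

theorem sendable_of_procSteps {n : ℕ} {φ : List (ℕ × ℕ)} {acts acts' Φ : Actors} {c p : Closure}
    {o : Option (ℕ × Message)} (h : (o, p, acts') ∈ procSteps n φ acts c) (ho : Known acts o)
    (hnames : ∀ e ∈ acts, e.1.unpair.1 ≠ 0) (hpre : acts' <+: Φ) (hsize : c.1 ≤ n)
    (hsent : ∀ x ∈ o, ∀ u ∈ x.2.2, Scoped acts' u) :
    ∀ x ∈ o, x.1.unpair.1 ≠ 0 ∧ x ∈ sendableMessages n Φ := by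
  intro x hx
  have hk : (acts.lookup x.1).isSome := ho x (Option.mem_toList.2 hx)
  obtain ⟨h1, h2, h3⟩ := procSteps_sent h x hx
  have hn := unpair_add_le n
  constructor
  · obtain ⟨e, he, hex⟩ := lookup_isSome_iff.1 hk
    exact hex ▸ hnames e he
  · refine mem_sendableMessages
      (List.Sublist.lookup_isSome ((procSteps_size h).2.2.trans hpre).sublist hk) (by omega)
      (by omega) fun u hu => ⟨(hsent x hx u hu).mono hpre, fun h0 => ?_⟩
    have := h3 u hu h0
    omega

theorem Inv.next_of_move {n : ℕ} {s t : Conf} (h : Inv n s) (hm : Move n s t) {Φ : Actors}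
    (hΦ : t.1.1 <+: Φ) : (machineSystem n Φ).Next s t := by
  cases hm with
  | main g c o p acts hp ho =>
    refine .main g (acts, p) c o ⟨hp, hΦ, sendable_of_procSteps hp ho h.names hΦ h.mainSize ?_⟩
    exact (procSteps_scoped hp h.mainPlain h.mainEnv (by simp) h.stores).2.1
  | proc g c v φ o p acts hv hp ho =>
    have hst : ∀ t ∈ procTokens (c v).1.1, t.1 ≠ 3 := fun t ht => (h.plain v t ht).2
    have hp' := procSteps_static hp hst g.1
    refine .step g c v o p ⟨φ, lookup_prefix hΦ hv, procSteps_static hp hst Φ,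
      sendable_of_procSteps hp' ho h.names hΦ (h.size v) ?_⟩
    exact (procSteps_scoped hp' (fun t ht => (h.plain v t ht).1) (h.env v)
      (scoped_stores_lookup h.stores hv) h.stores).2.1
  | start g c v m q p hv hi hq hp => exact .start g c v m q p hi hq hp

/-- The system knows all final actors `Φ`, the machine only those created so far. The difference is
harmless: by `known` an actor that moves exists already, and by scoping so does the target of every
message that is sent. -/
theorem Inv.move_of_next {n : ℕ} {s t : Conf} (h : Inv n s) {Φ : Actors}
    (hm : (machineSystem n Φ).Next s t) (hΦ : s.1.1 <+: Φ) : Move n s t ∧ t.1.1 <+: Φ := by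
  cases hm with
  | main g g' c o hp =>
    obtain ⟨hp, hpre, ho⟩ := hp
    refine ⟨.main g c o g'.2 g'.1 hp fun x hx => ?_, hpre⟩
    have hx := Option.mem_toList.1 hx
    exact scoped_target hp h.mainPlain h.mainEnv (by simp) h.stores x hx (ho x hx).1
  | step g c v o p hp =>
    obtain ⟨φ, hφ, hp, ho⟩ := hp
    have hp := procSteps_static hp (fun t ht => (h.plain v t ht).2) g.1
    have hv : g.1.lookup v = some φ := by
      have hk := h.known v (.inl (by have := (procSteps_size hp).1; simp only; omega))
      obtain ⟨φ', hφ'⟩ := Option.isSome_iff_exists.1 hk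
      have := lookup_prefix hΦ hφ'
      rw [hφ] at this
      rw [this]
      exact hφ'
    refine ⟨.proc g c v φ o p g.1 hv hp fun x hx => ?_, hΦ⟩
    have hx := Option.mem_toList.1 hx
    exact scoped_target hp (fun t ht => (h.plain v t ht).1) (h.env v)
      (scoped_stores_lookup h.stores hv) h.stores x hx (ho x hx).1
  | start g c v m q p hi hq hp =>
    exact ⟨.start g c v m q p (h.known v (.inr (by simp [hq]))) hi hq hp, hΦ⟩

theorem Move.prefix {n : ℕ} {s t : Conf} (hm : Move n s t) : s.1.1 <+: t.1.1 := by
  cases hm with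
  | main g c o p acts hp ho => exact (procSteps_size hp).2.2
  | proc => exact List.prefix_rfl
  | start => exact List.prefix_rfl

theorem Moves.prefix {n k : ℕ} {s t : Conf} (hm : Moves n k s t) : s.1.1 <+: t.1.1 := by
  induction hm with
  | refl => exact List.prefix_rfl
  | tail _ ht ih => exact ih.trans ht.prefix

theorem Inv.moves {n k : ℕ} (hn : ProgramOk n) {s t : Conf} (h : Inv n s) (hm : Moves n k s t) :
    Inv n t := by
  induction hm with
  | refl => exact h
  | tail _ ht ih => exact (ih h).move hn ht

theorem Inv.run_of_moves {n k : ℕ} (hn : ProgramOk n) {s t : Conf} (h : Inv n s)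
    (hm : Moves n k s t) : ∀ {Φ : Actors}, t.1.1 <+: Φ → (machineSystem n Φ).Run k s t := by
  induction hm with
  | refl => exact fun _ => .refl _
  | tail hm ht ih =>
    intro Φ hΦ
    exact (ih h (ht.prefix.trans hΦ)).trans (.one ((h.moves hn hm).next_of_move ht hΦ))

theorem Inv.moves_of_run {n k : ℕ} (hn : ProgramOk n) {Φ : Actors} {s t : Conf}
    (hr : (machineSystem n Φ).Run k s t) : Inv n s → s.1.1 <+: Φ → Moves n k s t := by
  induction hr with
  | refl => exact fun _ _ => .refl _
  | head hm _ ih =>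
    intro h hΦ
    obtain ⟨hm', hΦ'⟩ := h.move_of_next hm hΦ
    exact .head hm' (ih (h.move hn hm') hΦ')

/-- Some actor has a process equal to the one with the code `p`, up to renaming. -/
def Conf.Accepts (p : ℕ) (s : Conf) : Prop :=
  ClosureMatches p s.1.2 ∨
    ∃ e ∈ s.1.1, e.1 ≠ Nat.pair 1 0 ∧ ClosureMatches p (s.2 e.1).1

theorem closureTokens_of_code_eq_zero {c : Closure} (h : c.1 = 0) :
    closureTokens c = [(4, 0, 0)] := by
  rw [closureTokens, h, procTokens_of_nil (by simp)]
  simp [closeToken]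

/-- If the machine can reach a process, then it can do so within `moveBound n` moves. -/
theorem exists_moves_le {n p k : ℕ} (hn : ProgramOk n) {t : Conf}
    (h : Moves n k (initialMachine n).conf t) (ht : t.Accepts p) :
    ∃ j ≤ moveBound n, ∃ t', Moves n j (initialMachine n).conf t' ∧ t'.Accepts p := by
  have hinv := inv_initial hn
  have hinvt := hinv.moves hn h
  have hr := hinv.run_of_moves hn h List.prefix_rfl
  have hpre := h.prefix
  have hinit : (initialMachine n).conf =
      ((initialMachine n).1, fun _ => (((0, [], [], 0) : Closure), ([] : List Message))) := by
    simp only [Machine.conf, initialMachine, stateAt_nil]; rfl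
  set Y := machineSystem n t.1.1 with hY
  have hmain : ∀ g o g', Y.mainStep g o g' → g'.2.1 < g.2.1 := fun g o g' h =>
    (procSteps_size h.1).1
  have hms : (initialMachine n).1.2.1 ≤ n := hinv.mainSize
  have hmainrun : ∀ c', (∀ k, Y.Run k (initialMachine n).conf (t.1, c') →
      k ≤ (initialMachine n).1.2.1 → Conf.Accepts p (t.1, c') →
      ∃ j ≤ moveBound n, ∃ t', Moves n j (initialMachine n).conf t' ∧ t'.Accepts p) := by
    intro c' k hk hle hacc
    refine ⟨k, ?_, _, Inv.moves_of_run hn hk hinv hpre, hacc⟩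
    have h1 : 1 ≤ (4 * n + 9) ^ (messageBound n + 1) := Nat.one_le_pow _ _ (by omega)
    have := Nat.le_mul_of_pos_right (2 * n + 2) h1
    rw [moveBound]
    omega
  -- Running the main component alone produces its final state and all actors, which are still idle.
  -- This settles the goals that are met by the root or by an idle actor.
  obtain ⟨k', c', hk', hr', hc'⟩ := hr.main (mainSize := fun g => g.2.1) hmain
    (initialMachine n).conf.2
  by_cases h1 : ClosureMatches p t.1.2
  · exact hmainrun c' k' hr' hk' (.inl h1)
  by_cases h2 : ClosureMatches p (0, [], [], 0)
  · obtain ht | ⟨e, he, hne, hm⟩ := ht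
    · exact absurd ht h1
    · refine hmainrun c' k' hr' hk' (.inr ⟨e, he, hne, ?_⟩)
      rw [hc', hinit]
      exact h2
  -- What remains are goals that the idle process does not meet, as the bound for chains requires.
  · have ht' : ∃ A, (fun A c => A ≠ Nat.pair 1 0 ∧ ClosureMatches p c) A (t.2 A).1 := by
      obtain ht | ⟨e, he, hne, hm⟩ := ht
      · exact absurd ht h1
      · exact ⟨e.1, hne, hm⟩
    rw [hinit] at hr
    obtain ⟨j, t', hj, hr'', A, hA, hm⟩ := ActorSystem.exists_run_le
      (G := fun A c => A ≠ Nat.pair 1 0 ∧ ClosureMatches p c) (size := fun c => c.1) (K := n)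
      (fun A p o p' h => by obtain ⟨φ, -, h, -⟩ := h; exact (procSteps_size h).1)
      (fun A m p h => (starts_spec hn h).1) (mainSize := fun g => g.2.1) hmain
      (V := sendableMessages n t.1.1)
      (fun A p x p' h => by obtain ⟨φ, -, -, h⟩ := h; exact (h x rfl).2)
      (fun g x g' h => (h.2.2 x rfl).2)
      (card_sendableMessages_le (by have := hinvt.length; omega))
      (fun A h => h2 h.2)
      (fun A o p h => by obtain ⟨φ, -, h, -⟩ := h; have := (procSteps_size h).1; omega)
      rfl (Nat.zero_le _) hr ht'
    rw [← hinit] at hr''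
    have hmoves := Inv.moves_of_run hn hr'' hinv hpre
    refine ⟨j, hj.trans ?_, t', hmoves, .inr ?_⟩
    · exact Nat.mul_le_mul_right _ (by omega)
    -- The shorter run may have created fewer actors, but the one that meets the goal is not idle
    -- and therefore exists.
    · have hne : (t'.2 A).1.1 ≠ 0 := fun h0 => h2 (by
        rw [ClosureMatches, closureTokens_of_code_eq_zero (c := (0, [], [], 0)) rfl]
        rwa [ClosureMatches, closureTokens_of_code_eq_zero h0] at hm)
      obtain ⟨e, he, rfl⟩ := lookup_isSome_iff.1 ((hinv.moves hn hmoves).known A (.inl hne))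
      exact ⟨e, he, hA, hm⟩


/-! ### Codes of terms -/

theorem ofNat_codeList (l : List ℕ) : Denumerable.ofNat (List ℕ) (codeList l) = l := by
  induction l with
  | nil => exact Denumerable.list_ofNat_zero
  | cons n l ih =>
    rw [codeList, ← Nat.succ_eq_add_one, Denumerable.list_ofNat_succ, Nat.unpair_pair, ih]; rfl

theorem codeArgs_eq (Es : List Expr) : Expr.codeArgs Es = codeList (Es.map Expr.code) := by
  induction Es with
  | nil => rfl
  | cons E Es ih => simp [Expr.codeArgs, codeList, ih]

@[simp] theorem codeLength_codeArgs (Es : List Expr) : codeLength (Expr.codeArgs Es) = Es.length := by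
  rw [codeLength, codeArgs_eq, ofNat_codeList, List.length_map]

@[simp] theorem codeLength_codeList (l : List ℕ) : codeLength (codeList l) = l.length := by
  rw [codeLength, ofNat_codeList]

theorem ActorName.code_injective : Function.Injective ActorName.code := by
  rintro (_ | ⟨C, i⟩) (_ | ⟨D, j⟩) h <;> simp [ActorName.code, Nat.pair_eq_pair] at h ⊢
  exact h

theorem Value.code_injective : Function.Injective Value.code := by
  rintro (x | A) (y | B) h <;> simp [Value.code, Nat.pair_eq_pair] at h ⊢
  · exact h
  · exact ActorName.code_injective h

@[simp] theorem atomTokens_bound (k : ℕ) : atomTokens (Atom.bound k).code = [(0, k, 0)] := by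
  simp [atomTokens, Atom.code]

@[simp] theorem atomTokens_val (v : Value) : atomTokens (Atom.val v).code = [(1, v.code, 0)] := by
  simp [atomTokens, Atom.code]

@[simp] theorem exprTokens_atom (a : Atom) : exprTokens (Expr.atom a).code = atomTokens a.code := by
  rw [exprTokens_of_atom (by simp [Expr.code])]; simp [Expr.code]

@[simp] theorem exprTokens_field (f : Fld) : exprTokens (Expr.field f).code = [(2, f, 0)] := by
  rw [exprTokens_of_field (by simp [Expr.code])]; simp [Expr.code]

@[simp] theorem exprTokens_new (C : Cls) (Es : List Expr) : exprTokens (Expr.new C Es).code =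
    argsTokens (Expr.codeArgs Es) ++ [(3, C, Es.length)] := by
  rw [exprTokens_of_new (by simp [Expr.code])]; simp [Expr.code]

@[simp] theorem argsTokens_nil : argsTokens (Expr.codeArgs []) = [] := by
  simp [Expr.codeArgs]

@[simp] theorem argsTokens_cons (E : Expr) (Es : List Expr) :
    argsTokens (Expr.codeArgs (E :: Es)) = exprTokens E.code ++ argsTokens (Expr.codeArgs Es) := by
  rw [Expr.codeArgs, argsTokens_succ]; simp

@[simp] theorem procTokens_nil : procTokens Proc.nil.code = [(4, 0, 0)] :=
  procTokens_of_nil (by simp [Proc.code])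

@[simp] theorem procTokens_upd (f : Fld) (E : Expr) (P : Proc) : procTokens (Proc.upd f E P).code =
    exprTokens E.code ++ procTokens P.code ++ [(5, f, 0)] := by
  rw [procTokens_of_upd (by simp [Proc.code])]; simp [Proc.code]

@[simp] theorem procTokens_letIn (E : Expr) (P : Proc) : procTokens (Proc.letIn E P).code =
    exprTokens E.code ++ (procTokens P.code).map liftToken ++ [(6, 0, 0)] := by
  rw [procTokens_of_letIn (by simp [Proc.code])]; simp [Proc.code]

@[simp] theorem procTokens_invoke (x : Atom) (m : Meth) (Es : List Expr) (P : Proc) :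
    procTokens (Proc.invoke x m Es P).code = atomTokens x.code ++ argsTokens (Expr.codeArgs Es) ++
      procTokens P.code ++ [(7, m, Es.length)] := by
  rw [procTokens_of_invoke (by simp [Proc.code])]; simp [Proc.code]

@[simp] theorem procTokens_cond (E E' : Expr) (P Q : Proc) : procTokens (Proc.cond E E' P Q).code =
    exprTokens E.code ++ exprTokens E'.code ++ procTokens P.code ++ procTokens Q.code ++
      [(8, 0, 0)] := by
  rw [procTokens_of_cond (by simp [Proc.code])]; simp [Proc.code]

@[simp] theorem procTokens_plus (P Q : Proc) : procTokens (Proc.plus P Q).code =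
    procTokens P.code ++ procTokens Q.code ++ [(9, 0, 0)] := by
  rw [procTokens_of_plus (by simp [Proc.code])]; simp [Proc.code]

mutual
theorem mem_exprTokens {t : Token} : ∀ E : Expr, t ∈ exprTokens E.code →
    (t.1 = 1 → ∃ v : Value, t.2.1 = v.code ∧ Expr.atom (.val v) ∈ E.subs) ∧
      (t.1 = 3 → ∃ C Es, Expr.new C Es ∈ E.subs)
  | .atom (.bound k), h => by simp at h; simp [h]
  | .atom (.val v), h => by simp at h; simp [h, Expr.subs]
  | .field f, h => by simp at h; simp [h]
  | .new C Es, h => by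
    simp only [exprTokens_new, List.mem_append, List.mem_singleton] at h
    rcases h with h | rfl
    · obtain ⟨h1, h2⟩ := mem_argsTokens Es h
      exact ⟨fun ht => (h1 ht).imp fun v hv => ⟨hv.1, by simp [Expr.subs, hv.2]⟩,
        fun _ => ⟨C, Es, by simp [Expr.subs]⟩⟩
    · exact ⟨by simp, fun _ => ⟨C, Es, by simp [Expr.subs]⟩⟩
theorem mem_argsTokens {t : Token} : ∀ Es : List Expr, t ∈ argsTokens (Expr.codeArgs Es) →
    (t.1 = 1 → ∃ v : Value, t.2.1 = v.code ∧ Expr.atom (.val v) ∈ Expr.subsList Es) ∧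
      (t.1 = 3 → ∃ C Fs, Expr.new C Fs ∈ Expr.subsList Es)
  | [], h => by simp at h
  | E :: Es, h => by
    simp only [argsTokens_cons, List.mem_append] at h
    simp only [Expr.subsList, List.mem_append]
    rcases h with h | h
    · obtain ⟨h1, h2⟩ := mem_exprTokens E h
      exact ⟨fun ht => (h1 ht).imp fun v hv => ⟨hv.1, .inl hv.2⟩,
        fun ht => (h2 ht).imp fun C h => h.imp fun Es h => .inl h⟩
    · obtain ⟨h1, h2⟩ := mem_argsTokens Es h
      exact ⟨fun ht => (h1 ht).imp fun v hv => ⟨hv.1, .inr hv.2⟩,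
        fun ht => (h2 ht).imp fun C h => h.imp fun Es h => .inr h⟩
end

theorem mem_atomTokens {t : Token} (a : Atom) (h : t ∈ atomTokens a.code) :
    (t.1 = 1 → ∃ v : Value, t.2.1 = v.code ∧ Expr.atom (.val v) = Expr.atom a) ∧ t.1 ≠ 3 := by
  cases a <;> simp at h <;> simp [h]

theorem mem_procTokens (P : Proc) : ∀ {t : Token}, t ∈ procTokens P.code →
    (t.1 = 1 → ∃ v : Value, t.2.1 = v.code ∧ Expr.atom (.val v) ∈ P.exprs) ∧
      (t.1 = 3 → ∃ C Es, Expr.new C Es ∈ P.exprs) := by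
  have key : ∀ {t : Token} {l l' : List Expr},
      ((t.1 = 1 → ∃ v : Value, t.2.1 = v.code ∧ Expr.atom (.val v) ∈ l) ∧
        (t.1 = 3 → ∃ C Es, Expr.new C Es ∈ l)) → l ⊆ l' →
      (t.1 = 1 → ∃ v : Value, t.2.1 = v.code ∧ Expr.atom (.val v) ∈ l') ∧
        (t.1 = 3 → ∃ C Es, Expr.new C Es ∈ l') := fun h hl =>
    ⟨fun ht => (h.1 ht).imp fun v hv => ⟨hv.1, hl hv.2⟩,
      fun ht => (h.2 ht).imp fun C h => h.imp fun Es h => hl h⟩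
  induction P with
  | nil => intro t h; simp at h; simp [h]
  | upd f E P ih =>
    intro t h
    simp only [procTokens_upd, List.mem_append, List.mem_singleton] at h
    rcases h with (h | h) | rfl
    · exact key (mem_exprTokens E h) (by simp [Proc.exprs])
    · exact key (ih h) (by simp [Proc.exprs])
    · simp
  | letIn E P ih =>
    intro t h
    simp only [procTokens_letIn, List.mem_append, List.mem_singleton, List.mem_map] at h
    rcases h with (h | ⟨t, h, rfl⟩) | rfl
    · exact key (mem_exprTokens E h) (by simp [Proc.exprs])
    · have := key (l' := (Proc.letIn E P).exprs) (ih h) (by simp [Proc.exprs])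
      unfold liftToken
      split_ifs
      · simp
      · exact this
    · simp
  | invoke x m Es P ih =>
    intro t h
    simp only [procTokens_invoke, List.mem_append, List.mem_singleton] at h
    rcases h with ((h | h) | h) | rfl
    · obtain ⟨h1, h2⟩ := mem_atomTokens x h
      exact ⟨fun ht => (h1 ht).imp fun v hv => ⟨hv.1, by simp [Proc.exprs, hv.2]⟩,
        fun ht => absurd ht h2⟩
    · exact key (mem_argsTokens Es h) fun a ha => by simp [Proc.exprs, ha]
    · exact key (ih h) fun a ha => by simp [Proc.exprs, ha]
    · simp
  | cond E E' P Q ih ih' =>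
    intro t h
    simp only [procTokens_cond, List.mem_append, List.mem_singleton] at h
    rcases h with (((h | h) | h) | h) | rfl
    · exact key (mem_exprTokens E h) fun a ha => by simp [Proc.exprs, ha]
    · exact key (mem_exprTokens E' h) fun a ha => by simp [Proc.exprs, ha]
    · exact key (ih h) fun a ha => by simp [Proc.exprs, ha]
    · exact key (ih' h) fun a ha => by simp [Proc.exprs, ha]
    · simp
  | plus P Q ih ih' =>
    intro t h
    simp only [procTokens_plus, List.mem_append, List.mem_singleton] at h
    rcases h with (h | h) | rfl
    · exact key (ih h) (by simp [Proc.exprs])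
    · exact key (ih' h) (by simp [Proc.exprs])
    · simp

theorem plainToken_of_isSource {P : Proc} (h : P.IsSource) : ∀ t ∈ procTokens P.code,
    PlainToken t := by
  intro t ht h1
  obtain ⟨v, hv, hm⟩ := (mem_procTokens P ht).1 h1
  cases v with
  | var x => rw [hv]; simp [Value.code]
  | actor A => exact absurd hm (h.2 A)

theorem Program.ok {Pr : Program} (h : Pr.WellFormed) (hb : Pr.BoundedActors) :
    ProgramOk Pr.code := by
  constructor
  · simpa [Program.code] using plainToken_of_isSource h.main_source
  · intro k hk
    rw [Program.code, Nat.unpair_pair, Nat.unpair_pair, ofNat_codeList] at hk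
    obtain ⟨d, hd, rfl⟩ := List.mem_map.1 hk
    simp only [MethodDef.code, Nat.unpair_pair]
    intro t ht
    refine ⟨plainToken_of_isSource (h.body_source d hd) t ht, fun h3 => ?_⟩
    obtain ⟨C, Es, hm⟩ := (mem_procTokens _ ht).2 h3
    exact hb d hd C Es hm

/-! ### Terms that are equal up to their atoms -/

mutual
/-- The expressions are equal up to their atoms, which are related by `R`. If `ν` is false, then
they do not create actors. -/
inductive ExprRel (ν : Prop) (R : Atom → Atom → Prop) : Expr → Expr → Prop
  | atom {a b : Atom} (h : R a b) : ExprRel ν R (.atom a) (.atom b)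
  | field (f : Fld) : ExprRel ν R (.field f) (.field f)
  | new (C : Cls) {Es Fs : List Expr} (hν : ν) (h : ArgsRel ν R Es Fs) :
      ExprRel ν R (.new C Es) (.new C Fs)
inductive ArgsRel (ν : Prop) (R : Atom → Atom → Prop) : List Expr → List Expr → Prop
  | nil : ArgsRel ν R [] []
  | cons {E F : Expr} {Es Fs : List Expr} (h : ExprRel ν R E F) (hs : ArgsRel ν R Es Fs) :
      ArgsRel ν R (E :: Es) (F :: Fs)
end

/-- The processes, at a certain number of enclosing binders, are equal up to their atoms, which are
related by `R`, and they do not update fields. -/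
inductive ProcRel (ν : Prop) (R : ℕ → Atom → Atom → Prop) : ℕ → Proc → Proc → Prop
  | nil (k : ℕ) : ProcRel ν R k .nil .nil
  | letIn {k : ℕ} {E F : Expr} {P Q : Proc} (hE : ExprRel ν (R k) E F)
      (hP : ProcRel ν R (k + 1) P Q) : ProcRel ν R k (.letIn E P) (.letIn F Q)
  | invoke {k : ℕ} {x y : Atom} (m : Meth) {Es Fs : List Expr} {P Q : Proc} (hx : R k x y)
      (hE : ArgsRel ν (R k) Es Fs) (hP : ProcRel ν R k P Q) :
      ProcRel ν R k (.invoke x m Es P) (.invoke y m Fs Q)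
  | cond {k : ℕ} {E E' F F' : Expr} {P P' Q Q' : Proc} (hE : ExprRel ν (R k) E F)
      (hE' : ExprRel ν (R k) E' F') (hP : ProcRel ν R k P Q) (hP' : ProcRel ν R k P' Q') :
      ProcRel ν R k (.cond E E' P P') (.cond F F' Q Q')
  | plus {k : ℕ} {P P' Q Q' : Proc} (hP : ProcRel ν R k P Q) (hP' : ProcRel ν R k P' Q') :
      ProcRel ν R k (.plus P P') (.plus Q Q')

section
variable {ν : Prop} {R R' : Atom → Atom → Prop}

mutual
theorem ExprRel.restrict : ∀ {E F : Expr}, ExprRel ν R E F →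
    (∀ a b, Expr.atom a ∈ E.subs → R a b → R' a b) → ExprRel ν R' E F
  | _, _, .atom h, H => .atom (H _ _ (by simp [Expr.subs]) h)
  | _, _, .field f, _ => .field f
  | _, _, .new C hν h, H => .new C hν (h.restrict fun a b ha => H a b (by simp [Expr.subs, ha]))
theorem ArgsRel.restrict : ∀ {Es Fs : List Expr}, ArgsRel ν R Es Fs →
    (∀ a b, Expr.atom a ∈ Expr.subsList Es → R a b → R' a b) → ArgsRel ν R' Es Fs
  | _, _, .nil, _ => .nil
  | _, _, .cons h hs, H => .cons (h.restrict fun a b ha => H a b (by simp [Expr.subsList, ha]))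
      (hs.restrict fun a b ha => H a b (by simp [Expr.subsList, ha]))
end

mutual
theorem ExprRel.openAt {U : Value} {k : ℕ} (H : ∀ a b, R a b → R' (a.openAt U k) b) :
    ∀ {E F : Expr}, ExprRel ν R E F → ExprRel ν R' (E.openAt U k) F
  | _, _, .atom h => .atom (H _ _ h)
  | _, _, .field f => .field f
  | _, _, .new C hν h => .new C hν (h.openAt H)
theorem ArgsRel.openAt {U : Value} {k : ℕ} (H : ∀ a b, R a b → R' (a.openAt U k) b) :
    ∀ {Es Fs : List Expr}, ArgsRel ν R Es Fs → ArgsRel ν R' (Expr.openAtList U k Es) Fs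
  | _, _, .nil => .nil
  | _, _, .cons h hs => .cons (h.openAt H) (hs.openAt H)
end

mutual
theorem ExprRel.mapVal {g : Value → Value} {k : ℕ} : ∀ {E : Expr}, E.ClosedAt k →
    (ν ∨ ∀ C Es, Expr.new C Es ∉ E.subs) →
    (∀ a : Atom, Expr.atom a ∈ E.subs → a.ClosedAt k → R (a.mapVal g) a) →
    ExprRel ν R (E.mapVal g) E
  | .atom a, hc, _, H => .atom (H a (by simp [Expr.subs]) (by simpa [Expr.ClosedAt] using hc))
  | .field f, _, _, _ => .field f
  | .new C Es, hc, hν, H => .new C (hν.resolve_right fun h => h C Es (by simp [Expr.subs]))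
      (ArgsRel.mapVal (by simpa [Expr.ClosedAt] using hc)
        (hν.imp_right fun h D Fs hm => h D Fs (by simp [Expr.subs, hm]))
        fun a ha => H a (by simp [Expr.subs, ha]))
theorem ArgsRel.mapVal {g : Value → Value} {k : ℕ} : ∀ {Es : List Expr}, Expr.ClosedAtList k Es →
    (ν ∨ ∀ C Fs, Expr.new C Fs ∉ Expr.subsList Es) →
    (∀ a : Atom, Expr.atom a ∈ Expr.subsList Es → a.ClosedAt k → R (a.mapVal g) a) →
    ArgsRel ν R (Expr.mapValList g Es) Es
  | [], _, _, _ => .nil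
  | E :: Es, hc, hν, H => by
    rw [Expr.ClosedAtList] at hc
    exact .cons (ExprRel.mapVal hc.1
        (hν.imp_right fun h D Fs hm => h D Fs (by simp [Expr.subsList, hm]))
        fun a ha => H a (by simp [Expr.subsList, ha]))
      (ArgsRel.mapVal hc.2 (hν.imp_right fun h D Fs hm => h D Fs (by simp [Expr.subsList, hm]))
        fun a ha => H a (by simp [Expr.subsList, ha]))
end

end

section
variable {ν : Prop} {R R' : ℕ → Atom → Atom → Prop}

theorem ProcRel.restrict {k : ℕ} {P Q : Proc} (h : ProcRel ν R k P Q) :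
    (∀ k a b, Expr.atom a ∈ P.exprs → R k a b → R' k a b) → ProcRel ν R' k P Q := by
  induction h with
  | nil k => exact fun _ => .nil k
  | letIn hE _ ih =>
    exact fun H => .letIn (hE.restrict fun a b ha => H _ a b (by simp [Proc.exprs, ha]))
      (ih fun k a b ha => H k a b (by simp [Proc.exprs, ha]))
  | invoke m hx hE _ ih =>
    exact fun H => .invoke m (H _ _ _ (by simp [Proc.exprs]) hx)
      (hE.restrict fun a b ha => H _ a b (by simp [Proc.exprs, ha]))
      (ih fun k a b ha => H k a b (by simp [Proc.exprs, ha]))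
  | cond hE hE' _ _ ih ih' =>
    exact fun H => .cond (hE.restrict fun a b ha => H _ a b (by simp [Proc.exprs, ha]))
      (hE'.restrict fun a b ha => H _ a b (by simp [Proc.exprs, ha]))
      (ih fun k a b ha => H k a b (by simp [Proc.exprs, ha]))
      (ih' fun k a b ha => H k a b (by simp [Proc.exprs, ha]))
  | plus _ _ ih ih' =>
    exact fun H => .plus (ih fun k a b ha => H k a b (by simp [Proc.exprs, ha]))
      (ih' fun k a b ha => H k a b (by simp [Proc.exprs, ha]))

theorem ProcRel.openAt {U : Value} (H : ∀ k a b, R (k + 1) a b → R' k (a.openAt U k) b)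
    {k k' : ℕ} {P Q : Proc} (h : ProcRel ν R k P Q) (hk : k = k' + 1) :
    ProcRel ν R' k' (P.openAt U k') Q := by
  induction h generalizing k' with
  | nil k => exact .nil k'
  | letIn hE _ ih => subst hk; exact .letIn (hE.openAt (H k')) (ih rfl)
  | invoke m hx hE _ ih => subst hk; exact .invoke m (H k' _ _ hx) (hE.openAt (H k')) (ih rfl)
  | cond hE hE' _ _ ih ih' =>
    subst hk; exact .cond (hE.openAt (H k')) (hE'.openAt (H k')) (ih rfl) (ih' rfl)
  | plus _ _ ih ih' => exact .plus (ih hk) (ih' hk)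

theorem ProcRel.mapVal {g : Value → Value} {P : Proc} : ∀ {k : ℕ}, P.ClosedAt k →
    (ν ∨ ∀ C Es, Expr.new C Es ∉ P.exprs) → P.updates = [] →
    (∀ k (a : Atom), Expr.atom a ∈ P.exprs → a.ClosedAt k → R k (a.mapVal g) a) →
    ProcRel ν R k (P.mapVal g) P := by
  induction P with
  | nil => exact fun _ _ _ _ => .nil _
  | upd => exact fun _ _ h => by simp [Proc.updates] at h
  | letIn E P ih =>
    intro k hc hν hu H
    exact .letIn (ExprRel.mapVal hc.1
        (hν.imp_right fun h D Fs hm => h D Fs (by simp [Proc.exprs, hm]))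
        fun a ha => H k a (by simp [Proc.exprs, ha]))
      (ih hc.2 (hν.imp_right fun h D Fs hm => h D Fs (by simp [Proc.exprs, hm]))
        (by simpa [Proc.updates] using hu) fun k a ha => H k a (by simp [Proc.exprs, ha]))
  | invoke x m Es P ih =>
    intro k hc hν hu H
    exact .invoke m (H k x (by simp [Proc.exprs]) hc.1) (ArgsRel.mapVal hc.2.1
        (hν.imp_right fun h D Fs hm => h D Fs (by simp [Proc.exprs, hm]))
        fun a ha => H k a (by simp [Proc.exprs, ha]))
      (ih hc.2.2 (hν.imp_right fun h D Fs hm => h D Fs (by simp [Proc.exprs, hm]))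
        (by simpa [Proc.updates] using hu) fun k a ha => H k a (by simp [Proc.exprs, ha]))
  | cond E E' P Q ih ih' =>
    intro k hc hν hu H
    simp only [Proc.updates, List.append_eq_nil_iff] at hu
    exact .cond (ExprRel.mapVal hc.1
        (hν.imp_right fun h D Fs hm => h D Fs (by simp [Proc.exprs, hm]))
        fun a ha => H k a (by simp [Proc.exprs, ha]))
      (ExprRel.mapVal hc.2.1
        (hν.imp_right fun h D Fs hm => h D Fs (by simp [Proc.exprs, hm]))
        fun a ha => H k a (by simp [Proc.exprs, ha]))
      (ih hc.2.2.1 (hν.imp_right fun h D Fs hm => h D Fs (by simp [Proc.exprs, hm]))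
        hu.1 fun k a ha => H k a (by simp [Proc.exprs, ha]))
      (ih' hc.2.2.2 (hν.imp_right fun h D Fs hm => h D Fs (by simp [Proc.exprs, hm]))
        hu.2 fun k a ha => H k a (by simp [Proc.exprs, ha]))
  | plus P Q ih ih' =>
    intro k hc hν hu H
    simp only [Proc.updates, List.append_eq_nil_iff] at hu
    exact .plus
      (ih hc.1 (hν.imp_right fun h D Fs hm => h D Fs (by simp [Proc.exprs, hm]))
        hu.1 fun k a ha => H k a (by simp [Proc.exprs, ha]))
      (ih' hc.2 (hν.imp_right fun h D Fs hm => h D Fs (by simp [Proc.exprs, hm]))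
        hu.2 fun k a ha => H k a (by simp [Proc.exprs, ha]))

end

theorem mapVal_id_atom (a : Atom) : a.mapVal id = a := by cases a <;> rfl

mutual
theorem mapVal_id_expr : ∀ E : Expr, E.mapVal id = E
  | .atom a => by rw [Expr.mapVal, mapVal_id_atom]
  | .field f => rfl
  | .new C Es => by rw [Expr.mapVal, mapVal_id_args]
theorem mapVal_id_args : ∀ Es : List Expr, Expr.mapValList id Es = Es
  | [] => rfl
  | E :: Es => by rw [Expr.mapValList, mapVal_id_expr, mapVal_id_args]
end

theorem mapVal_id (P : Proc) : P.mapVal id = P := by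
  induction P <;> simp_all [Proc.mapVal, mapVal_id_expr, mapVal_id_args, mapVal_id_atom]


/-! ### Serialized processes and renaming -/

/-- Removes the number of enclosing binders from a token. -/
def stripToken (t : Token) : Token :=
  if t.1 = 0 then (0, t.2.1, 0) else if t.1 = 1 then (1, t.2.1, 0) else t

theorem stripToken_liftToken (t : Token) : stripToken (liftToken t) = stripToken t := by
  unfold stripToken liftToken
  by_cases h : t.1 = 0 <;> simp [h]

def Atom.ser (a : Atom) : Token := match a with
  | .bound k => (0, k, 0)
  | .val v => (1, v.code, 0)

/-- The counts of binders are needed for interpreting a term in a closure, but not for identifying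
it; without them, serialization is compatible with all constructors. -/
def Expr.ser (E : Expr) : List Token := (exprTokens E.code).map stripToken
def Expr.serArgs (Es : List Expr) : List Token := (argsTokens (Expr.codeArgs Es)).map stripToken
def Proc.ser (P : Proc) : List Token := (procTokens P.code).map stripToken

theorem map_atomTokens (a : Atom) : (atomTokens a.code).map stripToken = [a.ser] := by
  cases a <;> simp [stripToken, Atom.ser]

theorem Expr.ser_atom (a : Atom) : (Expr.atom a).ser = [a.ser] := by
  rw [Expr.ser, exprTokens_atom, map_atomTokens]

theorem Expr.ser_field (f : Fld) : (Expr.field f).ser = [(2, f, 0)] := by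
  simp [Expr.ser, stripToken]

theorem Expr.ser_new (C : Cls) (Es : List Expr) :
    (Expr.new C Es).ser = Expr.serArgs Es ++ [(3, C, Es.length)] := by
  simp [Expr.ser, Expr.serArgs, stripToken]

theorem Expr.serArgs_nil : Expr.serArgs [] = [] := by simp [Expr.serArgs]

theorem Expr.serArgs_cons (E : Expr) (Es : List Expr) :
    Expr.serArgs (E :: Es) = E.ser ++ Expr.serArgs Es := by
  simp [Expr.ser, Expr.serArgs]

theorem Proc.ser_nil : Proc.nil.ser = [(4, 0, 0)] := by simp [Proc.ser, stripToken]

theorem Proc.ser_upd (f : Fld) (E : Expr) (P : Proc) :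
    (Proc.upd f E P).ser = E.ser ++ P.ser ++ [(5, f, 0)] := by
  simp [Proc.ser, Expr.ser, stripToken]

theorem Proc.ser_letIn (E : Expr) (P : Proc) :
    (Proc.letIn E P).ser = E.ser ++ P.ser ++ [(6, 0, 0)] := by
  simp [Proc.ser, Expr.ser, Function.comp_def, stripToken_liftToken]
  simp [stripToken]

theorem Proc.ser_invoke (x : Atom) (m : Meth) (Es : List Expr) (P : Proc) :
    (Proc.invoke x m Es P).ser = [x.ser] ++ Expr.serArgs Es ++ P.ser ++ [(7, m, Es.length)] := by
  simp only [Proc.ser, Expr.serArgs, procTokens_invoke, List.map_append, map_atomTokens]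
  simp [stripToken]

theorem Proc.ser_cond (E E' : Expr) (P Q : Proc) :
    (Proc.cond E E' P Q).ser = E.ser ++ E'.ser ++ P.ser ++ Q.ser ++ [(8, 0, 0)] := by
  simp [Proc.ser, Expr.ser, stripToken]

theorem Proc.ser_plus (P Q : Proc) : (Proc.plus P Q).ser = P.ser ++ Q.ser ++ [(9, 0, 0)] := by
  simp [Proc.ser, stripToken]

theorem Atom.ser_injective : Function.Injective Atom.ser := by
  rintro (k | v) (j | w) h <;> simp [Atom.ser] at h ⊢
  · exact h
  · exact Value.code_injective h

theorem append_singleton_cancel {α : Type*} {l l' : List α} {a b : α} (h : l ++ [a] = l' ++ [b]) :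
    l = l' ∧ a = b := by
  simpa using List.append_inj' h rfl

theorem Atom.ser_kind (a : Atom) : a.ser.1 < 2 := by cases a <;> simp [Atom.ser]

mutual
-- Postfix terms are parsed from the right: the last token reveals the constructor and the arity,
-- and then the components are cancelled from the last to the first. The arbitrary lists in front
-- make the induction possible.
theorem ser_cancel_expr : ∀ (E F : Expr) {l l' : List Token}, l ++ E.ser = l' ++ F.ser →
    l = l' ∧ E = F
  | .atom a, F, l, l', h => by
    have ha := a.ser_kind
    cases F with
    | atom b =>
      simp only [Expr.ser_atom] at h
      obtain ⟨h1, h2⟩ := append_singleton_cancel h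
      exact ⟨h1, by rw [Atom.ser_injective h2]⟩
    | field f =>
      simp only [Expr.ser_atom, Expr.ser_field] at h
      have := (append_singleton_cancel h).2; rw [this] at ha; simp at ha
    | new C Es =>
      simp only [Expr.ser_atom, Expr.ser_new, ← List.append_assoc] at h
      have := (append_singleton_cancel h).2; rw [this] at ha; simp at ha
  | .field f, F, l, l', h => by
    cases F with
    | atom b =>
      have hb := b.ser_kind
      simp only [Expr.ser_atom, Expr.ser_field] at h
      have := (append_singleton_cancel h).2; rw [← this] at hb; simp at hb
    | field g =>
      simp only [Expr.ser_field] at h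
      simpa using append_singleton_cancel h
    | new C Es =>
      simp only [Expr.ser_field, Expr.ser_new, ← List.append_assoc] at h
      simpa using (append_singleton_cancel h).2
  | .new C Es, F, l, l', h => by
    cases F with
    | atom b =>
      have hb := b.ser_kind
      simp only [Expr.ser_atom, Expr.ser_new, ← List.append_assoc] at h
      have := (append_singleton_cancel h).2; rw [← this] at hb; simp at hb
    | field g =>
      simp only [Expr.ser_field, Expr.ser_new, ← List.append_assoc] at h
      simpa using (append_singleton_cancel h).2
    | new D Fs =>
      simp only [Expr.ser_new, ← List.append_assoc] at h
      obtain ⟨h1, h2⟩ := append_singleton_cancel h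
      simp only [Prod.mk.injEq, true_and] at h2
      obtain ⟨h3, rfl⟩ := ser_cancel_args Es Fs h2.2 h1
      exact ⟨h3, by rw [h2.1]⟩
theorem ser_cancel_args : ∀ (Es Fs : List Expr) {l l' : List Token}, Es.length = Fs.length →
    l ++ Expr.serArgs Es = l' ++ Expr.serArgs Fs → l = l' ∧ Es = Fs
  | [], Fs, l, l', hl, h => by
    obtain rfl := List.length_eq_zero_iff.1 hl.symm
    simpa using h
  | E :: Es, [], l, l', hl, h => by simp at hl
  | E :: Es, F :: Fs, l, l', hl, h => by
    simp only [Expr.serArgs_cons, ← List.append_assoc] at h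
    obtain ⟨h1, rfl⟩ := ser_cancel_args Es Fs (by simpa using hl) h
    obtain ⟨h2, rfl⟩ := ser_cancel_expr E F h1
    exact ⟨h2, rfl⟩
end

/-- The last token of a serialized process. -/
def Proc.lastToken : Proc → Token
  | .nil => (4, 0, 0)
  | .upd f _ _ => (5, f, 0)
  | .letIn _ _ => (6, 0, 0)
  | .invoke _ m Es _ => (7, m, Es.length)
  | .cond _ _ _ _ => (8, 0, 0)
  | .plus _ _ => (9, 0, 0)

/-- The other tokens of a serialized process. -/
def Proc.initTokens : Proc → List Token
  | .nil => []
  | .upd _ E P => E.ser ++ P.ser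
  | .letIn E P => E.ser ++ P.ser
  | .invoke x _ Es P => [x.ser] ++ Expr.serArgs Es ++ P.ser
  | .cond E E' P Q => E.ser ++ E'.ser ++ P.ser ++ Q.ser
  | .plus P Q => P.ser ++ Q.ser

theorem Proc.ser_eq (P : Proc) : P.ser = P.initTokens ++ [P.lastToken] := by
  cases P
  · exact Proc.ser_nil
  · exact Proc.ser_upd _ _ _
  · exact Proc.ser_letIn _ _
  · exact Proc.ser_invoke _ _ _ _
  · exact Proc.ser_cond _ _ _ _
  · exact Proc.ser_plus _ _

theorem ser_cancel_proc (P : Proc) : ∀ (Q : Proc) {l l' : List Token},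
    l ++ P.ser = l' ++ Q.ser → l = l' ∧ P = Q := by
  have key : ∀ {P Q : Proc} {l l' : List Token}, l ++ P.ser = l' ++ Q.ser →
      l ++ P.initTokens = l' ++ Q.initTokens ∧ P.lastToken = Q.lastToken := by
    intro P Q l l' h
    rw [P.ser_eq, Q.ser_eq, ← List.append_assoc, ← List.append_assoc] at h
    exact append_singleton_cancel h
  induction P with
  | nil =>
    intro Q l l' h
    obtain ⟨h1, h2⟩ := key h
    cases Q <;> simp [Proc.lastToken] at h2
    exact ⟨by simpa [Proc.initTokens] using h1, rfl⟩
  | upd f E P ih =>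
    intro Q l l' h
    obtain ⟨h1, h2⟩ := key h
    cases Q <;> simp [Proc.lastToken] at h2
    simp only [Proc.initTokens, ← List.append_assoc] at h1
    obtain ⟨e4, rfl⟩ := ih _ h1
    obtain ⟨e6, rfl⟩ := ser_cancel_expr _ _ e4
    exact ⟨e6, by rw [h2]⟩
  | letIn E P ih =>
    intro Q l l' h
    obtain ⟨h1, h2⟩ := key h
    cases Q <;> simp [Proc.lastToken] at h2
    simp only [Proc.initTokens, ← List.append_assoc] at h1
    obtain ⟨e4, rfl⟩ := ih _ h1
    obtain ⟨e6, rfl⟩ := ser_cancel_expr _ _ e4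
    exact ⟨e6, rfl⟩
  | invoke x m Es P ih =>
    intro Q l l' h
    obtain ⟨h1, h2⟩ := key h
    cases Q <;> simp [Proc.lastToken] at h2
    simp only [Proc.initTokens, ← List.append_assoc] at h1
    obtain ⟨e4, rfl⟩ := ih _ h1
    obtain ⟨e6, rfl⟩ := ser_cancel_args _ _ h2.2 e4
    obtain ⟨e8, h3⟩ := append_singleton_cancel e6
    exact ⟨e8, by rw [h2.1, Atom.ser_injective h3]⟩
  | cond E E' P P' ih ih' =>
    intro Q l l' h
    obtain ⟨h1, h2⟩ := key h
    cases Q <;> simp [Proc.lastToken] at h2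
    simp only [Proc.initTokens, ← List.append_assoc] at h1
    obtain ⟨e4, rfl⟩ := ih' _ h1
    obtain ⟨e6, rfl⟩ := ih _ e4
    obtain ⟨e8, rfl⟩ := ser_cancel_expr _ _ e6
    obtain ⟨e10, rfl⟩ := ser_cancel_expr _ _ e8
    exact ⟨e10, rfl⟩
  | plus P P' ih ih' =>
    intro Q l l' h
    obtain ⟨h1, h2⟩ := key h
    cases Q <;> simp [Proc.lastToken] at h2
    simp only [Proc.initTokens, ← List.append_assoc] at h1
    obtain ⟨e4, rfl⟩ := ih' _ h1
    obtain ⟨e6, rfl⟩ := ih _ e4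
    exact ⟨e6, rfl⟩

theorem Proc.ser_injective : Function.Injective Proc.ser := fun P Q h =>
  (ser_cancel_proc P Q (l := []) (l' := []) h).2

/-- The tokens are equal, up to values that are related by `W`. -/
def TokRel (W : Set (Value × ℕ)) (t t' : Token) : Prop :=
  (∃ U u, t = (1, U.code, 0) ∧ t' = (1, u, 0) ∧ (U, u) ∈ W) ∨ (t.1 ≠ 1 ∧ t' = t)

def graphOf (g : Value → Value) : Set (Value × ℕ) := {z | z.2 = (g z.1).code}

theorem forall₂_tokRel_singleton {W : Set (Value × ℕ)} {t : Token} (h : t.1 ≠ 1) :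
    List.Forall₂ (TokRel W) [t] [t] := .cons (.inr ⟨h, rfl⟩) .nil

theorem tokRel_ser_mapVal (g : Value → Value) (a : Atom) :
    TokRel (graphOf g) a.ser (a.mapVal g).ser := by
  cases a with
  | bound k => exact .inr ⟨by simp [Atom.ser], rfl⟩
  | val v => exact .inl ⟨v, (g v).code, rfl, rfl, rfl⟩

mutual
theorem ser_mapVal_expr (g : Value → Value) : ∀ E : Expr,
    List.Forall₂ (TokRel (graphOf g)) E.ser (E.mapVal g).ser
  | .atom a => by
    rw [Expr.mapVal, Expr.ser_atom, Expr.ser_atom]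
    exact .cons (tokRel_ser_mapVal g a) .nil
  | .field f => by
    rw [Expr.mapVal, Expr.ser_field]
    exact forall₂_tokRel_singleton (by simp)
  | .new C Es => by
    rw [Expr.mapVal, Expr.ser_new, Expr.ser_new, (ser_mapVal_args g Es).2]
    exact List.rel_append (ser_mapVal_args g Es).1 (forall₂_tokRel_singleton (by simp))
theorem ser_mapVal_args (g : Value → Value) : ∀ Es : List Expr,
    List.Forall₂ (TokRel (graphOf g)) (Expr.serArgs Es) (Expr.serArgs (Expr.mapValList g Es)) ∧
      (Expr.mapValList g Es).length = Es.length
  | [] => by simp [Expr.mapValList, Expr.serArgs_nil]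
  | E :: Es => by
    simp only [Expr.mapValList, Expr.serArgs_cons, List.length_cons, (ser_mapVal_args g Es).2,
      and_true]
    exact List.rel_append (ser_mapVal_expr g E) (ser_mapVal_args g Es).1
end

theorem ser_mapVal (g : Value → Value) (P : Proc) :
    List.Forall₂ (TokRel (graphOf g)) P.ser (P.mapVal g).ser := by
  induction P with
  | nil => rw [Proc.mapVal, Proc.ser_nil]; exact forall₂_tokRel_singleton (by simp)
  | upd f E P ih =>
    rw [Proc.mapVal, Proc.ser_upd, Proc.ser_upd]
    exact List.rel_append (List.rel_append (ser_mapVal_expr g E) ih)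
      (forall₂_tokRel_singleton (by simp))
  | letIn E P ih =>
    rw [Proc.mapVal, Proc.ser_letIn, Proc.ser_letIn]
    exact List.rel_append (List.rel_append (ser_mapVal_expr g E) ih)
      (forall₂_tokRel_singleton (by simp))
  | invoke x m Es P ih =>
    rw [Proc.mapVal, Proc.ser_invoke, Proc.ser_invoke, (ser_mapVal_args g Es).2]
    exact List.rel_append (List.rel_append (List.rel_append (.cons (tokRel_ser_mapVal g x) .nil)
      (ser_mapVal_args g Es).1) ih) (forall₂_tokRel_singleton (by simp))
  | cond E E' P Q ih ih' =>
    rw [Proc.mapVal, Proc.ser_cond, Proc.ser_cond]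
    exact List.rel_append (List.rel_append (List.rel_append (List.rel_append (ser_mapVal_expr g E)
      (ser_mapVal_expr g E')) ih) ih') (forall₂_tokRel_singleton (by simp))
  | plus P Q ih ih' =>
    rw [Proc.mapVal, Proc.ser_plus, Proc.ser_plus]
    exact List.rel_append (List.rel_append ih ih') (forall₂_tokRel_singleton (by simp))

/-! ### Closures that represent processes -/

/-- The atom `a` is the interpretation of the atom `b` in the closure `c`, under `k` binders, up to
values that are related by `W`. -/
def AtomRel (W : Set (Value × ℕ)) (c : Closure) (k : ℕ) (a b : Atom) : Prop :=
  match b with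
  | .bound j => (j < k ∧ a = .bound j) ∨
      (k ≤ j ∧ ∃ U u, a = .val U ∧ c.2.1[j - k]? = some u ∧ (U, u) ∈ W)
  | .val v => ∃ U, a = .val U ∧ (U, resolve c v.code) ∈ W

/-- Substitution for the variable of a `let` amounts to pushing its value onto the environment: of
the indices that are free under `k` binders, `k` is the first and refers to the top. -/
theorem AtomRel.openAt {W : Set (Value × ℕ)} {p p' : ℕ} {env : List ℕ} {r : List (ℕ × ℕ) × ℕ}
    {U : Value} {u : ℕ} (hU : (U, u) ∈ W) (k : ℕ) (a b : Atom)
    (h : AtomRel W (p, env, r) (k + 1) a b) :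
    AtomRel W (p', u :: env, r) k (a.openAt U k) b := by
  cases b with
  | bound j =>
    rcases h with ⟨hj, rfl⟩ | ⟨hj, V, v, rfl, hv, hW⟩
    · by_cases hjk : j = k
      · subst hjk
        exact .inr ⟨le_rfl, U, u, by simp [Atom.openAt], by simp, hU⟩
      · exact .inl ⟨by omega, by simp [Atom.openAt, hjk]⟩
    · obtain ⟨i, rfl⟩ := Nat.exists_eq_add_of_le hj
      refine .inr ⟨by omega, V, v, rfl, ?_, hW⟩
      rw [show k + 1 + i - k = i + 1 by omega]
      simpa using hv
  | val v =>
    obtain ⟨V, rfl, hW⟩ := h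
    exact ⟨V, rfl, hW⟩

/-- The interpretation of a token in a closure, under `k` binders. -/
def closeTokenAt (k : ℕ) (c : Closure) (t : Token) : Token :=
  if t.1 = 0 then
    if t.2.1 < t.2.2 + k then (0, t.2.1, 0)
    else (1, (c.2.1[t.2.1 - (t.2.2 + k)]?).getD 0, 0)
  else if t.1 = 1 then (1, resolve c t.2.1, 0)
  else t

theorem closeTokenAt_zero : closeTokenAt 0 = closeToken := rfl

theorem closeTokenAt_liftToken (k : ℕ) (c : Closure) (t : Token) :
    closeTokenAt k c (liftToken t) = closeTokenAt (k + 1) c t := by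
  by_cases h : t.1 = 0
  · simp [closeTokenAt, liftToken, h, show t.2.2 + 1 + k = t.2.2 + (k + 1) by omega]
  · simp [closeTokenAt, liftToken, h]

section
variable {ν : Prop} {W : Set (Value × ℕ)} {c : Closure}

theorem AtomRel.tokens {k : ℕ} {a b : Atom} (h : AtomRel W c k a b) : List.Forall₂ (TokRel W)
    [a.ser] ((atomTokens b.code).map (closeTokenAt k c)) := by
  cases b with
  | bound j =>
    rw [atomTokens_bound]
    rcases h with ⟨hj, rfl⟩ | ⟨hj, V, v, rfl, hv, hW⟩
    · refine .cons (.inr ⟨by simp [Atom.ser], ?_⟩) .nil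
      simp [closeTokenAt, hj, Atom.ser]
    · refine .cons (.inl ⟨V, v, rfl, ?_, hW⟩) .nil
      simp [closeTokenAt, hj.not_gt, hv]
  | val v =>
    obtain ⟨V, rfl, hW⟩ := h
    rw [atomTokens_val]
    exact .cons (.inl ⟨V, _, rfl, by simp [closeTokenAt], hW⟩) .nil

theorem forall₂_closeTokenAt_singleton {t : Token} (h : 1 < t.1) (k : ℕ) :
    List.Forall₂ (TokRel W) [t] ([t].map (closeTokenAt k c)) := by
  refine .cons (.inr ⟨by omega, ?_⟩) .nil
  simp [closeTokenAt, show t.1 ≠ 0 by omega, show t.1 ≠ 1 by omega]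

mutual
theorem ExprRel.tokens {k : ℕ} : ∀ {E F : Expr}, ExprRel ν (AtomRel W c k) E F →
    List.Forall₂ (TokRel W) E.ser ((exprTokens F.code).map (closeTokenAt k c))
  | _, _, .atom h => by rw [Expr.ser_atom, exprTokens_atom]; exact h.tokens
  | _, _, .field f => by
    rw [Expr.ser_field, exprTokens_field]; exact forall₂_closeTokenAt_singleton (by simp) k
  | _, _, .new C hν h => by
    rw [Expr.ser_new, exprTokens_new, List.map_append, h.tokens.2]
    exact List.rel_append h.tokens.1 (forall₂_closeTokenAt_singleton (by simp) k)
theorem ArgsRel.tokens {k : ℕ} : ∀ {Es Fs : List Expr}, ArgsRel ν (AtomRel W c k) Es Fs →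
    List.Forall₂ (TokRel W) (Expr.serArgs Es)
      ((argsTokens (Expr.codeArgs Fs)).map (closeTokenAt k c)) ∧ Es.length = Fs.length
  | _, _, .nil => by simp [Expr.serArgs_nil]
  | _, _, .cons h hs => by
    rw [Expr.serArgs_cons, argsTokens_cons, List.map_append]
    exact ⟨List.rel_append h.tokens hs.tokens.1, by simp [hs.tokens.2]⟩
end

theorem ProcRel.tokens {k : ℕ} {P Q : Proc} (h : ProcRel ν (AtomRel W c) k P Q) :
    List.Forall₂ (TokRel W) P.ser ((procTokens Q.code).map (closeTokenAt k c)) := by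
  induction h with
  | nil k => rw [Proc.ser_nil, procTokens_nil]; exact forall₂_closeTokenAt_singleton (by simp) k
  | letIn hE hP ih =>
    rw [Proc.ser_letIn, procTokens_letIn, List.map_append, List.map_append, List.map_map]
    simp only [Function.comp_def, closeTokenAt_liftToken]
    exact List.rel_append (List.rel_append hE.tokens ih)
      (forall₂_closeTokenAt_singleton (by simp) _)
  | invoke m hx hE hP ih =>
    rw [Proc.ser_invoke, procTokens_invoke, List.map_append, List.map_append, List.map_append,
      hE.tokens.2]
    exact List.rel_append (List.rel_append (List.rel_append hx.tokens hE.tokens.1) ih)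
      (forall₂_closeTokenAt_singleton (by simp) _)
  | cond hE hE' hP hP' ih ih' =>
    rw [Proc.ser_cond, procTokens_cond, List.map_append, List.map_append, List.map_append,
      List.map_append]
    exact List.rel_append (List.rel_append (List.rel_append (List.rel_append hE.tokens
      hE'.tokens) ih) ih') (forall₂_closeTokenAt_singleton (by simp) _)
  | plus hP hP' ih ih' =>
    rw [Proc.ser_plus, procTokens_plus, List.map_append, List.map_append]
    exact List.rel_append (List.rel_append ih ih') (forall₂_closeTokenAt_singleton (by simp) _)

end

/-! The tokens of a closed process. -/

theorem bound_atomTokens {k : ℕ} {a : Atom} (h : a.ClosedAt k) :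
    ∀ t ∈ atomTokens a.code, t.1 = 0 → t.2.1 < t.2.2 + k := by
  cases a <;> simp [Atom.ClosedAt] at h ⊢
  exact h

mutual
theorem bound_exprTokens {k : ℕ} : ∀ {E : Expr}, E.ClosedAt k →
    ∀ t ∈ exprTokens E.code, t.1 = 0 → t.2.1 < t.2.2 + k
  | .atom a, h => by rw [exprTokens_atom]; exact bound_atomTokens (by simpa [Expr.ClosedAt] using h)
  | .field f, h => by simp
  | .new C Es, h => by
    simp only [exprTokens_new, List.mem_append, List.mem_singleton]
    rintro t (ht | rfl)
    · exact bound_argsTokens (by simpa [Expr.ClosedAt] using h) t ht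
    · simp
theorem bound_argsTokens {k : ℕ} : ∀ {Es : List Expr}, Expr.ClosedAtList k Es →
    ∀ t ∈ argsTokens (Expr.codeArgs Es), t.1 = 0 → t.2.1 < t.2.2 + k
  | [], _ => by simp
  | E :: Es, h => by
    rw [Expr.ClosedAtList] at h
    simp only [argsTokens_cons, List.mem_append]
    rintro t (ht | ht)
    · exact bound_exprTokens h.1 t ht
    · exact bound_argsTokens h.2 t ht
end

theorem bound_procTokens {P : Proc} : ∀ {k : ℕ}, P.ClosedAt k →
    ∀ t ∈ procTokens P.code, t.1 = 0 → t.2.1 < t.2.2 + k := by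
  induction P with
  | nil => simp
  | upd f E P ih =>
    intro k h
    simp only [procTokens_upd, List.mem_append, List.mem_singleton]
    rintro t ((ht | ht) | rfl)
    · exact bound_exprTokens h.1 t ht
    · exact ih h.2 t ht
    · simp
  | letIn E P ih =>
    intro k h
    simp only [procTokens_letIn, List.mem_append, List.mem_singleton, List.mem_map]
    rintro t ((ht | ⟨t, ht, rfl⟩) | rfl)
    · exact bound_exprTokens h.1 t ht
    · intro h0
      rw [kind_liftToken] at h0
      have := ih h.2 t ht h0
      simp only [liftToken, h0, if_true]
      omega
    · simp
  | invoke x m Es P ih =>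
    intro k h
    simp only [procTokens_invoke, List.mem_append, List.mem_singleton]
    rintro t (((ht | ht) | ht) | rfl)
    · exact bound_atomTokens h.1 t ht
    · exact bound_argsTokens h.2.1 t ht
    · exact ih h.2.2 t ht
    · simp
  | cond E E' P Q ih ih' =>
    intro k h
    simp only [procTokens_cond, List.mem_append, List.mem_singleton]
    rintro t ((((ht | ht) | ht) | ht) | rfl)
    · exact bound_exprTokens h.1 t ht
    · exact bound_exprTokens h.2.1 t ht
    · exact ih h.2.2.1 t ht
    · exact ih' h.2.2.2 t ht
    · simp
  | plus P Q ih ih' =>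
    intro k h
    simp only [procTokens_plus, List.mem_append, List.mem_singleton]
    rintro t ((ht | ht) | rfl)
    · exact ih h.1 t ht
    · exact ih' h.2 t ht
    · simp

theorem closureTokens_code {P : Proc} (h : P.LocallyClosed) :
    closureTokens (P.code, [], [], 0) = P.ser := by
  rw [closureTokens, Proc.ser]
  refine List.map_congr_left fun t ht => ?_
  by_cases h0 : t.1 = 0
  · have := bound_procTokens h t ht h0
    simp [closeToken, stripToken, h0, show t.2.1 < t.2.2 from this]
  · by_cases h1 : t.1 = 1
    · obtain ⟨v, hv, -⟩ := (mem_procTokens P ht).1 h1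
      cases v <;> simp [closeToken, stripToken, resolve, h1, hv, Value.code]
    · simp [closeToken, stripToken, h0, h1]

/-! ### Renaming -/

/-- Pairs are added one at a time. The permutation for the others is followed by the transposition
of `σ x.1` and `x.2`, which moves no value prescribed earlier unless it belongs to the same pair. -/
theorem exists_perm {α : Type*} [DecidableEq α] (l : List (α × α))
    (h : ∀ z ∈ l, ∀ z' ∈ l, z.1 = z'.1 ↔ z.2 = z'.2) :
    ∃ σ : Equiv.Perm α, ∀ z ∈ l, σ z.1 = z.2 := by
  induction l with
  | nil => exact ⟨1, by simp⟩
  | cons x l ih =>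
    obtain ⟨σ, hσ⟩ := ih fun z hz z' hz' => h z (by simp [hz]) z' (by simp [hz'])
    refine ⟨σ.trans (Equiv.swap (σ x.1) x.2), fun z hz => ?_⟩
    rcases List.mem_cons.1 hz with rfl | hz'
    · simp
    · have hx := h z hz x (by simp)
      by_cases hzx : z.1 = x.1
      · rw [hzx, hx.1 hzx]; simp
      · rw [Equiv.trans_apply, hσ z hz', Equiv.swap_apply_of_ne_of_ne]
        · rw [← hσ z hz']; exact fun h => hzx (σ.injective h)
        · exact fun h => hzx (hx.2 h)


/-- A partial injection from values to codes that maps variables to variables and actor names to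
actor names. -/
structure IsMatching (W : Set (Value × ℕ)) : Prop where
  bij : ∀ z ∈ W, ∀ z' ∈ W, z.1 = z'.1 ↔ z.2 = z'.2
  kind : ∀ z ∈ W, z.2.unpair.1 = z.1.code.unpair.1

theorem Value.rename_injective (σ : Equiv.Perm Var) (τ : Equiv.Perm ActorName) :
    Function.Injective (Value.rename σ τ) := by
  rintro (x | A) (y | B) h <;> simp [Value.rename] at h ⊢ <;> exact h

theorem IsMatching.comp_rename {W : Set (Value × ℕ)} (h : IsMatching W) (σ : Equiv.Perm Var)
    (τ : Equiv.Perm ActorName) : IsMatching {z | (Value.rename σ τ z.1, z.2) ∈ W} where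
  bij z hz z' hz' := by
    rw [← (Value.rename_injective σ τ).eq_iff]
    exact h.bij _ hz _ hz'
  kind z hz := by
    rw [h.kind _ hz]
    cases z.1 <;> simp [Value.rename, Value.code]

theorem tokenCompat_of_tokRel {W : Set (Value × ℕ)} (h : IsMatching W) {x y : Token × Token}
    (hx : TokRel W x.1 x.2) (hy : TokRel W y.1 y.2) : TokenCompat x y := by
  obtain ⟨x, x'⟩ := x
  obtain ⟨y, y'⟩ := y
  dsimp only at hx hy
  rcases hx with ⟨U, u, rfl, rfl, hU⟩ | ⟨hx, rfl⟩
  · refine ⟨rfl, fun _ => (h.kind _ hU).symm, fun h => absurd rfl h, fun _ h1 => ?_⟩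
    rcases hy with ⟨V, v, rfl, rfl, hV⟩ | ⟨hy, rfl⟩
    · exact Value.code_injective.eq_iff.trans (h.bij _ hU _ hV)
    · exact absurd h1 hy
  · exact ⟨rfl, fun h1 => absurd h1 hx, fun _ => rfl, fun h1 => absurd h1 hx⟩

theorem tokensMatch_of_forall₂ {W : Set (Value × ℕ)} (h : IsMatching W) {l l' : List Token}
    (hl : List.Forall₂ (TokRel W) l l') : TokensMatch l l' := by
  obtain ⟨h1, h2⟩ := List.forall₂_iff_zip.1 hl
  exact ⟨h1, fun x hx y hy => tokenCompat_of_tokRel h (h2 hx) (h2 hy)⟩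

theorem exists_mem_zip_of_forall₂ {α β γ : Type*} {R : β → γ → Prop} {l₂ : List β} {l₃ : List γ}
    (h : List.Forall₂ R l₂ l₃) : ∀ {l₁ : List α} {a : α} {b : β}, (a, b) ∈ l₁.zip l₂ →
      ∃ c, (a, c) ∈ l₁.zip l₃ ∧ R b c := by
  induction h with
  | nil => simp
  | cons hR _ ih =>
    intro l₁ a b hab
    cases l₁ with
    | nil => simp at hab
    | cons a' l₁ =>
      rw [List.zip_cons_cons, List.mem_cons] at hab
      rcases hab with h | h
      · obtain ⟨rfl, rfl⟩ := Prod.mk.inj h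
        exact ⟨_, by simp, hR⟩
      · obtain ⟨c, hc, hR⟩ := ih h
        exact ⟨c, by simp [hc], hR⟩

theorem token_eq_of_mem_ser {P : Proc} {t : Token} (ht : t ∈ P.ser) (h : t.1 = 1) :
    ∃ U : Value, t = (1, U.code, 0) := by
  have hl := ser_mapVal id P
  obtain ⟨s, -, hs⟩ := exists_mem_zip_of_forall₂ (l₁ := P.ser) (a := t) (b := t) hl
    (by rw [List.zip_eq_zipWith]; simpa using ht)
  rcases hs with ⟨U, u, hU, -⟩ | ⟨h1, -⟩
  · exact ⟨U, hU⟩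
  · exact absurd h h1

/-- A finite partial injection on values extends to a renaming. -/
theorem exists_rename (l : List (Value × Value))
    (h : ∀ z ∈ l, ∀ z' ∈ l, z.1 = z'.1 ↔ z.2 = z'.2)
    (hk : ∀ z ∈ l, z.1.code.unpair.1 = z.2.code.unpair.1) :
    ∃ (σ : Equiv.Perm Var) (τ : Equiv.Perm ActorName), ∀ z ∈ l, Value.rename σ τ z.1 = z.2 := by
  obtain ⟨σ, hσ⟩ := exists_perm (l.filterMap fun z => match z with
    | (.var x, .var y) => some (x, y)
    | _ => none) (by
      simp only [List.mem_filterMap]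
      rintro ⟨x, y⟩ ⟨⟨_ | _, _ | _⟩, hz, e⟩ ⟨x', y'⟩ ⟨⟨_ | _, _ | _⟩, hz', e'⟩ <;>
        simp at e e'
      obtain ⟨rfl, rfl⟩ := e
      obtain ⟨rfl, rfl⟩ := e'
      simpa using h _ hz _ hz')
  obtain ⟨τ, hτ⟩ := exists_perm (l.filterMap fun z => match z with
    | (.actor A, .actor B) => some (A, B)
    | _ => none) (by
      simp only [List.mem_filterMap]
      rintro ⟨x, y⟩ ⟨⟨_ | _, _ | _⟩, hz, e⟩ ⟨x', y'⟩ ⟨⟨_ | _, _ | _⟩, hz', e'⟩ <;>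
        simp at e e'
      obtain ⟨rfl, rfl⟩ := e
      obtain ⟨rfl, rfl⟩ := e'
      simpa using h _ hz _ hz')
  refine ⟨σ, τ, ?_⟩
  rintro ⟨x | A, y | B⟩ hz
  · simpa [Value.rename] using hσ (x, y) (List.mem_filterMap.2 ⟨_, hz, rfl⟩)
  · simpa [Value.code] using hk _ hz
  · simpa [Value.code] using hk _ hz
  · simpa [Value.rename] using hτ (A, B) (List.mem_filterMap.2 ⟨_, hz, rfl⟩)

/-- The test for closures is correct. -/
theorem closureMatches_iff {P Q : Proc} {c : Closure} {W : Set (Value × ℕ)}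
    (hP : P.LocallyClosed) (hW : IsMatching W)
    (h : List.Forall₂ (TokRel W) Q.ser (closureTokens c)) :
    ClosureMatches P.code c ↔ P.EqUpToRenaming Q := by
  rw [ClosureMatches, closureTokens_code hP]
  constructor
  · rintro ⟨hlen, hm⟩
    have hlen' : P.ser.length = Q.ser.length := hlen.trans h.length_eq.symm
    have key : ∀ t t', (t, t') ∈ P.ser.zip Q.ser → (t.1 ≠ 1 ∧ t' = t) ∨
        ∃ U U' : Value, ∃ u, t = (1, U.code, 0) ∧ t' = (1, U'.code, 0) ∧ (U', u) ∈ W ∧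
          (t, (1, u, 0)) ∈ P.ser.zip (closureTokens c) := by
      intro t t' ht
      obtain ⟨s, hs, hR⟩ := exists_mem_zip_of_forall₂ h ht
      obtain ⟨h1, -, h3, -⟩ := hm _ hs _ hs
      simp only at h1 h3
      rcases hR with ⟨U', u, rfl, rfl, hU'⟩ | ⟨h4, rfl⟩
      · obtain ⟨U, rfl⟩ := token_eq_of_mem_ser (List.of_mem_zip ht).1 h1
        exact .inr ⟨U, U', u, rfl, rfl, hU', hs⟩
      · by_cases h5 : t.1 = 1
        · exact absurd (h1.symm.trans h5) h4
        · exact .inl ⟨h5, (h3 h5).symm⟩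
    have : Nonempty Value := ⟨.var 0⟩
    let dec : ℕ → Value := Function.invFun Value.code
    have hdec : ∀ U : Value, dec U.code = U :=
      Function.leftInverse_invFun Value.code_injective
    -- These are the pairs of values at corresponding positions of `P` and `Q`. They form a partial
    -- injection because the test compares `P` with the closure injectively, and `W` compares the
    -- closure with `Q` injectively.
    let L : List (Value × Value) := ((P.ser.zip Q.ser).filter fun z => z.1.1 = 1).map
      fun z => (dec z.1.2.1, dec z.2.2.1)
    have hL : ∀ z ∈ L, ∃ u, (z.2, u) ∈ W ∧
        ((1, z.1.code, 0), (1, u, 0)) ∈ P.ser.zip (closureTokens c) := by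
      intro z hz
      obtain ⟨⟨t, t'⟩, ht, rfl⟩ := List.mem_map.1 hz
      obtain ⟨ht, ht1⟩ := List.mem_filter.1 ht
      rcases key t t' ht with ⟨h1, -⟩ | ⟨U, U', u, rfl, rfl, hU', hs⟩
      · exact absurd (by simpa using ht1) h1
      · exact ⟨u, by simpa only [hdec] using hU', by simpa only [hdec] using hs⟩
    obtain ⟨σ, τ, hστ⟩ := exists_rename L (fun z hz z' hz' => by
      obtain ⟨u, hu, hm1⟩ := hL z hz
      obtain ⟨u', hu', hm2⟩ := hL z' hz'
      have h1 := (hm _ hm1 _ hm2).2.2.2 rfl rfl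
      have h2 := hW.bij _ hu _ hu'
      simp only at h1 h2
      rw [← Value.code_injective.eq_iff, h1, ← h2]) (fun z hz => by
      obtain ⟨u, hu, hm1⟩ := hL z hz
      have h1 := (hm _ hm1 _ hm1).2.1 rfl
      have h2 := hW.kind _ hu
      simp only at h1 h2
      rw [h1, h2])
    refine ⟨σ, τ, Proc.ser_injective ?_⟩
    have h1 := ser_mapVal (Value.rename σ τ) P
    -- At each position the token of `Q` is the only one that the renaming admits, so `Q` and the
    -- renamed `P` have the same serialization.
    have h2 : List.Forall₂ (fun t t' => ∀ s, TokRel (graphOf (Value.rename σ τ)) t s → t' = s)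
        P.ser Q.ser := by
      refine List.forall₂_iff_zip.2 ⟨hlen', fun {t t'} ht s hs => ?_⟩
      rcases key t t' ht with ⟨h1, rfl⟩ | ⟨U, U', u, rfl, rfl, hU', -⟩
      · rcases hs with ⟨V, v, rfl, -⟩ | ⟨-, rfl⟩
        · exact absurd rfl h1
        · rfl
      · rcases hs with ⟨V, v, hV, rfl, hv⟩ | ⟨h1, -⟩
        · simp only [Prod.mk.injEq, true_and, and_true, Value.code_injective.eq_iff] at hV
          subst hV
          have := hστ (U, U') (List.mem_map.2 ⟨_, List.mem_filter.2 ⟨ht, by simp⟩, by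
            simp only [hdec]⟩)
          simp only at this
          rw [← this, show v = _ from hv]
        · exact absurd rfl h1
    have key2 : ∀ {l l₁ l₂ : List Token},
        List.Forall₂ (TokRel (graphOf (Value.rename σ τ))) l l₁ → List.Forall₂
          (fun t t' => ∀ s, TokRel (graphOf (Value.rename σ τ)) t s → t' = s) l l₂ → l₂ = l₁ := by
      intro l l₁ l₂ hl
      induction hl generalizing l₂ with
      | nil => intro h; cases h; rfl
      | cons hR _ ih =>
        intro h
        cases h with
        | cons hS hs => rw [hS _ hR, ih hs]
    exact key2 h1 h2
  · rintro ⟨σ, τ, rfl⟩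
    refine tokensMatch_of_forall₂ (hW.comp_rename σ τ) ?_
    have key : ∀ {l l₁ l₂ : List Token},
        List.Forall₂ (TokRel (graphOf (Value.rename σ τ))) l l₁ →
        List.Forall₂ (TokRel W) l₁ l₂ →
        List.Forall₂ (TokRel {z | (Value.rename σ τ z.1, z.2) ∈ W}) l l₂ := by
      intro l l₁ l₂ hl
      induction hl generalizing l₂ with
      | nil => intro h; cases h; exact .nil
      | cons hR _ ih =>
        intro h
        cases h with
        | cons hS hs =>
          refine .cons ?_ (ih hs)
          rcases hR with ⟨U, u, rfl, rfl, hU⟩ | ⟨h1, rfl⟩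
          · rcases hS with ⟨V, v, hV, rfl, hv⟩ | ⟨h1, -⟩
            · refine .inl ⟨U, v, rfl, rfl, ?_⟩
              simp only [Prod.mk.injEq, true_and, and_true] at hV
              have := Value.code_injective ((show u = _ from hU).symm.trans hV)
              change (Value.rename σ τ U, v) ∈ W
              rw [this]
              exact hv
            · exact absurd rfl h1
          · rcases hS with ⟨V, v, rfl, -⟩ | ⟨-, rfl⟩
            · exact absurd rfl h1
            · exact .inr ⟨h1, rfl⟩
    exact key (ser_mapVal _ P) h


/-! ### Values, stores and actors of related configurations -/

/-- The code of an actor name as a value. -/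
abbrev ActorName.vcode (A : ActorName) : ℕ := (Value.actor A).code

theorem ActorName.vcode_injective : Function.Injective ActorName.vcode := fun A B h => by
  simpa using Value.code_injective h

theorem ActorName.unpair_vcode (A : ActorName) : A.vcode.unpair.1 = 1 := by
  simp [ActorName.vcode, Value.code]

/-- The pairs of an actor name or a variable in `F` and its code. -/
def diag (F : Set Var) : Set (Value × ℕ) := {z | (∀ x, z.1 = .var x → x ∈ F) ∧ z.2 = z.1.code}

theorem isMatching_diag (F : Set Var) : IsMatching (diag F) where
  bij z hz z' hz' := by rw [hz.2, hz'.2, Value.code_injective.eq_iff]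
  kind z hz := by rw [hz.2]

theorem actor_mem_diag (F : Set Var) (A : ActorName) : (.actor A, A.vcode) ∈ diag F :=
  ⟨by simp, rfl⟩

theorem diag_mono {F F' : Set Var} (h : F ⊆ F') : diag F ⊆ diag F' := fun _ hz =>
  ⟨fun x hx => h (hz.1 x hx), hz.2⟩

def StoreRel (F : Set Var) (φ : Store) (φ' : List (ℕ × ℕ)) : Prop :=
  ∀ f, φ'.lookup f = (φ f).map Value.code ∧ ∀ U, φ f = some U → (U, U.code) ∈ diag F

theorem StoreRel.restrict {F F' : Set Var} {φ : Store} {φ' : List (ℕ × ℕ)} (h : StoreRel F φ φ')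
    (hF : ∀ f x, φ f = some (.var x) → x ∈ F → x ∈ F') : StoreRel F' φ φ' := fun f =>
  ⟨(h f).1, fun U hU => ⟨fun x hx => hF f x (by rw [hU]; exact congrArg _ hx)
    (((h f).2 U hU).1 x hx), rfl⟩⟩

theorem lookup_zip_map {β γ : Type*} (g : β → γ) (fs : List ℕ) : ∀ (Us : List β) (f : ℕ),
    (fs.zip (Us.map g)).lookup f = ((fs.zip Us).lookup f).map g := by
  induction fs with
  | nil => simp
  | cons e fs ih =>
    intro Us f
    cases Us with
    | nil => simp
    | cons U Us =>
      rw [List.map_cons, List.zip_cons_cons, List.zip_cons_cons, List.lookup_cons,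
        List.lookup_cons]
      cases f == e
      · exact ih Us f
      · rfl

theorem storeRel_mkStore {F : Set Var} (fs : List Fld) {Us : List Value} {us : List ℕ}
    (h : List.Forall₂ (fun U u => (U, u) ∈ diag F) Us us) :
    StoreRel F (mkStore fs Us) (fs.zip us) := by
  obtain rfl : us = Us.map Value.code := by
    induction h with
    | nil => rfl
    | cons h _ ih => rw [List.map_cons, ← ih, ← h.2]
  refine fun f => ⟨lookup_zip_map _ _ _ _, fun U hU => ?_⟩
  obtain ⟨l₁, l₂, h1, -⟩ := List.lookup_eq_some_iff.1 hU
  have hm : U ∈ Us := (List.of_mem_zip (by rw [h1]; simp : (f, U) ∈ fs.zip Us)).2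
  rw [List.forall₂_map_right_iff, List.forall₂_same] at h
  exact h U hm

/-- The number of actors of a class. -/
def classCount (acts : Actors) (C : Cls) : ℕ := (acts.filter fun e => hasClass e.1 C).length

/-- By `count`, the names in use of each class form an initial segment, so the first unused name can
be computed from the number of actors. By `present`, the stores agree literally, without any
renaming of variables. -/
structure ActorsRel (F : Set Var) (S : Config) (acts : Actors) : Prop where
  coded : ∀ e ∈ acts, ∃ A : ActorName, e.1 = A.vcode
  absent : ∀ A, S A = none → acts.lookup A.vcode = none
  present : ∀ A st, S A = some st → ∃ φ', acts.lookup A.vcode = some φ' ∧ StoreRel F st.store φ'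
  count : ∀ C i, S (.named C i) = none ↔ ¬ i < classCount acts C
  root : (S .root).isSome

theorem hasClass_named {C D : Cls} {i : ℕ} :
    hasClass (ActorName.named C i).vcode D ↔ C = D := by
  simp [hasClass, ActorName.vcode, Value.code, ActorName.code]

theorem not_hasClass_root {D : Cls} : ¬ hasClass ActorName.root.vcode D := by
  simp [hasClass, ActorName.vcode, Value.code, ActorName.code]

theorem ActorsRel.freshActor {F : Set Var} {S : Config} {acts : Actors} (h : ActorsRel F S acts)
    (C : Cls) : S.freshActor C = .named C (classCount acts C) := by
  rw [Config.freshActor]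
  congr
  have : {i | S (.named C i) = none} = Set.Ici (classCount acts C) := by
    ext i; simp [h.count]
  rw [this, csInf_Ici]

theorem newName_eq (acts : Actors) (C : Cls) :
    newName acts C = (ActorName.named C (classCount acts C)).vcode := rfl

theorem ActorsRel.addActor {F : Set Var} {S : Config} {acts : Actors} (h : ActorsRel F S acts)
    (C : Cls) {st : ActorState} {φ : List (ℕ × ℕ)} (hφ : StoreRel F st.store φ) :
    ActorsRel F (Function.update S (S.freshActor C) (some st))
      (acts ++ [(newName acts C, φ)]) := by
  have hnone : acts.lookup (newName acts C) = none :=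
    h.absent _ ((h.count C _).2 (lt_irrefl _))
  rw [h.freshActor, newName_eq] at *
  constructor
  · intro e he
    rcases List.mem_append.1 he with he | he
    · exact h.coded e he
    · obtain rfl := List.mem_singleton.1 he
      exact ⟨_, rfl⟩
  · intro A hA
    by_cases hAN : A = .named C (classCount acts C)
    · subst hAN; simp at hA
    · rw [Function.update_of_ne hAN] at hA
      have h1 : (A.vcode == (ActorName.named C (classCount acts C)).vcode) = false := by
        simpa using fun h => hAN (ActorName.vcode_injective h)
      rw [List.lookup_append, h.absent A hA]
      simp [List.lookup_cons, h1]
  · intro A st' hA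
    by_cases hAN : A = .named C (classCount acts C)
    · subst hAN
      rw [Function.update_self, Option.some.injEq] at hA
      subst hA
      refine ⟨φ, ?_, hφ⟩
      rw [List.lookup_append, hnone]
      simp
    · rw [Function.update_of_ne hAN] at hA
      obtain ⟨φ', h1, h2⟩ := h.present A st' hA
      exact ⟨φ', by rw [List.lookup_append, h1]; rfl, h2⟩
  · intro D i
    have hc : classCount (acts ++ [((ActorName.named C (classCount acts C)).vcode, φ)]) D =
        classCount acts D + if C = D then 1 else 0 := by
      simp only [classCount, List.filter_append, List.length_append]
      by_cases hCD : C = D <;> simp [hasClass_named, hCD]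
    rw [hc]
    by_cases hCD : C = D
    · subst hCD
      by_cases hi : i = classCount acts C
      · subst hi; simp
      · rw [Function.update_of_ne (by simpa using hi), h.count]
        simp
        omega
    · rw [Function.update_of_ne (by simpa using fun h => absurd h.symm hCD), h.count]
      simp [hCD]
  · rw [Function.update_of_ne (by simp)]
    exact h.root

/-! ### Evaluation as a function -/

mutual
-- Evaluation is deterministic; as a partial function it can be compared with the fold over tokens,
-- failure included.
noncomputable def valueOf (Pr : Program) (φ : Store) : Expr → Config → Option (Value × Config)
  | .atom (.val U), S => some (U, S)
  | .atom (.bound _), _ => none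
  | .field f, S => (φ f).map fun U => (U, S)
  | .new C args, S => (valuesOf Pr φ args S).map fun r =>
      (.actor (r.2.freshActor C),
        Function.update r.2 (r.2.freshActor C) (some ⟨.nil, mkStore (Pr.fields C) r.1, []⟩))
noncomputable def valuesOf (Pr : Program) (φ : Store) :
    List Expr → Config → Option (List Value × Config)
  | [], S => some ([], S)
  | E :: Es, S => (valueOf Pr φ E S).bind fun r =>
      (valuesOf Pr φ Es r.2).map fun r' => (r.1 :: r'.1, r'.2)
end

mutual
theorem valueOf_of_eval {Pr : Program} {φ : Store} : ∀ {E : Expr} {S S' : Config} {U : Value},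
    Eval Pr φ S E U S' → valueOf Pr φ E S = some (U, S')
  | .atom _, _, _, _, .val _ _ => by simp [valueOf]
  | .field f, _, _, _, .field _ _ _ h => by simp [valueOf, h]
  | .new C Es, _, _, _, .new _ _ _ _ _ h => by simp [valueOf, valuesOf_of_evalList h]
theorem valuesOf_of_evalList {Pr : Program} {φ : Store} :
    ∀ {Es : List Expr} {S S' : Config} {Us : List Value},
    EvalList Pr φ S Es Us S' → valuesOf Pr φ Es S = some (Us, S')
  | [], _, _, _, .nil _ => by simp [valuesOf]
  | _ :: _, _, _, _, .cons _ _ _ _ _ _ _ h hs => by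
    simp [valuesOf, valueOf_of_eval h, valuesOf_of_evalList hs]
end

mutual
theorem eval_of_valueOf {Pr : Program} {φ : Store} : ∀ {E : Expr} {S S' : Config} {U : Value},
    valueOf Pr φ E S = some (U, S') → Eval Pr φ S E U S'
  | .atom (.val V), S, S', U, h => by
    simp only [valueOf, Option.some.injEq, Prod.mk.injEq] at h
    obtain ⟨rfl, rfl⟩ := h
    exact .val _ _
  | .atom (.bound _), S, S', U, h => by simp [valueOf] at h
  | .field f, S, S', U, h => by
    simp only [valueOf, Option.map_eq_some_iff, Prod.mk.injEq] at h
    obtain ⟨V, hV, rfl, rfl⟩ := h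
    exact .field _ _ _ hV
  | .new C Es, S, S', U, h => by
    simp only [valueOf, Option.map_eq_some_iff, Prod.mk.injEq] at h
    obtain ⟨⟨Us, S''⟩, hr, rfl, rfl⟩ := h
    exact .new _ _ _ _ _ (evalList_of_valuesOf hr)
theorem evalList_of_valuesOf {Pr : Program} {φ : Store} :
    ∀ {Es : List Expr} {S S' : Config} {Us : List Value},
    valuesOf Pr φ Es S = some (Us, S') → EvalList Pr φ S Es Us S'
  | [], S, S', U, h => by
    simp only [valuesOf, Option.some.injEq, Prod.mk.injEq] at h
    obtain ⟨rfl, rfl⟩ := h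
    exact .nil _
  | E :: Es, S, S', Us, h => by
    simp only [valuesOf, Option.bind_eq_some_iff, Option.map_eq_some_iff, Prod.mk.injEq] at h
    obtain ⟨⟨U, S₁⟩, h1, ⟨Vs, S₂⟩, h2, rfl, rfl⟩ := h
    exact .cons _ _ _ _ _ _ _ (eval_of_valueOf h1) (evalList_of_valuesOf h2)
end

theorem valuesOf_length {Pr : Program} {φ : Store} : ∀ {Es : List Expr} {S S' : Config}
    {Us : List Value}, valuesOf Pr φ Es S = some (Us, S') → Es.length = Us.length
  | [], S, S', U, h => by
    simp only [valuesOf, Option.some.injEq, Prod.mk.injEq] at h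
    simp [← h.1]
  | E :: Es, S, S', Us, h => by
    simp only [valuesOf, Option.bind_eq_some_iff, Option.map_eq_some_iff, Prod.mk.injEq] at h
    obtain ⟨⟨U, S₁⟩, h1, ⟨Vs, S₂⟩, h2, rfl, rfl⟩ := h
    simp [valuesOf_length h2]

/-- The configuration `S'` results from `S` by the creation of actors. -/
def Extends (S S' : Config) : Prop :=
  (∀ A st, S A = some st → S' A = some st) ∧
    ∀ A st, S' A = some st → S A = some st ∨ (S A = none ∧ st.proc = .nil ∧ st.queue = [])

theorem Extends.refl (S : Config) : Extends S S := ⟨fun _ _ h => h, fun _ _ h => .inl h⟩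

theorem Extends.trans {S S' S'' : Config} (h : Extends S S') (h' : Extends S' S'') :
    Extends S S'' := by
  refine ⟨fun A st hA => h'.1 A st (h.1 A st hA), fun A st hA => ?_⟩
  rcases h'.2 A st hA with hA | ⟨hA, hst⟩
  · exact h.2 A st hA
  · refine .inr ⟨?_, hst⟩
    by_contra hne
    obtain ⟨st', h1⟩ := Option.ne_none_iff_exists'.1 hne
    rw [h.1 A st' h1] at hA
    cases hA

theorem ActorsRel.extends_addActor {F : Set Var} {S : Config} {acts : Actors}
    (h : ActorsRel F S acts) (C : Cls) {st : ActorState} (hp : st.proc = .nil)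
    (hq : st.queue = []) : Extends S (Function.update S (S.freshActor C) (some st)) := by
  have hnone : S (S.freshActor C) = none := by
    rw [h.freshActor]; exact (h.count C _).2 (lt_irrefl _)
  constructor
  · intro A st' hA
    rw [Function.update_of_ne]
    · exact hA
    · rintro rfl; rw [hnone] at hA; cases hA
  · intro A st' hA
    by_cases hAN : A = S.freshActor C
    · subst hAN
      rw [Function.update_self, Option.some.injEq] at hA
      subst hA
      exact .inr ⟨hnone, hp, hq⟩
    · rw [Function.update_of_ne hAN] at hA
      exact .inl hA

theorem fieldsOf_code (Pr : Program) (C : Cls) : fieldsOf Pr.code C = Pr.fields C := by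
  have key : ∀ l : List (Cls × List Fld), (((l.map fun e => Nat.pair e.1 (codeList e.2)).map
      Nat.unpair).lookup C).map (fun fs => Denumerable.ofNat (List ℕ) fs) = l.lookup C := by
    intro l
    induction l with
    | nil => rfl
    | cons e l ih =>
      obtain ⟨D, fs⟩ := e
      simp only [List.map_cons, Nat.unpair_pair, List.lookup_cons]
      cases C == D
      · exact ih
      · simp [ofNat_codeList]
  simp only [fieldsOf, Program.code, Nat.unpair_pair, ofNat_codeList, key, Program.fields]

/-- The relation between the results of the evaluation of an expression. -/
def EvalRel (ν : Prop) (F : Set Var) (W : Set (Value × ℕ)) (S : Config) (l : List ℕ)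
    (r : Option (Value × Config)) (r' : Option (List ℕ × Actors)) : Prop :=
  (r = none ∧ r' = none) ∨ ∃ U S' u acts', r = some (U, S') ∧ r' = some (u :: l, acts') ∧
    (U, u) ∈ W ∧ ActorsRel F S' acts' ∧ Extends S S' ∧ (ν ∨ S' = S)

def EvalArgsRel (ν : Prop) (F : Set Var) (W : Set (Value × ℕ)) (S : Config) (l : List ℕ)
    (r : Option (List Value × Config)) (r' : Option (List ℕ × Actors)) : Prop :=
  (r = none ∧ r' = none) ∨ ∃ Us S' us acts', r = some (Us, S') ∧
    r' = some (us.reverse ++ l, acts') ∧ List.Forall₂ (fun U u => (U, u) ∈ W) Us us ∧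
      ActorsRel F S' acts' ∧ Extends S S' ∧ (ν ∨ S' = S)

section
variable {Pr : Program} {ν : Prop} {F : Set Var} {W : Set (Value × ℕ)} {c : Closure} {φ : Store}
  {φ' : List (ℕ × ℕ)}

theorem AtomRel.eval {a b : Atom} (h : AtomRel W c 0 a b) : ∃ U u, a = .val U ∧ (U, u) ∈ W ∧
    ∀ l acts, (atomTokens b.code).foldl (evalToken Pr.code φ' c) (some (l, acts)) =
      some (u :: l, acts) := by
  cases b with
  | bound j =>
    rcases h with ⟨hj, -⟩ | ⟨-, U, u, rfl, hu, hW⟩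
    · omega
    · refine ⟨U, u, rfl, hW, fun l acts => ?_⟩
      rw [Nat.sub_zero] at hu
      simp [evalToken, hu]
  | val v =>
    obtain ⟨U, rfl, hW⟩ := h
    exact ⟨U, _, rfl, hW, fun l acts => by simp [evalToken]⟩

mutual
theorem ExprRel.eval (hφ : StoreRel F φ φ') (hW : diag F ⊆ W) (hν : ν → W ⊆ diag F) :
    ∀ {E E₀ : Expr}, ExprRel ν (AtomRel W c 0) E E₀ → ∀ {S : Config} {acts : Actors},
    ActorsRel F S acts → ∀ l : List ℕ, EvalRel ν F W S l (valueOf Pr φ E S)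
      ((exprTokens E₀.code).foldl (evalToken Pr.code φ' c) (some (l, acts)))
  | _, _, .atom h, S, acts, hS, l => by
    obtain ⟨U, u, rfl, hU, h1⟩ := h.eval (Pr := Pr) (φ' := φ')
    rw [exprTokens_atom, h1]
    exact .inr ⟨U, S, u, acts, by simp [valueOf], rfl, hU, hS, .refl S, .inr rfl⟩
  | _, _, .field f, S, acts, hS, l => by
    obtain ⟨h1, h2⟩ := hφ f
    cases hf : φ f with
    | none => exact .inl ⟨by simp [valueOf, hf], by simp [evalToken, h1, hf]⟩
    | some U =>
      exact .inr ⟨U, S, U.code, acts, by simp [valueOf, hf], by simp [evalToken, h1, hf],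
        hW (h2 U hf), hS, .refl S, .inr rfl⟩
  | _, _, .new C hn h, S, acts, hS, l => by
    rename_i Es Fs
    have hlen : Es.length = Fs.length := h.tokens.2
    rw [exprTokens_new, List.foldl_append]
    rcases ArgsRel.eval hφ hW hν h hS l with ⟨h1, h2⟩ | ⟨Us, S', us, acts', h1, h2, h3, h4, h5, -⟩
    · refine .inl ⟨by simp [valueOf, h1], ?_⟩
      rw [h2, foldl_evalToken_none]
    · have hl : us.length = Fs.length := by
        rw [← h3.length_eq, ← hlen]
        exact (valuesOf_length h1).symm
      refine .inr ⟨.actor (S'.freshActor C), _, newName acts' C, _, by simp [valueOf, h1], ?_,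
        ?_, h4.addActor C (storeRel_mkStore (Pr.fields C) (h3.imp fun U u h => hν hn h)),
        h5.trans (h4.extends_addActor C (st := ⟨.nil, mkStore (Pr.fields C) Us, []⟩) rfl rfl), .inl hn⟩
      · rw [h2]
        simp [evalToken, ← hl, fieldsOf_code]
      · rw [newName_eq, ← h4.freshActor]
        exact hW (actor_mem_diag F _)
theorem ArgsRel.eval (hφ : StoreRel F φ φ') (hW : diag F ⊆ W) (hν : ν → W ⊆ diag F) :
    ∀ {Es Es₀ : List Expr}, ArgsRel ν (AtomRel W c 0) Es Es₀ → ∀ {S : Config} {acts : Actors},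
    ActorsRel F S acts → ∀ l : List ℕ, EvalArgsRel ν F W S l (valuesOf Pr φ Es S)
      ((argsTokens (Expr.codeArgs Es₀)).foldl (evalToken Pr.code φ' c) (some (l, acts)))
  | _, _, .nil, S, acts, hS, l => .inr ⟨[], S, [], acts, by simp [valuesOf], by simp, .nil, hS,
      .refl S, .inr rfl⟩
  | _, _, .cons h hs, S, acts, hS, l => by
    rw [argsTokens_cons, List.foldl_append]
    rcases ExprRel.eval hφ hW hν h hS l with ⟨h1, h2⟩ | ⟨U, S', u, acts', h1, h2, h3, h4, h5, h6⟩
    · refine .inl ⟨by simp [valuesOf, h1], ?_⟩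
      rw [h2, foldl_evalToken_none]
    · rcases ArgsRel.eval hφ hW hν hs h4 (u :: l) with
        ⟨k1, k2⟩ | ⟨Us, S'', us, acts'', k1, k2, k3, k4, k5, k6⟩
      · refine .inl ⟨by simp [valuesOf, h1, k1], ?_⟩
        rw [h2, k2]
      · refine .inr ⟨U :: Us, S'', u :: us, acts'', by simp [valuesOf, h1, k1], ?_,
          .cons h3 k3, k4, h5.trans k5, ?_⟩
        · rw [h2, k2]; simp
        · rcases h6 with h6 | rfl
          · exact .inl h6
          · exact k6
end

end


/-! ### Steps of single processes -/

/-- A step of a process that is not an update: the message that it sends, its continuation, and the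
configuration with the actors that it creates. -/
inductive LocalStep (Pr : Program) (φ : Store) (S : Config) :
    Proc → Option (ActorName × Msg) → Proc → Config → Prop
  | letIn {E : Expr} {P : Proc} {U : Value} {S' : Config} (h : valueOf Pr φ E S = some (U, S')) :
      LocalStep Pr φ S (.letIn E P) none (P.openAt U 0) S'
  | invoke {B : ActorName} {m : Meth} {Es : List Expr} {P : Proc} {Us : List Value} {S' : Config}
      (h : valuesOf Pr φ Es S = some (Us, S')) :
      LocalStep Pr φ S (.invoke (.val (.actor B)) m Es P) (some (B, ⟨m, Us⟩)) P S'
  | eqMatch {E E' : Expr} {P Q : Proc} {U : Value} {S' : Config}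
      (h : valuesOf Pr φ [E, E'] S = some ([U, U], S')) : LocalStep Pr φ S (.cond E E' P Q) none P S'
  | neMatch {E E' : Expr} {P Q : Proc} {U V : Value} {S' : Config} (hUV : U ≠ V)
      (h : valuesOf Pr φ [E, E'] S = some ([U, V], S')) : LocalStep Pr φ S (.cond E E' P Q) none Q S'
  | plusLeft {P Q : Proc} : LocalStep Pr φ S (.plus P Q) none P S
  | plusRight {P Q : Proc} : LocalStep Pr φ S (.plus P Q) none Q S

/-- The message is the one with the code `m`, up to a renaming of the variables other than those
in `F`. -/
def MsgRel (F : Set Var) (b : ℕ) (msg : Msg) (m : Message) : Prop :=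
  m.1 = msg.meth ∧ (∀ u ∈ m.2, u.unpair.1 = 0 → u.unpair.2 < b + m.2.length) ∧
    ∃ W, IsMatching W ∧ diag F ⊆ W ∧ List.Forall₂ (fun U u => (U, u) ∈ W) msg.args m.2

theorem MsgRel.restrict {F F' : Set Var} (h : F' ⊆ F) {b : ℕ} {msg : Msg} {m : Message}
    (hm : MsgRel F b msg m) : MsgRel F' b msg m := by
  obtain ⟨h1, h2, W, h3, h4, h5⟩ := hm
  exact ⟨h1, h2, W, h3, (diag_mono h).trans h4, h5⟩

theorem canonVal_unpair_one (b : ℕ) (vs : List ℕ) (u : ℕ) :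
    (canonVal b vs u).unpair.1 = u.unpair.1 := by
  unfold canonVal
  split_ifs with h
  · simp [h.1]
  · rfl

/-- Renamed variables are not less than `b`, so they never collide with values that are kept; two
renamed ones are distinguished by their positions, provided that one of them occurs in the tuple. -/
theorem canonVal_inj {b : ℕ} {vs : List ℕ} {u v : ℕ}
    (hu : u ∈ vs ∨ ¬ (u.unpair.1 = 0 ∧ ¬ u.unpair.2 < b))
    (h : canonVal b vs u = canonVal b vs v) : u = v := by
  unfold canonVal at h
  split_ifs at h with h1 h2 h2
  · have := (Nat.pair_eq_pair.1 h).2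
    exact (List.idxOf_inj (hu.resolve_right fun h => h h1)).1 (by omega)
  · rw [← h] at h2
    simp at h2
  · rw [h] at h1
    simp at h1
  · exact h

/-- The matching for the message is `W` followed by `canonVal`, restricted to values on which the
latter is injective: those in the tuple and those that it fixes. The pairs of `diag F` are of the
second sort. -/
theorem msgRel_canon {F : Set Var} {b : ℕ} (hF : ∀ x ∈ F, x < b) {W : Set (Value × ℕ)}
    (hW : IsMatching W) (hFW : diag F ⊆ W) (m : Meth) {Us : List Value} {us : List ℕ}
    (h : List.Forall₂ (fun U u => (U, u) ∈ W) Us us) : MsgRel F b ⟨m, Us⟩ (m, canon b us) := by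
  have hdiag : ∀ z ∈ diag F, ¬ (z.2.unpair.1 = 0 ∧ ¬ z.2.unpair.2 < b) := by
    rintro ⟨U | A, u⟩ ⟨h1, h2⟩
    · have := hF U (h1 U rfl)
      simp only at h2
      simpa [h2, Value.code] using this
    · simp only at h2
      simp [h2, Value.code]
  refine ⟨rfl, fun u hu h0 => by
    have := (mem_canon hu).1 h0; rwa [length_canon],
    {z | ∃ u, (z.1, u) ∈ W ∧ (u ∈ us ∨ ¬ (u.unpair.1 = 0 ∧ ¬ u.unpair.2 < b)) ∧
      z.2 = canonVal b us u}, ⟨?_, ?_⟩, ?_, ?_⟩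
  · rintro ⟨U, -⟩ ⟨u, hu, hu', rfl⟩ ⟨V, -⟩ ⟨v, hv, -, rfl⟩
    refine (hW.bij _ hu _ hv).trans ⟨fun h => ?_, canonVal_inj hu'⟩
    simp only at h
    rw [h]
  · rintro ⟨U, -⟩ ⟨u, hu, hu', rfl⟩
    simp only [canonVal_unpair_one]
    exact hW.kind _ hu
  · intro z hz
    refine ⟨z.2, hFW hz, .inr (hdiag z hz), ?_⟩
    rw [canonVal, if_neg (hdiag z hz)]
  · rw [canon, List.forall₂_map_right_iff]
    refine List.forall₂_iff_zip.2 ⟨h.length_eq, fun {U u} hz => ?_⟩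
    exact ⟨u, (List.forall₂_iff_zip.1 h).2 hz, .inl (List.of_mem_zip hz).2, rfl⟩

/-- The closure represents the process, up to values that are related by `W`. -/
def ProcRep (ν : Prop) (W : Set (Value × ℕ)) (Q : Proc) (c : Closure) : Prop :=
  ∃ P : Proc, c.1 = P.code ∧ ProcRel ν (AtomRel W c) 0 Q P

/-- The relation between sent messages. -/
def SentRel (F : Set Var) (b : ℕ) : Option (ActorName × Msg) → Option (ℕ × Message) → Prop
  | none, none => True
  | some x, some y => y.1 = x.1.vcode ∧ MsgRel F b x.2 y.2
  | _, _ => False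

/-- The relation between the results of steps. -/
def OutcomeRel (ν : Prop) (F : Set Var) (b : ℕ) (W : Set (Value × ℕ)) (S : Config)
    (o : Option (ActorName × Msg)) (Q : Proc) (S' : Config) (r : Outcome) : Prop :=
  SentRel F b o r.1 ∧ ProcRep ν W Q r.2.1 ∧ ActorsRel F S' r.2.2 ∧ Extends S S' ∧ (ν ∨ S' = S)

theorem IsMatching.eq_vcode {F : Set Var} {W : Set (Value × ℕ)} (hW : IsMatching W)
    (hFW : diag F ⊆ W) {A : ActorName} {u : ℕ} (h : (.actor A, u) ∈ W) : u = A.vcode :=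
  (hW.bij _ h _ (hFW (actor_mem_diag F A))).1 rfl

section
variable {n : ℕ} {φ : List (ℕ × ℕ)} {acts : Actors} {c : Closure} {r : Outcome}

theorem mem_procSteps_nil (hc : c.1 = Proc.nil.code) : r ∉ procSteps n φ acts c := by
  obtain ⟨o, p, a⟩ := r
  rw [mem_procSteps, hc]
  simp [Proc.code]

theorem mem_procSteps_letIn {E : Expr} {P : Proc} (hc : c.1 = (Proc.letIn E P).code) :
    r ∈ procSteps n φ acts c ↔ ∃ l acts', (exprTokens E.code).foldl (evalToken n φ c)
      (some ([], acts)) = some (l, acts') ∧ r = (none, (P.code, l.headI :: c.2.1, c.2.2), acts') := by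
  obtain ⟨o, p, a⟩ := r
  rw [mem_procSteps, hc]
  simp only [Proc.code, Nat.unpair_pair, Nat.reduceEqDiff, false_and, or_false, true_and,
    evalTokens, Prod.mk.injEq]
  exact ⟨fun ⟨l, h1, h2, h3⟩ => ⟨l, a, h1, h2, h3, rfl⟩,
    fun ⟨l, a', h1, h2, h3, h4⟩ => ⟨l, h4 ▸ h1, h2, h3⟩⟩

theorem mem_procSteps_invoke {x : Atom} {m : Meth} {Es : List Expr} {P : Proc} {v : ℕ}
    (hc : c.1 = (Proc.invoke x m Es P).code)
    (hx : ∀ l acts, (atomTokens x.code).foldl (evalToken n φ c) (some (l, acts)) =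
      some (v :: l, acts)) :
    r ∈ procSteps n φ acts c ↔ ∃ l acts', (argsTokens (Expr.codeArgs Es)).foldl (evalToken n φ c)
      (some ([], acts)) = some (l, acts') ∧
        r = (some (v, (m, canon (n.unpair.1 + 1) l.reverse)), (P.code, c.2), acts') := by
  obtain ⟨o, p, a⟩ := r
  rw [mem_procSteps, hc]
  simp only [Proc.code, Nat.unpair_pair, Nat.reduceEqDiff, false_and, or_false, true_and,
    false_or, evalTokens, Prod.mk.injEq]
  constructor
  · rintro ⟨l₀, a₀, l, h0, h1, h2, h3⟩
    rw [hx, Option.some.injEq, Prod.mk.injEq] at h0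
    exact ⟨l, a, h1, by rw [h2, ← h0.1]; rfl, h3, rfl⟩
  · rintro ⟨l, a', h1, h2, h3, h4⟩
    exact ⟨[v], acts, l, hx _ _, h4 ▸ h1, h2, h3⟩

theorem mem_procSteps_cond {E E' : Expr} {P Q : Proc} (hc : c.1 = (Proc.cond E E' P Q).code) :
    r ∈ procSteps n φ acts c ↔ ∃ l acts', (exprTokens E.code ++ exprTokens E'.code).foldl
      (evalToken n φ c) (some ([], acts)) = some (l, acts') ∧
        r = (none, (if l.headI = l.tail.headI then P.code else Q.code, c.2), acts') := by
  obtain ⟨o, p, a⟩ := r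
  rw [mem_procSteps, hc]
  simp only [Proc.code, Nat.unpair_pair, Nat.reduceEqDiff, false_and, or_false, true_and,
    false_or, evalTokens, Prod.mk.injEq]
  exact ⟨fun ⟨l, h1, h2, h3⟩ => ⟨l, a, h1, h2, h3, rfl⟩,
    fun ⟨l, a', h1, h2, h3, h4⟩ => ⟨l, h4 ▸ h1, h2, h3⟩⟩

theorem mem_procSteps_plus {P Q : Proc} (hc : c.1 = (Proc.plus P Q).code) :
    r ∈ procSteps n φ acts c ↔
      r = (none, (P.code, c.2), acts) ∨ r = (none, (Q.code, c.2), acts) := by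
  obtain ⟨o, p, a⟩ := r
  rw [mem_procSteps, hc]
  simp only [Proc.code, Nat.unpair_pair, Nat.reduceEqDiff, false_and, true_and,
    false_or, Prod.mk.injEq]
  tauto

end

section
variable {Pr : Program} {ν : Prop} {F : Set Var} {W : Set (Value × ℕ)} {φ : Store}
  {φ' : List (ℕ × ℕ)} {S : Config} {acts : Actors}

/-- The steps of a process agree with those of a closure that represents it. -/
theorem ProcRep.steps {Q : Proc} {c : Closure} (h : ProcRep ν W Q c) (hW : IsMatching W)
    (hφ : StoreRel F φ φ') (hFW : diag F ⊆ W) (hν : ν → W ⊆ diag F)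
    (hF : ∀ x ∈ F, x < Pr.main.code + 1) (hS : ActorsRel F S acts) :
    (∀ o Q' S', LocalStep Pr φ S Q o Q' S' → ∃ r ∈ procSteps Pr.code φ' acts c,
      OutcomeRel ν F (Pr.main.code + 1) W S o Q' S' r) ∧
    ∀ r ∈ procSteps Pr.code φ' acts c, (∀ x ∈ r.1, x.1.unpair.1 ≠ 0) →
      ∃ o Q' S', LocalStep Pr φ S Q o Q' S' ∧ OutcomeRel ν F (Pr.main.code + 1) W S o Q' S' r := by
  obtain ⟨P, hc, h⟩ := h
  have hb : Pr.code.unpair.1 = Pr.main.code := by simp [Program.code]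
  cases h with
  | nil => exact ⟨fun o Q' S' h => (nomatch h), fun r hr => absurd hr (mem_procSteps_nil hc)⟩
  | letIn hE hP =>
    rename_i E E₀ Q P
    have key := hE.eval (Pr := Pr) hφ hFW hν hS []
    have hrep : ∀ {U u}, (U, u) ∈ W → ProcRep ν W (Q.openAt U 0) (P.code, u :: c.2.1, c.2.2) :=
      fun hU => ⟨P, rfl, hP.openAt (AtomRel.openAt hU) rfl⟩
    simp only [mem_procSteps_letIn hc]
    constructor
    · rintro o Q' S' (h | h)
      rcases key with ⟨h1, -⟩ | ⟨U, S', u, acts', h1, h2, h3, h4, h5, h6⟩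
      · rw [h] at h1; cases h1
      · rw [h] at h1; cases h1
        exact ⟨_, ⟨_, _, h2, rfl⟩, trivial, hrep h3, h4, h5, h6⟩
    · rintro r ⟨l, acts', hl, rfl⟩ -
      rcases key with ⟨-, h2⟩ | ⟨U, S', u, acts', h1, h2, h3, h4, h5, h6⟩
      · rw [h2] at hl; cases hl
      · rw [h2] at hl; cases hl
        exact ⟨none, _, S', .letIn h1, trivial, hrep h3, h4, h5, h6⟩
  | invoke m hx hE hP =>
    rename_i x y Es Es₀ Q P
    have key := hE.eval (Pr := Pr) hφ hFW hν hS []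
    obtain ⟨V, v, rfl, hV, hx⟩ := hx.eval (Pr := Pr) (φ' := φ')
    have hrep : ProcRep ν W Q (P.code, c.2) := ⟨P, rfl, hP⟩
    simp only [mem_procSteps_invoke hc hx, hb]
    constructor
    · intro o Q' S' h
      cases h with
      | invoke h =>
        rcases key with ⟨h1, -⟩ | ⟨Us, S', us, acts', h1, h2, h3, h4, h5, h6⟩
        · rw [h] at h1; cases h1
        · rw [h] at h1; cases h1
          refine ⟨_, ⟨_, _, h2, rfl⟩, ⟨hW.eq_vcode hFW hV, ?_⟩, hrep, h4, h5, h6⟩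
          rw [List.append_nil, List.reverse_reverse]
          exact msgRel_canon hF hW hFW m h3
    · rintro r ⟨l, acts', hl, rfl⟩ ho
      -- The program is stuck if the target is a variable; the hypothesis on the target excludes the
      -- corresponding outcome of the machine.
      have hv : v.unpair.1 ≠ 0 := ho _ rfl
      cases V with
      | var x =>
        have := hW.kind _ hV
        simp [Value.code] at this
        exact absurd this hv
      | actor B =>
        rcases key with ⟨-, h2⟩ | ⟨Us, S', us, acts', h1, h2, h3, h4, h5, h6⟩
        · rw [h2] at hl; cases hl
        · rw [h2] at hl; cases hl
          refine ⟨_, _, S', .invoke h1, ⟨hW.eq_vcode hFW hV, ?_⟩, hrep, h4, h5, h6⟩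
          rw [List.append_nil, List.reverse_reverse]
          exact msgRel_canon hF hW hFW m h3
  | cond hE hE' hP hP' =>
    rename_i E E' E₀ E₀' Q Q' P P'
    have key := (ArgsRel.cons hE (.cons hE' .nil)).eval (Pr := Pr) hφ hFW hν hS []
    have hrep : ProcRep ν W Q (P.code, c.2) := ⟨P, rfl, hP⟩
    have hrep' : ProcRep ν W Q' (P'.code, c.2) := ⟨P', rfl, hP'⟩
    simp only [mem_procSteps_cond hc]
    simp only [argsTokens_cons, argsTokens_nil, List.append_nil] at key
    -- The second value is on top of the stack, hence the order in `v = u`.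
    have two : ∀ {Us us}, List.Forall₂ (fun U u => (U, u) ∈ W) Us us → [E, E'].length = Us.length →
        ∃ U V u v, Us = [U, V] ∧ us = [u, v] ∧ (U = V ↔ v = u) := by
      intro Us us h hlen
      obtain ⟨U, V, rfl⟩ := List.length_eq_two.1 hlen.symm
      obtain ⟨u, v, rfl⟩ := List.length_eq_two.1 (h.length_eq.symm.trans rfl)
      simp only [List.forall₂_cons, List.forall₂_nil_left_iff, and_true] at h
      exact ⟨U, V, u, v, rfl, rfl, (hW.bij _ h.1 _ h.2).trans eq_comm⟩
    constructor
    · intro o Q₁ S₁ h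
      rcases key with ⟨h1, -⟩ | ⟨Us, S', us, acts', h1, h2, h3, h4, h5, h6⟩
      · cases h with
        | eqMatch h => rw [h] at h1; cases h1
        | neMatch hne h => rw [h] at h1; cases h1
      · obtain ⟨U, V, u, v, rfl, rfl, huv⟩ := two h3 (valuesOf_length h1)
        refine ⟨_, ⟨_, _, h2, rfl⟩, ?_⟩
        cases h with
        | eqMatch h =>
          rw [h] at h1; cases h1
          refine ⟨trivial, ?_, h4, h5, h6⟩
          simpa [huv.1 rfl] using hrep
        | neMatch hne h =>
          rw [h] at h1; cases h1
          refine ⟨trivial, ?_, h4, h5, h6⟩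
          have : ¬ v = u := fun h => hne (huv.2 h)
          simpa [this] using hrep'
    · rintro r ⟨l, acts', hl, rfl⟩ -
      rcases key with ⟨-, h2⟩ | ⟨Us, S', us, acts', h1, h2, h3, h4, h5, h6⟩
      · rw [h2] at hl; cases hl
      · rw [h2] at hl; cases hl
        obtain ⟨U, V, u, v, rfl, rfl, huv⟩ := two h3 (valuesOf_length h1)
        by_cases hUV : U = V
        · subst hUV
          refine ⟨none, Q, S', .eqMatch h1, trivial, ?_, h4, h5, h6⟩
          simpa [huv.1 rfl] using hrep
        · refine ⟨none, Q', S', .neMatch hUV h1, trivial, ?_, h4, h5, h6⟩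
          have : ¬ v = u := fun h => hUV (huv.2 h)
          simpa [this] using hrep'
  | plus hP hP' =>
    rename_i Q Q' P P'
    have hrep : ProcRep ν W Q (P.code, c.2) := ⟨P, rfl, hP⟩
    have hrep' : ProcRep ν W Q' (P'.code, c.2) := ⟨P', rfl, hP'⟩
    simp only [mem_procSteps_plus hc]
    constructor
    · intro o Q' S' h
      cases h with
      | plusLeft => exact ⟨_, .inl rfl, trivial, hrep, hS, .refl S, .inr rfl⟩
      | plusRight => exact ⟨_, .inr rfl, trivial, hrep', hS, .refl S, .inr rfl⟩
    · rintro r (rfl | rfl) -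
      · exact ⟨none, Q, S, .plusLeft, trivial, hrep, hS, .refl S, .inr rfl⟩
      · exact ⟨none, Q', S, .plusRight, trivial, hrep', hS, .refl S, .inr rfl⟩

end


/-! ### Starting a method -/

theorem lookup_zip_forall₂ {R : Value → ℕ → Prop} (ps : List Var) (x : Var) {Us : List Value}
    {us : List ℕ} (h : List.Forall₂ R Us us) :
    ((ps.zip Us).lookup x = none ∧ (ps.zip us).lookup x = none) ∨
      ∃ U u, (ps.zip Us).lookup x = some U ∧ (ps.zip us).lookup x = some u ∧ (U, u) ∈ Us.zip us := by
  induction h generalizing ps with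
  | nil => simp
  | cons _ _ ih =>
    cases ps with
    | nil => simp
    | cons p ps =>
      simp only [List.zip_cons_cons, List.lookup_cons]
      cases x == p
      · rcases ih ps with h | ⟨U, u, h1, h2, h3⟩
        · exact .inl h
        · exact .inr ⟨U, u, h1, h2, List.mem_cons_of_mem _ h3⟩
      · exact .inr ⟨_, _, rfl, rfl, List.mem_cons_self⟩

theorem not_mem_of_lookup_zip {α β : Type*} [BEq α] [LawfulBEq α] {x : α} :
    ∀ {ps : List α} {l : List β}, ps.length = l.length → (ps.zip l).lookup x = none → x ∉ ps
  | [], _, _, _ => by simp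
  | p :: ps, [], h, _ => by simp at h
  | p :: ps, b :: l, h, hl => by
    rw [List.zip_cons_cons, List.lookup_cons] at hl
    cases hx : x == p with
    | true => rw [hx] at hl; cases hl
    | false =>
      rw [hx] at hl
      simp only [List.mem_cons, not_or]
      exact ⟨by simpa using hx, not_mem_of_lookup_zip (by simpa using h) hl⟩

/-- The instantiation of a method body is represented by the closure with which the machine starts
the method. -/
theorem procRep_instantiate {d : MethodDef} (hd : d.body.IsSource)
    (hnew : ∀ C Es, Expr.new C Es ∉ d.body.exprs) (hupd : d.body.updates = []) {F : Set Var}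
    {b : ℕ} {S : Config} (hfin : {x | S.UsedVar x}.Finite) (hF : ∀ x ∈ F, S.UsedVar x ∧ x < b)
    (A : ActorName) {Us : List Value} {m : Message} (hUs : ∀ x, .var x ∈ Us → S.UsedVar x)
    (hlen : d.params.length = Us.length) (hm : MsgRel F b ⟨d.meth, Us⟩ m) :
    ∃ W, IsMatching W ∧ diag F ⊆ W ∧ ProcRep False W (d.instantiate S A Us)
      (d.body.code, [], (0, A.vcode) :: d.params.zip m.2, b + m.2.length) := by
  obtain ⟨-, hb, W₀, hW₀, hFW, hargs⟩ := hm
  have hinf : {x | ¬ S.UsedVar x}.Infinite := hfin.infinite_compl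
  have hfresh : ∀ k, ¬ S.UsedVar (S.freshVar k) := fun k => Nat.nth_mem_of_infinite hinf k
  have hinj : Function.Injective S.freshVar := Nat.nth_injective hinf
  -- `K` is the matching of the message, cut down to used variables and to codes below the shift;
  -- `N` matches the local variables. The fresh variables are unused and their codes are not below
  -- the shift, so the union is still a matching.
  let K : Set (Value × ℕ) := {z | z ∈ W₀ ∧ (∀ x, z.1 = .var x → S.UsedVar x) ∧
    (z.2.unpair.1 = 0 → z.2.unpair.2 < b + m.2.length)}
  let N : Set (Value × ℕ) := {z | ∃ x ∈ d.localVars,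
    z = (.var (S.freshVar (d.localVars.idxOf x)), Nat.pair 0 (b + m.2.length + x))}
  have hK : diag F ⊆ K := by
    refine fun z hz => ⟨hFW hz, fun x hx => (hF x (hz.1 x hx)).1, fun h0 => ?_⟩
    obtain ⟨U | A, u⟩ := z
    · obtain ⟨h1, rfl⟩ : U ∈ F ∧ u = Nat.pair 0 U := ⟨hz.1 U rfl, hz.2⟩
      have := (hF U h1).2
      simp only [Nat.unpair_pair]
      exact lt_of_lt_of_le this (Nat.le_add_right _ _)
    · have : u = A.vcode := hz.2
      simp only [this, ActorName.unpair_vcode] at h0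
      omega
  have hKN : ∀ z ∈ K, ∀ z' ∈ N, z.1 ≠ z'.1 ∧ z.2 ≠ z'.2 := by
    rintro z ⟨-, h1, h2⟩ - ⟨x, -, rfl⟩
    refine ⟨fun h => hfresh _ (h1 _ h), fun h => ?_⟩
    rw [h] at h2
    simp at h2
  refine ⟨K ∪ N, ⟨?_, ?_⟩, hK.trans Set.subset_union_left, d.body, rfl,
    ProcRel.mapVal hd.1 (.inr hnew) hupd ?_⟩
  · rintro z (hz | hz) z' (hz' | hz')
    · exact hW₀.bij z hz.1 z' hz'.1
    · have := hKN z hz z' hz'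
      simp [this]
    · have := hKN z' hz' z hz
      simp [this.1.symm, this.2.symm]
    · obtain ⟨x, hx, rfl⟩ := hz
      obtain ⟨y, hy, rfl⟩ := hz'
      simp [hinj.eq_iff, Nat.pair_eq_pair, List.idxOf_inj hx]
  · rintro z (hz | ⟨x, -, rfl⟩)
    · exact hW₀.kind z hz.1
    · simp [Value.code]
  · rintro k (j | v) ha hc
    · exact .inl ⟨hc, rfl⟩
    · refine ⟨_, rfl, ?_⟩
      cases v with
      | actor B => exact absurd ha (hd.2 B)
      | var x =>
        simp only [Value.subst, Value.code, resolve, Nat.unpair_pair, if_true, List.lookup_cons]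
        by_cases hx : x = this
        · subst hx
          exact .inl (hK (actor_mem_diag F A))
        · have hx' : (x == 0) = false := beq_false_of_ne hx
          rw [if_neg hx, hx']
          rcases lookup_zip_forall₂ d.params x hargs with ⟨h1, h2⟩ | ⟨U, u, h1, h2, h3⟩
          · simp only [h1, h2, Option.getD_none]
            refine .inr ⟨x, ?_, rfl⟩
            have h3 := not_mem_of_lookup_zip hlen h1
            have h4 : x ∈ d.body.freeVars := List.mem_filterMap.2 ⟨_, ha, rfl⟩
            simp [MethodDef.localVars, h4, hx, h3]
          · simp only [h1, h2, Option.getD_some]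
            refine .inl ⟨(List.forall₂_iff_zip.1 hargs).2 h3, ?_, hb u (List.of_mem_zip h3).2⟩
            rintro x rfl
            exact hUs x (List.of_mem_zip h3).1

/-! ### The simulation -/

/-- The relation between configurations of the program and of the machine. The set `F` contains
the variables in stores and in the process of the root actor. -/
structure Sim (Pr : Program) (F : Set Var) (S : Config) (s : Conf) : Prop where
  acts : ActorsRel F S s.1.1
  vars : ∀ x ∈ F, x < Pr.main.code + 1
  root : ∀ st, S .root = some st → StoreRel F st.store [] ∧ ProcRep True (diag F) st.proc s.1.2
  idle : (s.2 ActorName.root.vcode).1 = (0, [], [], 0)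
  proc : ∀ C i st, S (.named C i) = some st → ∃ W, IsMatching W ∧ diag F ⊆ W ∧
    ProcRep False W st.proc (s.2 (ActorName.named C i).vcode).1
  queue : ∀ A st, S A = some st →
    List.Forall₂ (MsgRel F (Pr.main.code + 1)) st.queue (s.2 A.vcode).2
  absent : ∀ A, S A = none → s.2 A.vcode = idleState

theorem ActorsRel.isSome_iff {F : Set Var} {S : Config} {acts : Actors} (h : ActorsRel F S acts)
    (A : ActorName) : (acts.lookup A.vcode).isSome ↔ (S A).isSome := by
  cases hA : S A with
  | none => simp [h.absent A hA]
  | some st =>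
    obtain ⟨φ', h1, -⟩ := h.present A st hA
    simp [h1]

theorem ActorsRel.exists_of_lookup {F : Set Var} {S : Config} {acts : Actors}
    (h : ActorsRel F S acts) {v : ℕ} (hv : (acts.lookup v).isSome) :
    ∃ (A : ActorName) (st : ActorState), v = A.vcode ∧ S A = some st := by
  obtain ⟨e, he, rfl⟩ := lookup_isSome_iff.1 hv
  obtain ⟨A, hA⟩ := h.coded e he
  rw [hA, h.isSome_iff A] at hv
  obtain ⟨st, hst⟩ := Option.isSome_iff_exists.1 hv
  exact ⟨A, st, hA, hst⟩

theorem ActorsRel.setState {F : Set Var} {S : Config} {acts : Actors} (h : ActorsRel F S acts)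
    {A : ActorName} {st : ActorState} (hA : S A = some st) (Q : Proc) (q : List Msg) :
    ActorsRel F (Function.update S A (some ⟨Q, st.store, q⟩)) acts where
  coded := h.coded
  absent B hB := by
    by_cases hBA : B = A
    · subst hBA; simp at hB
    · exact h.absent B (by rwa [Function.update_of_ne hBA] at hB)
  present B st' hB := by
    by_cases hBA : B = A
    · subst hBA
      rw [Function.update_self, Option.some.injEq] at hB
      subst hB
      exact h.present B st hA
    · exact h.present B st' (by rwa [Function.update_of_ne hBA] at hB)
  count C i := by
    by_cases hBA : .named C i = A
    · subst hBA
      rw [← h.count, hA]; simp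
    · rw [Function.update_of_ne hBA]; exact h.count C i
  root := by
    by_cases hBA : .root = A
    · subst hBA; simp
    · rw [Function.update_of_ne hBA]; exact h.root

section
variable {Pr : Program} {F : Set Var} {S : Config} {g : MainState} {c : ℕ → LocalState}

theorem Sim.extend (h : Sim Pr F S (g, c)) {S' : Config} {acts : Actors}
    (ha : ActorsRel F S' acts) (hS : Extends S S') : Sim Pr F S' ((acts, g.2), c) where
  acts := ha
  vars := h.vars
  root st hst := by
    rcases hS.2 _ st hst with hst | ⟨h0, -⟩
    · exact h.root st hst
    · have := h.acts.root
      rw [h0] at this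
      cases this
  idle := h.idle
  proc C i st hst := by
    rcases hS.2 _ st hst with hst | ⟨h0, h1, -⟩
    · exact h.proc C i st hst
    · have h2 := h.absent _ h0
      simp only at h2 ⊢
      rw [h1, h2]
      exact ⟨diag F, isMatching_diag F, subset_rfl, .nil, rfl, .nil 0⟩
  queue A st hst := by
    rcases hS.2 _ st hst with hst | ⟨h0, -, h1⟩
    · exact h.queue A st hst
    · have h2 := h.absent _ h0
      simp only at h2 ⊢
      rw [h1, h2]
      exact .nil
  absent A hA := h.absent A (by
    by_contra hne
    obtain ⟨st, hst⟩ := Option.ne_none_iff_exists'.1 hne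
    rw [hS.1 A st hst] at hA
    cases hA)

theorem Sim.setMain (h : Sim Pr F S (g, c)) {st : ActorState} (hst : S .root = some st) {Q : Proc}
    {p : Closure} (hQ : ProcRep True (diag F) Q p) :
    Sim Pr F (Function.update S .root (some ⟨Q, st.store, st.queue⟩)) ((g.1, p), c) where
  acts := h.acts.setState hst Q st.queue
  vars := h.vars
  root st' hst' := by
    rw [Function.update_self, Option.some.injEq] at hst'
    subst hst'
    exact ⟨(h.root st hst).1, hQ⟩
  idle := h.idle
  proc C i st' hst' := h.proc C i st' (by rwa [Function.update_of_ne (by simp)] at hst')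
  queue A st' hst' := by
    by_cases hA : A = .root
    · subst hA
      rw [Function.update_self, Option.some.injEq] at hst'
      subst hst'
      exact h.queue _ st hst
    · exact h.queue A st' (by rwa [Function.update_of_ne hA] at hst')
  absent A hA := h.absent A (by
    by_cases h0 : A = .root
    · subst h0; simp at hA
    · rwa [Function.update_of_ne h0] at hA)

theorem Sim.setProc (h : Sim Pr F S (g, c)) {C : Cls} {i : ℕ} {st : ActorState}
    (hst : S (.named C i) = some st) {Q : Proc} {p : Closure} {W : Set (Value × ℕ)}
    (hW : IsMatching W) (hFW : diag F ⊆ W) (hQ : ProcRep False W Q p) {q : List Msg}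
    {q' : List Message} (hq : List.Forall₂ (MsgRel F (Pr.main.code + 1)) q q') :
    Sim Pr F (Function.update S (.named C i) (some ⟨Q, st.store, q⟩))
      (g, Function.update c (ActorName.named C i).vcode (p, q')) where
  acts := h.acts.setState hst Q q
  vars := h.vars
  root st' hst' := h.root st' (by rwa [Function.update_of_ne (by simp)] at hst')
  idle := by
    simp only
    rw [Function.update_of_ne (ActorName.vcode_injective.ne (by simp))]
    exact h.idle
  proc D j st' hst' := by
    by_cases hA : ActorName.named D j = .named C i
    · rw [hA, Function.update_self, Option.some.injEq] at hst'
      subst hst'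
      simp only
      rw [hA, Function.update_self]
      exact ⟨W, hW, hFW, hQ⟩
    · rw [Function.update_of_ne hA] at hst'
      simp only
      rw [Function.update_of_ne (ActorName.vcode_injective.ne hA)]
      exact h.proc D j st' hst'
  queue A st' hst' := by
    by_cases hA : A = .named C i
    · rw [hA, Function.update_self, Option.some.injEq] at hst'
      subst hst'
      simp only
      rw [hA, Function.update_self]
      exact hq
    · rw [Function.update_of_ne hA] at hst'
      simp only
      rw [Function.update_of_ne (ActorName.vcode_injective.ne hA)]
      exact h.queue A st' hst'
  absent A hA := by
    by_cases h0 : A = .named C i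
    · subst h0; simp at hA
    · rw [Function.update_of_ne h0] at hA
      simp only
      rw [Function.update_of_ne (ActorName.vcode_injective.ne h0)]
      exact h.absent A hA

/-- The configuration in which a message, if any, has been appended to the queue of its target. -/
def deliver : Option (ActorName × Msg) → Config → Config
  | none, S => S
  | some x, S => Function.update S x.1
      ((S x.1).map fun st => ⟨st.proc, st.store, st.queue ++ [x.2]⟩)

theorem Sim.deliver (h : Sim Pr F S (g, c)) {o : Option (ActorName × Msg)}
    {o' : Option (ℕ × Message)} (ho : SentRel F (Pr.main.code + 1) o o')
    (hS : ∀ x ∈ o, (S x.1).isSome) : Sim Pr F (deliver o S) (g, ActorSystem.send o' c) := by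
  match o, o', ho with
  | none, none, _ => exact h
  | some (B, msg), some (v, m), ho =>
    obtain ⟨hv, hm⟩ := ho
    simp only at hv hm
    subst hv
    obtain ⟨st, hst⟩ := Option.isSome_iff_exists.1 (hS _ rfl)
    simp only at hst
    have hd : ActorLang.deliver (some (B, msg)) S =
        Function.update S B (some ⟨st.proc, st.store, st.queue ++ [msg]⟩) := by
      simp [ActorLang.deliver, hst]
    rw [hd]
    cases B with
    | named C i =>
      obtain ⟨W, hW, hFW, hp⟩ := h.proc C i st hst
      exact h.setProc hst hW hFW hp (List.rel_append (h.queue _ st hst) (.cons hm .nil))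
    | root =>
      refine ⟨h.acts.setState hst _ _, h.vars, fun st' hst' => ?_, ?_, fun C i st' hst' => ?_,
        fun A st' hst' => ?_, fun A hA => ?_⟩
      · rw [Function.update_self, Option.some.injEq] at hst'
        subst hst'
        exact h.root st hst
      · simp only [ActorSystem.send, Function.update_self]
        exact h.idle
      · rw [Function.update_of_ne (by simp)] at hst'
        simp only [ActorSystem.send]
        rw [Function.update_of_ne (ActorName.vcode_injective.ne (by simp))]
        exact h.proc C i st' hst'
      · by_cases hA : A = .root
        · subst hA
          rw [Function.update_self, Option.some.injEq] at hst'
          subst hst'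
          simp only [ActorSystem.send, Function.update_self]
          exact List.rel_append (h.queue _ st hst) (.cons hm .nil)
        · rw [Function.update_of_ne hA] at hst'
          simp only [ActorSystem.send]
          rw [Function.update_of_ne (ActorName.vcode_injective.ne hA)]
          exact h.queue A st' hst'
      · by_cases h0 : A = .root
        · subst h0; simp at hA
        · rw [Function.update_of_ne h0] at hA
          simp only [ActorSystem.send]
          rw [Function.update_of_ne (ActorName.vcode_injective.ne h0)]
          exact h.absent A hA

/-- Infinitely many variables therefore remain unused, which is why `freshVar` yields pairwise
distinct unused variables. -/
theorem Sim.finite {s : Conf} (h : Sim Pr F S s) : {x | S.UsedVar x}.Finite := by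
  have hA : {A | (S A).isSome}.Finite := by
    refine Set.Finite.of_finite_image (f := ActorName.vcode) ?_
      ActorName.vcode_injective.injOn
    refine Set.Finite.subset (List.finite_toSet (s.1.1.map Prod.fst)) ?_
    rintro - ⟨A, hA, rfl⟩
    obtain ⟨e, he, h1⟩ := lookup_isSome_iff.1 ((h.acts.isSome_iff A).2 hA)
    exact h1 ▸ List.mem_map_of_mem he
  have hF : F.Finite := (Set.finite_Iio (Pr.main.code + 1)).subset fun x hx => h.vars x hx
  have hq : ∀ q : List Msg, {x | ∃ msg ∈ q, Value.var x ∈ msg.args}.Finite := by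
    intro q
    have : {x | ∃ msg ∈ q, Value.var x ∈ msg.args} =
        ⋃ msg ∈ {msg | msg ∈ q}, Value.var ⁻¹' {U | U ∈ msg.args} := by
      ext x; simp
    rw [this]
    exact (List.finite_toSet q).biUnion fun msg _ => (List.finite_toSet msg.args).preimage
      (fun x _ y _ hxy => by simpa using hxy)
  refine Set.Finite.subset (s := {this} ∪ ((⋃ A ∈ {A | (S A).isSome}, {x | ∃ st, S A = some st ∧
    (x ∈ st.proc.freeVars ∨ ∃ msg ∈ st.queue, Value.var x ∈ msg.args)}) ∪ F)) ?_ ?_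
  · refine (Set.finite_singleton _).union ((hA.biUnion fun A hA => ?_).union hF)
    obtain ⟨st, hst⟩ := Option.isSome_iff_exists.1 hA
    refine ((List.finite_toSet st.proc.freeVars).union (hq st.queue)).subset ?_
    rintro x ⟨st', hst', hx⟩
    rw [hst, Option.some.injEq] at hst'
    subst hst'
    exact hx
  · rintro x (hx | ⟨A, st, hst, hx⟩)
    · exact .inl hx
    · have hm : A ∈ {A | (S A).isSome} := by simp [hst]
      rcases hx with hx | ⟨f, hf⟩ | hx
      · exact .inr (.inl (Set.mem_biUnion hm ⟨st, hst, .inl hx⟩))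
      · obtain ⟨φ', -, hφ⟩ := h.acts.present A st hst
        exact .inr (.inr (((hφ f).2 _ hf).1 x rfl))
      · exact .inr (.inl (Set.mem_biUnion hm ⟨st, hst, .inr hx⟩))

/-- Only the used variables in `F` matter. -/
theorem Sim.restrict {s : Conf} (h : Sim Pr F S s) : Sim Pr (F ∩ {x | S.UsedVar x}) S s := by
  have hF : F ∩ {x | S.UsedVar x} ⊆ F := Set.inter_subset_left
  refine ⟨⟨h.acts.coded, h.acts.absent, fun A st hst => ?_, h.acts.count, h.acts.root⟩,
    fun x hx => h.vars x hx.1, fun st hst => ?_, h.idle, fun C i st hst => ?_,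
    fun A st hst => (h.queue A st hst).imp fun _ _ hm => hm.restrict hF, h.absent⟩
  · obtain ⟨φ', h1, h2⟩ := h.acts.present A st hst
    exact ⟨φ', h1, h2.restrict fun f x hf hx => ⟨hx, .inr ⟨A, st, hst, .inr (.inl ⟨f, hf⟩)⟩⟩⟩
  · obtain ⟨h1, P, hP, h2⟩ := h.root st hst
    refine ⟨h1.restrict fun f x hf hx => ⟨hx, .inr ⟨.root, st, hst, .inr (.inl ⟨f, hf⟩)⟩⟩,
      P, hP, h2.restrict fun k a b ha hab => ?_⟩
    have key : ∀ {U u}, a = .val U → (U, u) ∈ diag F → (U, u) ∈ diag (F ∩ {x | S.UsedVar x}) := by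
      rintro U u rfl hU
      refine ⟨fun x hx => ⟨hU.1 x hx, .inr ⟨.root, st, hst, .inl ?_⟩⟩, hU.2⟩
      simp only at hx
      subst hx
      exact List.mem_filterMap.2 ⟨_, ha, rfl⟩
    cases b with
    | bound j =>
      exact hab.imp id fun ⟨hk, U, u, h3, h4, h5⟩ => ⟨hk, U, u, h3, h4, key h3 h5⟩
    | val v => exact hab.imp fun U hU => ⟨hU.1, key hU.1 hU.2⟩
  · obtain ⟨W, h1, h2, h3⟩ := h.proc C i st hst
    exact ⟨W, h1, (diag_mono hF).trans h2, h3⟩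

end


section
variable {Pr : Program} {F : Set Var} {S : Config}

theorem ActorsRel.known_iff {acts : Actors} (h : ActorsRel F S acts) {b : ℕ}
    {o : Option (ActorName × Msg)} {o' : Option (ℕ × Message)} (ho : SentRel F b o o') :
    Known acts o' ↔ ∀ x ∈ o, (S x.1).isSome := by
  match o, o', ho with
  | none, none, _ => simp [Known]
  | some (B, msg), some (v, m), ho =>
    have hv : v = B.vcode := ho.1
    subst hv
    have := h.isSome_iff B
    simpa only [Known, Option.toList_some, List.mem_singleton, forall_eq, Option.mem_some_iff,
      forall_eq'] using this

theorem ActorsRel.unpair_ne_zero {acts : Actors} (h : ActorsRel F S acts)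
    {o : Option (ℕ × Message)} (ho : Known acts o) : ∀ x ∈ o, x.1.unpair.1 ≠ 0 := by
  intro x hx
  obtain ⟨A, -, hA, -⟩ := h.exists_of_lookup (ho x (Option.mem_toList.2 hx))
  rw [hA, ActorName.unpair_vcode]
  omega

theorem isSome_update {S S' : Config} (h : Extends S S') (A : ActorName) (st : ActorState)
    {o : Option (ActorName × Msg)} (ho : ∀ x ∈ o, (S x.1).isSome) :
    ∀ x ∈ o, (Function.update S' A (some st) x.1).isSome := by
  intro x hx
  by_cases hA : x.1 = A
  · rw [hA]; simp
  · obtain ⟨st', hst'⟩ := Option.isSome_iff_exists.1 (ho x hx)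
    rw [Function.update_of_ne hA, h.1 _ _ hst']; rfl

/-- The machine simulates the steps of the processes. -/
theorem Sim.move_of_localStep {s : Conf} (h : Sim Pr F S s) {A : ActorName} {st : ActorState}
    (hA : S A = some st) {o : Option (ActorName × Msg)} {Q : Proc} {S' : Config}
    (hl : LocalStep Pr st.store S st.proc o Q S') (ho : ∀ x ∈ o, (S x.1).isSome) :
    ∃ s', Move Pr.code s s' ∧ Extends S S' ∧
      Sim Pr F (ActorLang.deliver o (Function.update S' A (some ⟨Q, st.store, st.queue⟩))) s' := by
  obtain ⟨g, c⟩ := s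
  cases A with
  | root =>
    obtain ⟨hφ, hp⟩ := h.root st hA
    obtain ⟨⟨o', p, acts⟩, hr, hsent, hrep, hacts, hext, -⟩ :=
      (hp.steps (isMatching_diag F) hφ subset_rfl (fun _ => subset_rfl) h.vars h.acts).1 o Q S' hl
    refine ⟨_, .main g c o' p acts hr ((h.acts.known_iff hsent).2 ho), hext, ?_⟩
    exact ((h.extend hacts hext).setMain (hext.1 _ _ hA) hrep).deliver hsent
      (isSome_update hext _ _ ho)
  | named C i =>
    obtain ⟨φ', hv, hφ⟩ := h.acts.present _ st hA
    obtain ⟨W, hW, hFW, hp⟩ := h.proc C i st hA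
    obtain ⟨⟨o', p, acts⟩, hr, hsent, hrep, hacts, hext, hS⟩ :=
      (hp.steps hW hφ hFW False.elim h.vars h.acts).1 o Q S' hl
    obtain rfl := hS.resolve_left id
    refine ⟨_, .proc g c _ φ' o' p acts hv hr ((h.acts.known_iff hsent).2 ho), hext, ?_⟩
    exact (h.setProc hA hW hFW hrep (h.queue _ st hA)).deliver hsent (isSome_update hext _ _ ho)

theorem step_of_localStep {A : ActorName} {st : ActorState} (hA : S A = some st)
    {o : Option (ActorName × Msg)} {Q : Proc} {S' : Config}
    (hl : LocalStep Pr st.store S st.proc o Q S') (hS : Extends S S')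
    (ho : ∀ x ∈ o, (S x.1).isSome) :
    Step Pr S (deliver o (Function.update S' A (some ⟨Q, st.store, st.queue⟩))) := by
  obtain ⟨P, φ, q⟩ := st
  simp only at hl
  cases hl with
  | letIn hE => exact .letIn _ _ _ _ _ _ _ _ hA (eval_of_valueOf hE)
  | invoke hE =>
    rename_i B m Es Us
    have hE := evalList_of_valuesOf hE
    by_cases hAB : A = B
    · subst hAB
      simpa [deliver] using Step.invokeSelf _ _ _ _ _ _ _ _ _ hA hE
    · obtain ⟨⟨Q', ψ, r⟩, hB⟩ := Option.isSome_iff_exists.1 (ho _ rfl)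
      simp only at hB
      have := Step.invoke _ _ _ _ _ _ _ _ _ _ _ _ _ hAB hA hB hE
      simpa [deliver, Function.update_of_ne (Ne.symm hAB), hS.1 _ _ hB] using this
  | eqMatch hE => exact .eqMatch _ _ _ _ _ _ _ _ _ _ hA (evalList_of_valuesOf hE)
  | neMatch hne hE => exact .neMatch _ _ _ _ _ _ _ _ _ _ _ hne hA (evalList_of_valuesOf hE)
  | plusLeft => exact .plusLeft _ _ _ _ _ _ hA
  | plusRight => exact .plusRight _ _ _ _ _ _ hA

theorem mem_starts_code {v : ℕ} {m : Message} {p : Closure} : p ∈ starts Pr.code v m ↔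
    ∃ d ∈ Pr.defs, hasClass v d.cls ∧ d.meth = m.1 ∧ d.params.length = m.2.length ∧
      p = (d.body.code, [], (0, v) :: d.params.zip m.2, Pr.main.code + 1 + m.2.length) := by
  simp only [starts, Program.code, Nat.unpair_pair, ofNat_codeList, List.mem_map, List.mem_filter,
    decide_eq_true_eq]
  constructor
  · rintro ⟨-, ⟨⟨d, hd, rfl⟩, h1, h2, h3⟩, rfl⟩
    simp only [MethodDef.code, Nat.unpair_pair, ofNat_codeList, codeLength_codeList] at h1 h2 h3 ⊢
    exact ⟨d, hd, h1, h2, h3, rfl⟩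
  · rintro ⟨d, hd, h1, h2, h3, rfl⟩
    refine ⟨d.code, ⟨⟨d, hd, rfl⟩, ?_⟩, ?_⟩ <;>
      simp [MethodDef.code, ofNat_codeList, h1, h2, h3]

/-- A variable of `F` may have disappeared from the configuration, and then the program may choose
it for a local variable of the method. So `F` has to be cut down to the used variables before the
method is instantiated. -/
theorem Sim.start (hwf : Pr.WellFormed) (hb : Pr.BoundedActors) (hro : Pr.ReadOnly) {g : MainState}
    {c : ℕ → LocalState} (h : Sim Pr F S (g, c)) {C : Cls} {i : ℕ} {d : MethodDef} {φ : Store}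
    {Us : List Value} {q : List Msg} (hd : d ∈ Pr.defs) (hlen : d.params.length = Us.length)
    (hA : S (.named C i) = some ⟨.nil, φ, ⟨d.meth, Us⟩ :: q⟩) {m : Message} {q' : List Message}
    (hq : (c (ActorName.named C i).vcode).2 = m :: q') :
    Sim Pr (F ∩ {x | S.UsedVar x}) (Function.update S (.named C i)
        (some ⟨d.instantiate S (.named C i) Us, φ, q⟩))
      (g, Function.update c (ActorName.named C i).vcode ((d.body.code, [],
        (0, (ActorName.named C i).vcode) :: d.params.zip m.2,
          Pr.main.code + 1 + m.2.length), q')) := by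
  have h' := h.restrict
  have hQ := h'.queue _ _ hA
  simp only [hq, List.forall₂_cons] at hQ
  obtain ⟨W, hW, hFW, hrep⟩ := procRep_instantiate (hwf.body_source d hd) (hb d hd) (hro.2 d hd)
    h.finite (fun x hx => ⟨hx.2, h.vars x hx.1⟩) (.named C i)
    (fun x hx => .inr ⟨_, _, hA, .inr (.inr ⟨_, List.mem_cons_self, hx⟩)⟩) hlen hQ.1
  exact h'.setProc hA hW hFW hrep hQ.2

theorem Sim.not_upd {s : Conf} (h : Sim Pr F S s) {A : ActorName} {f : Fld} {E : Expr} {P : Proc}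
    {φ : Store} {q : List Msg} (hA : S A = some ⟨.upd f E P, φ, q⟩) : False := by
  cases A with
  | root => obtain ⟨-, P', -, h⟩ := h.root _ hA; cases h
  | named C i => obtain ⟨W, -, -, P', -, h⟩ := h.proc C i _ hA; cases h

/-- The machine simulates the steps of the program. -/
theorem Sim.move_of_step (hwf : Pr.WellFormed) (hb : Pr.BoundedActors) (hro : Pr.ReadOnly)
    {s : Conf} (h : Sim Pr F S s) {T : Config} (hT : Step Pr S T) :
    ∃ F' s', Move Pr.code s s' ∧ Sim Pr F' T s' := by
  cases hT with
  | upd S' A f E P φ q U hA => exact (h.not_upd hA).elim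
  | letIn S' A E P φ q U hA hE =>
    obtain ⟨s', hm, -, hs⟩ := h.move_of_localStep hA (.letIn (valueOf_of_eval hE)) (by simp)
    exact ⟨F, s', hm, hs⟩
  | invokeSelf S' A m Es P φ q Us hA hE =>
    obtain ⟨s', hm, -, hs⟩ := h.move_of_localStep hA (.invoke (valuesOf_of_evalList hE))
      (by simp [hA])
    exact ⟨F, s', hm, by simpa [ActorLang.deliver] using hs⟩
  | invoke S' A B m Es P Q φ ψ q r Us hAB hA hB hE =>
    obtain ⟨s', hm, hS, hs⟩ := h.move_of_localStep hA (.invoke (valuesOf_of_evalList hE))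
      (by simp [hB])
    refine ⟨F, s', hm, ?_⟩
    simpa [ActorLang.deliver, Function.update_of_ne (Ne.symm hAB), hS.1 _ _ hB] using hs
  | inst C i d φ Us q hd hC hlen hA =>
    obtain ⟨g, c⟩ := s
    have hq := h.queue _ _ hA
    obtain ⟨m, q', hm, -, hmq⟩ := List.forall₂_cons_left_iff.1 hq
    simp only at hmq
    have hcode : (c (ActorName.named C i).vcode).1.1 = 0 := by
      obtain ⟨W, -, -, P, hP, hrel⟩ := h.proc C i _ hA
      cases hrel
      exact hP
    have hlen' : Us.length = m.2.length := by
      obtain ⟨-, -, W, -, -, hW⟩ := hm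
      exact hW.length_eq
    refine ⟨_, _, .start g c _ m q' _ ?_ hcode hmq (mem_starts_code.2 ⟨d, hd, ?_, hm.1.symm,
      hlen.trans hlen', rfl⟩), h.start hwf hb hro hd hlen hA hmq⟩
    · exact (h.acts.isSome_iff _).2 (by simp [hA])
    · exact hasClass_named.2 hC.symm
  | eqMatch S' A E E' P Q φ q U hA hE =>
    obtain ⟨s', hm, -, hs⟩ := h.move_of_localStep hA (.eqMatch (valuesOf_of_evalList hE)) (by simp)
    exact ⟨F, s', hm, hs⟩
  | neMatch S' A E E' P Q φ q U V hUV hA hE =>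
    obtain ⟨s', hm, -, hs⟩ := h.move_of_localStep hA (.neMatch hUV (valuesOf_of_evalList hE))
      (by simp)
    exact ⟨F, s', hm, hs⟩
  | plusLeft A P Q φ q hA =>
    obtain ⟨s', hm, -, hs⟩ := h.move_of_localStep hA .plusLeft (by simp)
    exact ⟨F, s', hm, hs⟩
  | plusRight A P Q φ q hA =>
    obtain ⟨s', hm, -, hs⟩ := h.move_of_localStep hA .plusRight (by simp)
    exact ⟨F, s', hm, hs⟩

theorem Proc.eq_nil_of_code {P : Proc} (h : P.code = 0) : P = .nil := by
  have := congrArg (fun n => n.unpair.1) h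
  cases P <;> simp [Proc.code] at this
  rfl

/-- The program simulates the moves of the machine. -/
theorem Sim.step_of_move (hwf : Pr.WellFormed) (hb : Pr.BoundedActors) (hro : Pr.ReadOnly)
    {s s' : Conf} (h : Sim Pr F S s) (hm : Move Pr.code s s') :
    ∃ F' T, Step Pr S T ∧ Sim Pr F' T s' := by
  cases hm with
  | main g c o p acts hp ho =>
    obtain ⟨st, hA⟩ := Option.isSome_iff_exists.1 h.acts.root
    obtain ⟨hφ, hp'⟩ := h.root st hA
    obtain ⟨o', Q, S', hl, hsent, hrep, hacts, hext, -⟩ :=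
      (hp'.steps (isMatching_diag F) hφ subset_rfl (fun _ => subset_rfl) h.vars h.acts).2 _ hp
        (h.acts.unpair_ne_zero ho)
    have ho' := (h.acts.known_iff hsent).1 ho
    exact ⟨F, _, step_of_localStep hA hl hext ho', ((h.extend hacts hext).setMain
      (hext.1 _ _ hA) hrep).deliver hsent (isSome_update hext _ _ ho')⟩
  | proc g c v φ o p acts hv hp ho =>
    obtain ⟨A, st, rfl, hA⟩ := h.acts.exists_of_lookup (Option.isSome_iff_exists.2 ⟨φ, hv⟩)
    cases A with
    | root =>
      -- The process of the root is kept in the main state; as an entry among the actors the root is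
      -- always idle.
      have := h.idle
      simp only at this
      exact absurd hp (mem_procSteps_nil (by rw [this]; rfl))
    | named C i =>
      obtain ⟨φ', hv', hφ⟩ := h.acts.present _ st hA
      obtain rfl : φ' = φ := by simpa using hv'.symm.trans hv
      obtain ⟨W, hW, hFW, hp'⟩ := h.proc C i st hA
      obtain ⟨o', Q, S', hl, hsent, hrep, hacts, hext, hS⟩ :=
        (hp'.steps hW hφ hFW False.elim h.vars h.acts).2 _ hp (h.acts.unpair_ne_zero ho)
      obtain rfl := hS.resolve_left id
      have ho' := (h.acts.known_iff hsent).1 ho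
      exact ⟨F, _, step_of_localStep hA hl hext ho',
        (h.setProc hA hW hFW hrep (h.queue _ st hA)).deliver hsent (isSome_update hext _ _ ho')⟩
  | start g c v m q p hv hi hq hp =>
    obtain ⟨A, ⟨P, φ, qs⟩, rfl, hA⟩ := h.acts.exists_of_lookup hv
    obtain ⟨d, hd, hC, hmeth, hlen, rfl⟩ := mem_starts_code.1 hp
    cases A with
    | root => exact absurd hC not_hasClass_root
    | named C i =>
      have hC := hasClass_named.1 hC
      obtain rfl : P = .nil := by
        obtain ⟨W, -, -, P', hP', hrel⟩ := h.proc C i _ hA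
        simp only at hP'
        rw [hi] at hP'
        obtain rfl := Proc.eq_nil_of_code hP'.symm
        cases hrel
        rfl
      have hQ := h.queue _ _ hA
      simp only [hq] at hQ
      obtain ⟨⟨meth, Us⟩, qs', hmsg, -, rfl⟩ := List.forall₂_cons_right_iff.1 hQ
      obtain rfl : d.meth = meth := hmeth.trans hmsg.1
      have hlen' : d.params.length = Us.length := by
        obtain ⟨-, -, W, -, -, hW⟩ := hmsg
        exact hlen.trans hW.length_eq.symm
      exact ⟨_, _, .inst S C i d φ Us qs' hd hC.symm hlen' hA,
        h.start hwf hb hro hd hlen' hA hq⟩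

end

/-! ### Initial and accepting configurations -/

theorem Atom.code_val_le (x : Var) : x ≤ (Atom.val (.var x)).code := by
  exact (Nat.right_le_pair 0 x).trans (Nat.right_le_pair 1 _)

mutual
theorem var_le_code_expr (x : Var) : ∀ E : Expr, Expr.atom (.val (.var x)) ∈ E.subs → x ≤ E.code
  | .atom a, h => by
    simp only [Expr.subs, List.mem_singleton, Expr.atom.injEq] at h
    subst h
    exact (Atom.code_val_le x).trans (Nat.right_le_pair _ _)
  | .field f, h => by simp [Expr.subs] at h
  | .new C Es, h => by
    have h := var_le_code_args x Es (by simpa [Expr.subs] using h)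
    exact h.trans ((Nat.right_le_pair _ _).trans (Nat.right_le_pair _ _))
theorem var_le_code_args (x : Var) : ∀ Es : List Expr,
    Expr.atom (.val (.var x)) ∈ Expr.subsList Es → x ≤ Expr.codeArgs Es
  | [], h => by simp [Expr.subsList] at h
  | E :: Es, h => by
    rw [Expr.subsList, List.mem_append] at h
    rw [Expr.codeArgs]
    rcases h with h | h
    · exact ((var_le_code_expr x E h).trans (Nat.left_le_pair _ _)).trans (Nat.le_succ _)
    · exact ((var_le_code_args x Es h).trans (Nat.right_le_pair _ _)).trans (Nat.le_succ _)
end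

/-- This is why `Pr.main.code + 1` separates the variables of the main process from those that may
be renamed. -/
theorem var_le_code (x : Var) (P : Proc) :
    Expr.atom (.val (.var x)) ∈ P.exprs → x ≤ P.code := by
  have hr : ∀ {a b : ℕ}, x ≤ b → x ≤ Nat.pair a b := fun h => h.trans (Nat.right_le_pair _ _)
  have hl : ∀ {a b : ℕ}, x ≤ a → x ≤ Nat.pair a b := fun h => h.trans (Nat.left_le_pair _ _)
  induction P with
  | nil => simp [Proc.exprs]
  | upd f E P ih =>
    simp only [Proc.exprs, List.mem_append, Proc.code]
    rintro (h | h)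
    · exact hr (hr (hl (var_le_code_expr x E h)))
    · exact hr (hr (hr (ih h)))
  | letIn E P ih =>
    simp only [Proc.exprs, List.mem_append, Proc.code]
    rintro (h | h)
    · exact hr (hl (var_le_code_expr x E h))
    · exact hr (hr (ih h))
  | invoke y m Es P ih =>
    simp only [Proc.exprs, List.mem_append, Proc.code, List.mem_cons, Expr.atom.injEq]
    rintro (rfl | h | h)
    · exact hr (hl (Atom.code_val_le x))
    · exact hr (hr (hr (hl (var_le_code_args x Es h))))
    · exact hr (hr (hr (hr (ih h))))
  | cond E E' P Q ih ih' =>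
    simp only [Proc.exprs, List.mem_append, Proc.code]
    rintro (((h | h) | h) | h)
    · exact hr (hl (var_le_code_expr x E h))
    · exact hr (hr (hl (var_le_code_expr x E' h)))
    · exact hr (hr (hr (hl (ih h))))
    · exact hr (hr (hr (hr (ih' h))))
  | plus P Q ih ih' =>
    simp only [Proc.exprs, List.mem_append, Proc.code]
    rintro (h | h)
    · exact hr (hl (ih h))
    · exact hr (hr (ih' h))

theorem sim_initial {Pr : Program} (hwf : Pr.WellFormed) (hro : Pr.ReadOnly) :
    Sim Pr {x | Expr.atom (.val (.var x)) ∈ Pr.main.exprs} Pr.initial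
      (initialMachine Pr.code).conf := by
  have hb : Pr.code.unpair.1 = Pr.main.code := by simp [Program.code]
  have hroot : Nat.pair 1 0 = ActorName.root.vcode := rfl
  have hstore : ∀ F, StoreRel F (fun _ => none) [] := fun F f => ⟨rfl, by simp⟩
  simp only [initialMachine, Machine.conf, stateAt_nil, hb, hroot]
  refine ⟨⟨?_, ?_, ?_, ?_, rfl⟩, fun x hx => Nat.lt_succ_of_le (var_le_code x _ hx), ?_, rfl, ?_,
    ?_, fun _ _ => rfl⟩
  · intro e he
    exact ⟨.root, by rw [List.mem_singleton.1 he]⟩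
  · rintro (_ | ⟨C, i⟩) hA
    · simp [Program.initial] at hA
    · have h1 : ((ActorName.named C i).vcode == ActorName.root.vcode) = false :=
        beq_false_of_ne (ActorName.vcode_injective.ne (by simp))
      simp [List.lookup_cons, h1]
  · rintro (_ | ⟨C, i⟩) st hA
    · simp only [Program.initial, Option.some.injEq] at hA
      subst hA
      exact ⟨[], by simp, hstore _⟩
    · simp [Program.initial] at hA
  · intro C i
    simp [Program.initial, classCount, not_hasClass_root]
  · intro st hA
    simp only [Program.initial, Option.some.injEq] at hA
    subst hA
    refine ⟨hstore _, Pr.main, rfl, ?_⟩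
    have := ProcRel.mapVal (ν := True)
      (R := AtomRel (diag {x | Expr.atom (.val (.var x)) ∈ Pr.main.exprs})
        (Pr.main.code, [], [], 0)) (g := id) hwf.main_source.1 (.inl trivial) hro.1 ?_
    · rwa [mapVal_id] at this
    · rintro k (j | v) ha hc
      · exact .inl ⟨hc, rfl⟩
      · refine ⟨v, rfl, ?_⟩
        cases v with
        | actor A => exact absurd ha (hwf.main_source.2 A)
        | var x =>
          refine ⟨fun y hy => ?_, by simp [resolve, Value.code]⟩
          obtain rfl : x = y := by simpa using hy
          exact ha
  · intro C i st hA
    simp [Program.initial] at hA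
  · rintro (_ | ⟨C, i⟩) st hA
    · simp only [Program.initial, Option.some.injEq] at hA
      subst hA
      exact .nil
    · simp [Program.initial] at hA

theorem ProcRep.tokens {ν : Prop} {W : Set (Value × ℕ)} {Q : Proc} {c : Closure}
    (h : ProcRep ν W Q c) : List.Forall₂ (TokRel W) Q.ser (closureTokens c) := by
  obtain ⟨P, hP, h⟩ := h
  have := h.tokens
  rwa [closeTokenAt_zero, ← hP] at this

theorem Sim.accepts_iff {Pr : Program} {F : Set Var} {S : Config} {s : Conf} (h : Sim Pr F S s)
    {P : Proc} (hP : P.LocallyClosed) :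
    s.Accepts P.code ↔ ∃ A st, S A = some st ∧ P.EqUpToRenaming st.proc := by
  constructor
  · rintro (hm | ⟨e, he, hne, hm⟩)
    · obtain ⟨st, hA⟩ := Option.isSome_iff_exists.1 h.acts.root
      exact ⟨.root, st, hA,
        (closureMatches_iff hP (isMatching_diag F) (h.root st hA).2.tokens).1 hm⟩
    · obtain ⟨A, st, hA, hst⟩ := h.acts.exists_of_lookup (lookup_isSome_iff.2 ⟨e, he, rfl⟩)
      rw [hA] at hm hne
      cases A with
      | root => exact absurd rfl hne
      | named C i =>
        obtain ⟨W, hW, -, hrep⟩ := h.proc C i st hst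
        exact ⟨_, st, hst, (closureMatches_iff hP hW hrep.tokens).1 hm⟩
  · rintro ⟨A, st, hA, hm⟩
    cases A with
    | root =>
      exact .inl ((closureMatches_iff hP (isMatching_diag F) (h.root st hA).2.tokens).2 hm)
    | named C i =>
      obtain ⟨W, hW, -, hrep⟩ := h.proc C i st hA
      obtain ⟨e, he, he'⟩ := lookup_isSome_iff.1 ((h.acts.isSome_iff (.named C i)).2 (by simp [hA]))
      refine .inr ⟨e, he, ?_, ?_⟩
      · rw [he']
        exact ActorName.vcode_injective.ne (a₂ := .root) (by simp)
      · rw [he']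
        exact (closureMatches_iff hP hW hrep.tokens).2 hm

-- Correctness of the bounded search

theorem exists_moves_of_reflTransGen {Pr : Program} (hwf : Pr.WellFormed) (hb : Pr.BoundedActors)
    (hro : Pr.ReadOnly) {T : Config} (h : Relation.ReflTransGen (Step Pr) Pr.initial T) :
    ∃ k F s, Moves Pr.code k (initialMachine Pr.code).conf s ∧ Sim Pr F T s := by
  induction h with
  | refl => exact ⟨0, _, _, .refl _, sim_initial hwf hro⟩
  | tail _ hT ih =>
    obtain ⟨k, F, s, hm, hs⟩ := ih
    obtain ⟨F', s', hm', hs'⟩ := hs.move_of_step hwf hb hro hT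
    exact ⟨k + 1, F', s', hm.tail hm', hs'⟩

theorem exists_reflTransGen_of_moves {Pr : Program} (hwf : Pr.WellFormed) (hb : Pr.BoundedActors)
    (hro : Pr.ReadOnly) {k : ℕ} {s : Conf} (h : Moves Pr.code k (initialMachine Pr.code).conf s) :
    ∃ F T, Relation.ReflTransGen (Step Pr) Pr.initial T ∧ Sim Pr F T s := by
  generalize hs₀ : (initialMachine Pr.code).conf = s₀ at h
  induction h with
  | refl => subst hs₀; exact ⟨_, _, .refl, sim_initial hwf hro⟩
  | tail _ hm ih =>
    obtain ⟨F, T, hT, hs⟩ := ih hs₀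
    obtain ⟨F', T', hT', hs'⟩ := hs.step_of_move hwf hb hro hm
    exact ⟨F', T', hT.tail hT', hs'⟩

/-- The process with the code `x.2` is reachable by the program with the code `x.1`. -/
def MachineReaches (x : ℕ × ℕ) : Prop := ∃ S ∈ explore x.1 (moveBound x.1), Accepts x.2 S

theorem primrecPred_machineReaches : PrimrecPred MachineReaches := by
  unfold MachineReaches moveBound messageBound
  fun_prop

/-- What the search finds can be replayed by the program. Conversely, a run of the program yields a
run of the machine of unknown length, and `exists_moves_le` replaces it by one within the bound of
the search. -/
theorem machineReaches_iff {Pr : Program} {P : Proc} (hwf : Pr.WellFormed)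
    (hb : Pr.BoundedActors) (hro : Pr.ReadOnly) (hP : P.LocallyClosed) :
    MachineReaches (Pr.code, P.code) ↔ Pr.ReachesProc P := by
  constructor
  · rintro ⟨S, hS, hacc⟩
    obtain ⟨j, -, hm⟩ := exists_mem_explore_iff.1 ⟨S, hS, rfl⟩
    obtain ⟨F, T, hT, hs⟩ := exists_reflTransGen_of_moves hwf hb hro hm
    exact ⟨T, hT, (hs.accepts_iff hP).1 hacc⟩
  · rintro ⟨T, hT, hacc⟩
    obtain ⟨k, F, s, hm, hs⟩ := exists_moves_of_reflTransGen hwf hb hro hT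
    obtain ⟨j, hj, s', hm', hacc'⟩ := exists_moves_le (Pr.ok hwf hb) hm ((hs.accepts_iff hP).2 hacc)
    obtain ⟨S, hS, rfl⟩ := exists_mem_explore_iff.2 ⟨j, hj, hm'⟩
    exact ⟨S, hS, hacc'⟩

end ActorLang

theorem mainTheorem6 :
    ∃ decider : ℕ × ℕ → Bool, Computable decider ∧
      ∀ (Pr : ActorLang.Program) (P : ActorLang.Proc),
        Pr.WellFormed → Pr.BoundedActors → Pr.ReadOnly → P.LocallyClosed →
          (decider (Pr.code, P.code) = true ↔ Pr.ReachesProc P) := by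
  obtain ⟨_, h⟩ := ActorLang.primrecPred_machineReaches
  refine ⟨fun x => decide (ActorLang.MachineReaches x), h.to_comp, fun Pr P hwf hb hro hP => ?_⟩
  rw [decide_eq_true_iff]
  exact ActorLang.machineReaches_iff hwf hb hro hP
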